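/- **Notation.** For $|q|<1$ put $(a)_\infty=\prod_{n\ge 0}(1-aq^n)$; let $\eta(z)=e^{\pi i z/12}\prod_{n\ge1}(1-e^{2\pi i nz})$. For $x\in\mathbb R$ let $((x))=x-\lfloor x\rfloor-\frac12$ if $x\notin\mathbb Z$ and $((x))=0$ if $x\in\mathbb Z$, and let $$\omega_{h,k}=\exp\Big(\pi i\sum_{\mu \bmod k}\Big(\Big(\frac{\mu}{k}\Big)\Big)\Big(\Big(\frac{h\mu}{k}\Big)\Big)\Big).$$ For a complex number $r$ define $$\mathcal O_r(q)=4\,\frac{(-q)_\infty}{(q)_\infty}\sum_{n\in\mathbb Z}(-1)^{n+1}\frac{q^{n^2}}{1+e^{2\pi i r}q^n},$$ and, for $\operatorname{Im} z>0$ and $q=e^{2\pi i z}$, $$\mathcal U_r(q)=\mathcal U_r(z)=e^{\pi i r}\,\frac{\eta(z)}{\eta^2(2z)}\sum_{m\ \mathrm{odd}}\frac{q^{\frac12(m^2+m)}}{1-e^{2\pi i r}q^m}.$$ Let $\widetilde k\in\{0,1\}$ be the parity of $k$, and for $\nu\in\mathbb Z$, $r\in\mathbb R$, $\operatorname{Re}(w)>0$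 let $$I^{\pm}_{k,\nu,r}(w)=\int_{\mathbb R}\frac{e^{-2\pi w x^2/k}}{1+e^{\pm\frac{2\pi i\nu}{k}\mp\frac{\pi i\widetilde k}{2k}+2\pi i r-\frac{2\pi w x}{k}}}\,dx,$$ where for $k$ even the integral is the principal value at $x=0$, i.e. $\lim_{\varepsilon\to0^+}\int_{|x|>\varepsilon}$. Powers of $w$ are principal, and $\operatorname{sgn}(r)\in\{-1,0,1\}$ is the sign of $r$. **Theorem 4.1.** Let $k$ be a positive integer. There is $\delta>0$ such that the following holds for all integers $h,h'$ with $hh'\equiv-1\pmod k$, all $w\in\mathbb C$ with $\operatorname{Re}(w)>0$ and all $r\in\mathbb R$ with $|r|<\delta$. Put $$q=e^{\frac{2\pi i}{k}(h+iw)},\qquad q_1=e^{\frac{2\pi i}{k}\left(h'+\frac iw\right)},\qquad q_1^{1/2}=e^{\frac{\pi i}{k}\left(h'+\frac iw\right)}$$ (so $\mathcal U_r(q_1^{1/2})$ is $\mathcal U_r(z)$ at $z=\frac1{2k}(h'+\frac iw)$). All denominators in the series below are nonzero, and these series converge absolutely. The integrals exist: they converge absolutely if $k$ is odd or $r\neq0$,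 and exist as principal values if $k$ is even. (1) If $k$ is odd and $h'$ is chosen even, then $$\mathcal O_r(q)=-2\sqrt2\,i\,w^{-\frac12}\frac{\omega_{h,k}^2}{\omega_{2h,k}}\,e^{\frac{\pi i h'}{8k}+\frac{2\pi k r^2}{w}}\,\mathcal U_{\frac{ir}{w}}\big(q_1^{\frac12}\big)-2\sqrt2\,w^{\frac12}\,\frac{\omega_{h,k}^2}{\omega_{2h,k}}\,\frac1k\sum_{\nu\bmod k}e^{\frac{2\pi i h'}{k}\left(-\nu^2+\frac{\nu}{2}\right)}\big(I^+_{k,\nu,r}(w)+I^-_{k,\nu,r}(w)\big).$$ (2) If $k$ is even, then $$\mathcal O_r(q)=-i\,\frac{\omega_{h,k}^2}{\omega_{h,k/2}}\,w^{-\frac12}e^{\frac{2\pi k r^2}{w}}\Big(\mathcal O_{\frac{r}{iw}}(q_1)+2\big(1-\operatorname{sgn}(r)\big)\Big)-\frac{4\,\omega_{h,k}^2\,w^{\frac12}}{k\,\omega_{h,k/2}}\sum_{\nu\bmod k}(-1)^\nu e^{-\frac{2\pi i h'\nu^2}{k}}I^+_{k,\nu,r}(w).$$ In particular, for $r>0$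 the bracket is just $\mathcal O_{\frac r{iw}}(q_1)$. -/

import Mathlib

open Complex Filter Topology MeasureTheory

noncomputable section

namespace OverpartitionRank

/-- The sawtooth function `((x))`: `x - ⌊x⌋ - 1/2` for non-integral `x`, and `0` on integers. -/
def sawtooth (x : ℝ) : ℝ :=
  if Int.fract x = 0 then 0 else x - ⌊x⌋ - 1 / 2

/-- `ω_{h,k} = exp (π i ∑_{μ mod k} ((μ/k)) ((hμ/k)))`. -/
def omega (h : ℤ) (k : ℕ) : ℂ :=
  exp (Real.pi * I *
    ((∑ μ ∈ Finset.range k, sawtooth ((μ : ℝ) / k) * sawtooth ((h : ℝ) * μ / k) : ℝ) : ℂ))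

/-- The infinite `q`-shifted factorial `(a)_∞ = ∏_{n ≥ 0} (1 - a qⁿ)`. -/
def qPochInf (a q : ℂ) : ℂ := ∏' n : ℕ, (1 - a * q ^ n)

/-- The `n`-th term of the series in `O_r(q)`. -/
def oTerm (r q : ℂ) (n : ℤ) : ℂ :=
  (-1) ^ (n + 1) * (q ^ (n ^ 2) / (1 + exp (2 * Real.pi * I * r) * q ^ n))

/-- `O_r(q) = 4 (-q)_∞ / (q)_∞ ∑_{n ∈ ℤ} (-1)^{n+1} q^{n²} / (1 + e^{2πir} qⁿ)`. -/
def oFun (r q : ℂ) : ℂ :=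
  4 * (qPochInf (-q) q / qPochInf q q) * ∑' n : ℤ, oTerm r q n

/-- The `m`-th term of the series in `U_r(q)`, `q = e^{2πiz}`; the exponent `(m² + m)/2` is an
exact quotient of integers. -/
def uTerm (r z : ℂ) (m : ℤ) : ℂ :=
  exp (2 * Real.pi * I * z) ^ ((m ^ 2 + m) / 2) /
    (1 - exp (2 * Real.pi * I * r) * exp (2 * Real.pi * I * z) ^ m)

/-- `U_r(q) = e^{πir} η(z) / η(2z)² ∑_{m odd} q^{(m²+m)/2} / (1 - e^{2πir} q^m)`, as a function of
`z` in the upper half-plane, where `q = e^{2πiz}`. -/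
def uFun (r z : ℂ) : ℂ :=
  exp (Real.pi * I * r) * (ModularForm.eta z / ModularForm.eta (2 * z) ^ 2) *
    ∑' m : {m : ℤ // Odd m}, uTerm r z m

/-- The integrand of `I^±_{k,ν,r}(w)`; the sign `±` is the argument `σ = ±1`, and `k % 2` is `0`
or `1` according to whether `k` is even or odd. -/
def mordellIntegrand (σ : ℤ) (k : ℕ) (ν : ℤ) (r : ℝ) (w : ℂ) (x : ℝ) : ℂ :=
  exp (-(2 * Real.pi * w * x ^ 2 / k)) /
    (1 + exp (σ * (2 * Real.pi * I * ν / k) - σ * (Real.pi * I * ((k % 2 : ℕ) : ℂ) / (2 * k))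
      + 2 * Real.pi * I * r - 2 * Real.pi * w * x / k))

/-- The integral of `f` over `{x : |x| > ε}`. -/
def truncatedIntegral (f : ℝ → ℂ) (ε : ℝ) : ℂ := ∫ x in {x : ℝ | ε < |x|}, f x

/-- The Mordell integral `I^±_{k,ν,r}(w)`: an ordinary integral over `ℝ` for `k` odd, and for `k`
even the principal value at `x = 0`, the only real point where the integrand can have a pole. -/
def mordellI (σ : ℤ) (k : ℕ) (ν : ℤ) (r : ℝ) (w : ℂ) : ℂ :=
  if Odd k then ∫ x : ℝ, mordellIntegrand σ k ν r w x
  else limUnder (𝓝[>] (0 : ℝ)) (truncatedIntegral (mordellIntegrand σ k ν r w))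

end OverpartitionRank

end

/-!
The idea is Poisson summation. Because `h h' ≡ -1 (mod k)`, the integers `n` can be written as
`k l - h' N` with `N` modulo `k`, and on such a class the summand of `O_r(q)` is, up to a root of
unity and the sign `(-1)^{k l}`, the value at the integer points `x = k l - h' N` of the function
`exp(-2πwx²/k) / (1 + e(N/k + r) exp(-2πwx/k))` (`oTerm_class`). Poisson summation over `l`
(`poisson_class`) gives Fourier integrals of this function at the frequencies `μ ≡ k (mod 2)`. Each
of them is moved to the horizontal line through the saddle point `iμ/(4w)`. On that line it is
`exp(-πμ²/(8kw))` times a Mordell integral, and the poles crossed on the way, at `x = iT/w` with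
`T = n + k/2 + kr`, leave residues. This gives `tsum_oTerm_eq`. For `0 < |r| < 1/(8k)`, and for
`k` odd also at `r = 0`, no pole lies on the real axis or on a saddle line.

In the residue part the pole `n` is crossed by the frequencies `μ` beyond `4T`, a half-line, so the
sum over `μ` is geometric; what is left is a sum over `n` that is the series in `U` for `k` odd
(`tsum_resTerm_of_odd`) and the series in `O` for `k` even (`tsum_resTerm_of_even`), where for
`r < 0` one additional frequency contributes a theta series. In the Gaussian part, `N` and `μ` are
recombined by `N = ±(ν + s)`, `μ = ±(4s + 1)` or `μ = 4s`: this splits the double sum into a theta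
series in `s` and the finite sum over `ν` of the integrals `I^±` (`sum_saddleTerm_of_odd`,
`sum_saddleTerm_of_even`). By the triple product identity the theta series are eta quotients, and
the factor `(-q)_∞/(q)_∞ = η(2z)/η(z)²` is transformed by the modularity of `η`, with the multiplier
expressed through `ω_{h,k}` (`eta_transform`; the Euclidean algorithm together with the reciprocity
law for Dedekind sums). This proves `oFun_of_odd` and `oFun_of_even`.

For `k` even and `r = 0` no limit is taken. The identity `1/(1 + u) + 1/(1 + u⁻¹) = 1` shows that
`O_r + O_{-r} = -4` on both sides of the transformation, and that the integrals for `(ν, r)` and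
`(-ν, -r)`, principal values included, add up to a Gaussian integral. Hence the formula at `r = 0`
is half the sum of the formulas at `r` and `-r` for any small `r ≠ 0` (`oFun_zero_of_even`).
-/

namespace OverpartitionRank

/-! ### Dedekind sums and their reciprocity law -/

/-- The Dedekind sum `s(h, k)`, so that `ω_{h,k} = exp (π i s(h, k))`. -/
noncomputable def dedekindSum (h : ℤ) (k : ℕ) : ℝ :=
  ∑ μ ∈ Finset.range k, sawtooth ((μ : ℝ) / k) * sawtooth ((h : ℝ) * μ / k)

lemma omega_eq_exp (h : ℤ) (k : ℕ) :
    omega h k = exp (Real.pi * I * (dedekindSum h k : ℂ)) := rfl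

lemma sawtooth_add_intCast (x : ℝ) (n : ℤ) : sawtooth (x + n) = sawtooth x := by
  simp only [sawtooth, Int.fract_add_intCast, Int.floor_add_intCast, Int.cast_add]
  split_ifs <;> ring

lemma sawtooth_neg (x : ℝ) : sawtooth (-x) = -sawtooth x := by
  by_cases hx : Int.fract x = 0
  · simp [sawtooth, hx, Int.fract_neg_eq_zero.2 hx]
  · have h1 : Int.fract (-x) ≠ 0 := fun h => hx (Int.fract_neg_eq_zero.1 h)
    have h2 := Int.fract_neg hx
    have h3 : -x - ⌊-x⌋ = Int.fract (-x) := Int.self_sub_floor _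
    have h4 : x - ⌊x⌋ = Int.fract x := Int.self_sub_floor _
    simp only [sawtooth, hx, h1, if_false]
    rw [h3, h2, h4]
    ring

lemma dedekindSum_add_mul (h n : ℤ) (k : ℕ) :
    dedekindSum (h + k * n) k = dedekindSum h k := by
  rcases Nat.eq_zero_or_pos k with rfl | hk
  · simp [dedekindSum]
  refine Finset.sum_congr rfl fun μ _ => ?_
  have : ((h + k * n : ℤ) : ℝ) * μ / k = (h : ℝ) * μ / k + ((n * μ : ℤ) : ℝ) := by
    push_cast
    field_simp
  rw [this, sawtooth_add_intCast]

lemma dedekindSum_neg (h : ℤ) (k : ℕ) : dedekindSum (-h) k = -dedekindSum h k := by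
  rw [dedekindSum, dedekindSum, ← Finset.sum_neg_distrib]
  refine Finset.sum_congr rfl fun μ _ => ?_
  have : ((-h : ℤ) : ℝ) * μ / k = -((h : ℝ) * μ / k) := by
    push_cast
    ring
  rw [this, sawtooth_neg]
  ring

lemma sawtooth_natCast_div {a k : ℕ} (hk : 0 < k) (h : ¬ k ∣ a) :
    sawtooth ((a : ℝ) / k) = ((a % k : ℕ) : ℝ) / k - 1 / 2 := by
  have hf : ⌊(a : ℝ) / k⌋ = ((a / k : ℕ) : ℤ) := by
    rw [← Int.natCast_floor_eq_floor (by positivity), Nat.floor_div_eq_div]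
  have hx : (a : ℝ) / k - ((a / k : ℕ) : ℝ) = ((a % k : ℕ) : ℝ) / k := by
    have := Nat.div_add_mod a k
    field_simp
    rw [sub_eq_iff_eq_add]
    exact_mod_cast (by linarith : a = a % k + k * (a / k))
  have hfr : Int.fract ((a : ℝ) / k) = ((a % k : ℕ) : ℝ) / k := by
    rw [Int.fract, hf, Int.cast_natCast, hx]
  have hne : ((a % k : ℕ) : ℝ) / k ≠ 0 := by
    have : a % k ≠ 0 := fun h' => h (Nat.dvd_of_mod_eq_zero h')
    positivity
  rw [sawtooth, hfr, if_neg hne, hf, Int.cast_natCast, hx]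

lemma sum_range_mul_mod {M : Type*} [AddCommMonoid M] {h k : ℕ} (hk : 0 < k)
    (hc : Nat.Coprime h k) (g : ℕ → M) :
    ∑ μ ∈ Finset.range k, g (h * μ % k) = ∑ μ ∈ Finset.range k, g μ := by
  have hinj : Set.InjOn (fun μ => h * μ % k) (Finset.range k : Set ℕ) := by
    intro a ha b hb hab
    have h1 : a ≡ b [MOD k] := Nat.ModEq.cancel_left_of_coprime
      (by rw [Nat.gcd_comm]; exact hc) (hab : h * a ≡ h * b [MOD k])
    rw [Finset.coe_range, Set.mem_Iio] at ha hb
    exact Nat.ModEq.eq_of_lt_of_lt h1 ha hb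
  have himg : (Finset.range k).image (fun μ => h * μ % k) = Finset.range k := by
    refine Finset.eq_of_subset_of_card_le ?_ ?_
    · intro x hx
      obtain ⟨a, -, rfl⟩ := Finset.mem_image.1 hx
      exact Finset.mem_range.2 (Nat.mod_lt _ hk)
    · rw [Finset.card_image_of_injOn hinj]
  rw [← Finset.sum_image (f := g) hinj, himg]

lemma sum_range_natCast (k : ℕ) :
    ∑ μ ∈ Finset.range k, (μ : ℝ) = k * (k - 1) / 2 := by
  induction k with
  | zero => simp
  | succ n ih => rw [Finset.sum_range_succ, ih]; push_cast; ring

lemma sum_range_natCast_sq (k : ℕ) :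
    ∑ μ ∈ Finset.range k, (μ : ℝ) ^ 2 = (k - 1) * k * (2 * k - 1) / 6 := by
  induction k with
  | zero => simp
  | succ n ih => rw [Finset.sum_range_succ, ih]; push_cast; ring

/-- The Dedekind sum in terms of the integer parts `⌊h μ / k⌋`. -/
lemma dedekindSum_eq_sum_div {h k : ℕ} (hk : 0 < k) (hc : Nat.Coprime h k) :
    dedekindSum h k = h * ((k - 1) * (2 * k - 1)) / (6 * k)
      - (∑ μ ∈ Finset.range k, (μ : ℝ) * ((h * μ / k : ℕ) : ℝ)) / k - (k - 1) / 4 := by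
  have hterm : ∀ μ ∈ Finset.range k,
      sawtooth ((μ : ℝ) / k) * sawtooth (((h : ℤ) : ℝ) * μ / k) =
        ((μ : ℝ) / k - 1 / 2) * (((h * μ % k : ℕ) : ℝ) / k - 1 / 2)
          - if μ = 0 then 1 / 4 else 0 := by
    intro μ hμ
    rw [Finset.mem_range] at hμ
    rcases Nat.eq_zero_or_pos μ with rfl | hpos
    · simp [sawtooth]
      norm_num
    · have h1 : ¬ k ∣ μ := Nat.not_dvd_of_pos_of_lt hpos hμ
      have h2 : ¬ k ∣ h * μ := fun hd => h1 (hc.symm.dvd_of_dvd_mul_left hd)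
      have e1 := sawtooth_natCast_div hk h1
      have e2 := sawtooth_natCast_div hk h2
      rw [Nat.mod_eq_of_lt hμ] at e1
      rw [Int.cast_natCast, ← Nat.cast_mul, e1, e2, if_neg hpos.ne']
      ring
  have hmod : ∀ μ : ℕ, ((h * μ % k : ℕ) : ℝ) = h * μ - k * ((h * μ / k : ℕ) : ℝ) := by
    intro μ
    have := Nat.div_add_mod (h * μ) k
    rw [eq_sub_iff_add_eq]
    exact_mod_cast (by linarith : h * μ % k + k * (h * μ / k) = h * μ)
  have hb := sum_range_mul_mod hk hc (fun n => (n : ℝ))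
  have h1 : ∑ μ ∈ Finset.range k, (μ : ℝ) * ((h * μ % k : ℕ) : ℝ) =
      h * ∑ μ ∈ Finset.range k, (μ : ℝ) ^ 2
        - k * ∑ μ ∈ Finset.range k, (μ : ℝ) * ((h * μ / k : ℕ) : ℝ) := by
    rw [Finset.mul_sum, Finset.mul_sum, ← Finset.sum_sub_distrib]
    refine Finset.sum_congr rfl fun μ _ => ?_
    rw [hmod]
    ring
  have hsplit : ∑ μ ∈ Finset.range k,
      ((μ : ℝ) / k - 1 / 2) * (((h * μ % k : ℕ) : ℝ) / k - 1 / 2) =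
      (∑ μ ∈ Finset.range k, (μ : ℝ) * ((h * μ % k : ℕ) : ℝ)) / k ^ 2
        - (∑ μ ∈ Finset.range k, (μ : ℝ)) / (2 * k)
        - (∑ μ ∈ Finset.range k, ((h * μ % k : ℕ) : ℝ)) / (2 * k) + k / 4 := by
    rw [Finset.sum_div, Finset.sum_div, Finset.sum_div, ← Finset.sum_sub_distrib,
      ← Finset.sum_sub_distrib]
    have : (k : ℝ) / 4 = ∑ μ ∈ Finset.range k, (1 / 4 : ℝ) := by
      rw [Finset.sum_const, Finset.card_range]
      simp [div_eq_mul_inv]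
    rw [this, ← Finset.sum_add_distrib]
    refine Finset.sum_congr rfl fun μ _ => ?_
    field_simp
    ring
  rw [dedekindSum, Finset.sum_congr rfl hterm, Finset.sum_sub_distrib, hsplit, h1, hb,
    sum_range_natCast, sum_range_natCast_sq, Finset.sum_ite_eq' (Finset.range k) 0,
    if_pos (Finset.mem_range.2 hk)]
  field_simp
  ring

/-- Squaring `h μ mod k = h μ - k ⌊h μ / k⌋` and summing over a full residue system. -/
lemma sum_mul_div_eq_sum_div_sq {h k : ℕ} (hk : 0 < k) (hc : Nat.Coprime h k) :
    2 * h * k * ∑ μ ∈ Finset.range k, (μ : ℝ) * ((h * μ / k : ℕ) : ℝ) =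
      (h ^ 2 - 1) * ((k - 1) * k * (2 * k - 1) / 6)
        + k ^ 2 * ∑ μ ∈ Finset.range k, ((h * μ / k : ℕ) : ℝ) ^ 2 := by
  have hb := sum_range_mul_mod hk hc (fun n => (n : ℝ) ^ 2)
  have hmod : ∀ μ : ℕ, ((h * μ % k : ℕ) : ℝ) = h * μ - k * ((h * μ / k : ℕ) : ℝ) := by
    intro μ
    have := Nat.div_add_mod (h * μ) k
    rw [eq_sub_iff_add_eq]
    exact_mod_cast (by linarith : h * μ % k + k * (h * μ / k) = h * μ)
  have h1 : ∑ μ ∈ Finset.range k, ((h * μ % k : ℕ) : ℝ) ^ 2 =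
      h ^ 2 * (∑ μ ∈ Finset.range k, (μ : ℝ) ^ 2)
        - 2 * h * k * (∑ μ ∈ Finset.range k, (μ : ℝ) * ((h * μ / k : ℕ) : ℝ))
        + k ^ 2 * ∑ μ ∈ Finset.range k, ((h * μ / k : ℕ) : ℝ) ^ 2 := by
    rw [Finset.mul_sum, Finset.mul_sum, Finset.mul_sum, ← Finset.sum_sub_distrib,
      ← Finset.sum_add_distrib]
    refine Finset.sum_congr rfl fun μ _ => ?_
    rw [hmod]
    ring
  rw [h1, sum_range_natCast_sq] at hb
  linarith

lemma sum_div_eq {h k : ℕ} (hk : 0 < k) (hc : Nat.Coprime h k) :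
    ∑ μ ∈ Finset.range k, ((h * μ / k : ℕ) : ℝ) = (h - 1) * (k - 1) / 2 := by
  have hk' : (k : ℝ) ≠ 0 := by positivity
  have hb := sum_range_mul_mod hk hc (fun n => (n : ℝ))
  have hmod : ∀ μ : ℕ, ((h * μ % k : ℕ) : ℝ) = h * μ - k * ((h * μ / k : ℕ) : ℝ) := by
    intro μ
    have := Nat.div_add_mod (h * μ) k
    rw [eq_sub_iff_add_eq]
    exact_mod_cast (by linarith : h * μ % k + k * (h * μ / k) = h * μ)
  simp only [hmod, Finset.sum_sub_distrib, ← Finset.mul_sum] at hb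
  rw [sum_range_natCast] at hb
  apply mul_left_cancel₀ hk'
  linarith

/-- Counting the lattice points `(μ, ν)` with `ν k ≤ h μ`, weighted by `ν`, along rows and along
columns. -/
lemma sum_div_sq_add_sum_div {h k : ℕ} (hh : 0 < h) (hk : 0 < k) (hc : Nat.Coprime h k) :
    ∑ μ ∈ Finset.range k, (((h * μ / k : ℕ) : ℝ) ^ 2 + ((h * μ / k : ℕ) : ℝ)) =
      2 * ∑ ν ∈ Finset.range h, (ν : ℝ) * ((k : ℝ) - 1 - ((k * ν / h : ℕ) : ℝ)) := by
  have hrow : ∀ μ ∈ Finset.range k, (((h * μ / k : ℕ) : ℝ) ^ 2 + ((h * μ / k : ℕ) : ℝ)) =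
      2 * ∑ ν ∈ Finset.range h, if ν ≤ h * μ / k then (ν : ℝ) else 0 := by
    intro μ hμ
    rw [Finset.mem_range] at hμ
    have hlt : h * μ / k < h := by
      rw [Nat.div_lt_iff_lt_mul hk]
      exact Nat.mul_lt_mul_of_pos_left hμ hh
    rw [← Finset.sum_filter]
    have : (Finset.range h).filter (fun ν => ν ≤ h * μ / k) = Finset.range (h * μ / k + 1) := by
      ext ν
      simp only [Finset.mem_filter, Finset.mem_range]
      omega
    rw [this, sum_range_natCast]
    push_cast
    ring
  have hcol : ∀ ν ∈ Finset.range h, (∑ μ ∈ Finset.range k,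
      if ν ≤ h * μ / k then (ν : ℝ) else 0) = ν * ((k : ℝ) - 1 - ((k * ν / h : ℕ) : ℝ)) := by
    intro ν hν
    rw [Finset.mem_range] at hν
    rcases Nat.eq_zero_or_pos ν with rfl | hpos
    · simp
    have hlt : k * ν / h < k := by
      rw [Nat.div_lt_iff_lt_mul hh]
      exact Nat.mul_lt_mul_of_pos_left hν hk
    rw [← Finset.sum_filter]
    have : (Finset.range k).filter (fun μ => ν ≤ h * μ / k) = Finset.Ico (k * ν / h + 1) k := by
      ext μ
      simp only [Finset.mem_filter, Finset.mem_range, Finset.mem_Ico]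
      rw [Nat.le_div_iff_mul_le hk, Nat.succ_le_iff, Nat.div_lt_iff_lt_mul hh, and_comm]
      refine and_congr_left fun hμ => ?_
      have hne : ν * k ≠ h * μ := by
        intro he
        have : h ∣ ν := hc.dvd_of_dvd_mul_right ⟨μ, he⟩
        exact absurd (Nat.le_of_dvd hpos this) (by omega)
      rw [mul_comm k ν, mul_comm μ h]
      omega
    rw [this, Finset.sum_const, Nat.card_Ico, nsmul_eq_mul, Nat.cast_sub hlt]
    push_cast
    ring
  rw [Finset.sum_congr rfl hrow, ← Finset.mul_sum, Finset.sum_comm, Finset.sum_congr rfl hcol]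

/-- Dedekind's reciprocity law. -/
theorem dedekindSum_add_dedekindSum {h k : ℕ} (hh : 0 < h) (hk : 0 < k)
    (hc : Nat.Coprime h k) :
    dedekindSum h k + dedekindSum k h =
      -(1 / 4) + ((h : ℝ) ^ 2 + (k : ℝ) ^ 2 + 1) / (12 * h * k) := by
  have e1 := sum_mul_div_eq_sum_div_sq hk hc
  have e2 := sum_div_eq hk hc
  have e3 := sum_div_sq_add_sum_div hh hk hc
  have e4 : ∑ ν ∈ Finset.range h, (ν : ℝ) * ((k : ℝ) - 1 - ((k * ν / h : ℕ) : ℝ)) =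
      (k - 1) * (h * (h - 1) / 2) - ∑ ν ∈ Finset.range h, (ν : ℝ) * ((k * ν / h : ℕ) : ℝ) := by
    rw [← sum_range_natCast, Finset.mul_sum, ← Finset.sum_sub_distrib]
    exact Finset.sum_congr rfl fun ν _ => by ring
  rw [Finset.sum_add_distrib, e2, e4] at e3
  rw [dedekindSum_eq_sum_div hk hc, dedekindSum_eq_sum_div hh hc.symm]
  generalize (∑ μ ∈ Finset.range k, (μ : ℝ) * ((h * μ / k : ℕ) : ℝ)) = A at *
  generalize (∑ ν ∈ Finset.range h, (ν : ℝ) * ((k * ν / h : ℕ) : ℝ)) = B at *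
  generalize (∑ μ ∈ Finset.range k, ((h * μ / k : ℕ) : ℝ) ^ 2) = S at *
  have hS : S = 2 * ((k - 1) * (h * (h - 1) / 2) - B) - (h - 1) * (k - 1) / 2 := by linarith
  rw [hS] at e1
  have hA : A = ((h ^ 2 - 1) * ((k - 1) * k * (2 * k - 1) / 6) + k ^ 2 *
      (2 * ((k - 1) * (h * (h - 1) / 2) - B) - (h - 1) * (k - 1) / 2)) / (2 * h * k) := by
    rw [eq_div_iff (by positivity)]
    linarith
  rw [hA]
  field_simp
  ring

/-! ### The transformation of the Dedekind eta function -/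

lemma mul_cpow_of_arg {a b : ℂ} (ha : a ≠ 0) (hb : b ≠ 0)
    (h : arg a + arg b ∈ Set.Ioc (-Real.pi) Real.pi) (s : ℂ) :
    (a * b) ^ s = a ^ s * b ^ s := by
  rw [cpow_def_of_ne_zero (mul_ne_zero ha hb), cpow_def_of_ne_zero ha, cpow_def_of_ne_zero hb,
    (log_mul_eq_add_log_iff ha hb).2 h, add_mul, exp_add]

lemma ne_zero_of_re_pos {w : ℂ} (hw : 0 < w.re) : w ≠ 0 := by
  rintro rfl
  simp at hw

lemma mul_cpow_of_re_pos {a b : ℂ} (ha : 0 < a.re) (hb : 0 < b.re) (s : ℂ) :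
    (a * b) ^ s = a ^ s * b ^ s := by
  have h1 := abs_lt.1 (abs_arg_lt_pi_div_two_iff.2 (Or.inl ha))
  have h2 := abs_lt.1 (abs_arg_lt_pi_div_two_iff.2 (Or.inl hb))
  exact mul_cpow_of_arg (ne_zero_of_re_pos ha) (ne_zero_of_re_pos hb)
    ⟨by linarith, by linarith⟩ s

lemma re_inv_pos {w : ℂ} (hw : 0 < w.re) : 0 < (1 / w).re := by
  rw [one_div, inv_re]
  exact div_pos hw (normSq_pos.2 (ne_zero_of_re_pos hw))

lemma neg_I_mul_cpow_half {w : ℂ} (hw : 0 < w.re) :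
    (-I * w) ^ (1 / 2 : ℂ) = exp (-(Real.pi * I / 4)) * w ^ (1 / 2 : ℂ) := by
  have h1 := abs_lt.1 (abs_arg_lt_pi_div_two_iff.2 (Or.inl hw))
  rw [mul_cpow_of_arg (neg_ne_zero.2 I_ne_zero) (ne_zero_of_re_pos hw)
    ⟨by rw [arg_neg_I]; linarith [Real.pi_pos], by rw [arg_neg_I]; linarith [Real.pi_pos]⟩,
    cpow_def_of_ne_zero (neg_ne_zero.2 I_ne_zero), log_neg_I]
  congr 2
  ring

lemma eta_add_int (z : ℂ) (n : ℤ) :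
    ModularForm.eta (z + n) = exp (Real.pi * I * n / 12) * ModularForm.eta z := by
  have h1 : ∀ m : ℕ, ModularForm.eta_q m (z + n) = ModularForm.eta_q m z := by
    intro m
    rw [ModularForm.eta_q_eq_cexp, ModularForm.eta_q_eq_cexp, exp_eq_exp_iff_exists_int]
    exact ⟨(m + 1) * n, by push_cast; ring⟩
  simp only [ModularForm.eta, h1, Function.Periodic.qParam]
  rw [← mul_assoc, ← exp_add]
  congr 2
  push_cast
  ring

/-- The inversion formula for `η` on the right half-plane, `z = i v`. -/
lemma eta_I_div {v : ℂ} (hv : 0 < v.re) :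
    ModularForm.eta (I / v) = v ^ (1 / 2 : ℂ) * ModularForm.eta (I * v) := by
  have hv0 := ne_zero_of_re_pos hv
  have hmem : I * v ∈ UpperHalfPlane.upperHalfPlaneSet := by
    simpa [UpperHalfPlane.upperHalfPlaneSet] using hv
  have h := ModularForm.eta_comp_eq_csqrt_I_inv hmem
  simp only [Function.comp_apply, Pi.smul_apply, Pi.mul_apply, smul_eq_mul, Complex.sqrt] at h
  have h1 := abs_lt.1 (abs_arg_lt_pi_div_two_iff.2 (Or.inl hv))
  rw [mul_cpow_of_arg I_ne_zero hv0
    ⟨by rw [arg_I]; linarith [Real.pi_pos], by rw [arg_I]; linarith⟩] at h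
  have harg : -1 / (I * v) = I / v := by
    rw [div_eq_div_iff (mul_ne_zero I_ne_zero hv0) hv0]
    linear_combination (-v) * I_sq
  rw [harg] at h
  rw [h, one_div]
  field_simp

lemma dedekindSum_one (h : ℤ) : dedekindSum h 1 = 0 := by
  simp [dedekindSum, sawtooth]

/-- The transformation `z ↦ (h' + i/w)/k` of `(h + iw)/k` for `η`, with the multiplier given by a
Dedekind sum. It is proved by running the Euclidean algorithm on `(h, k)`: the reciprocity law for
Dedekind sums matches the inversion formula for `η`. -/
theorem eta_transform (k : ℕ) (hk : 0 < k) : ∀ (h h' : ℤ), h * h' ≡ -1 [ZMOD (k : ℤ)] →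
    ∀ w : ℂ, 0 < w.re → ModularForm.eta ((h' + I / w) / k) =
      omega h k * w ^ (1 / 2 : ℂ) * exp (Real.pi * I * (h' - h) / (12 * k)) *
        ModularForm.eta ((h + I * w) / k) := by
  induction k using Nat.strong_induction_on with
  | _ k ih =>
  intro h h' hh w hw
  have hw0 := ne_zero_of_re_pos hw
  have hk0 : (k : ℂ) ≠ 0 := by exact_mod_cast hk.ne'
  have hkz : (k : ℤ) ≠ 0 := by exact_mod_cast hk.ne'
  -- `h` only matters modulo `k`
  obtain ⟨h₀, n, hh₀, hlt⟩ : ∃ (h₀ : ℕ) (n : ℤ), h = h₀ + k * n ∧ h₀ < k := by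
    refine ⟨(h % k).toNat, h / k, ?_, ?_⟩
    · rw [Int.toNat_of_nonneg (Int.emod_nonneg _ hkz)]
      exact (Int.emod_add_mul_ediv _ _).symm
    · have := Int.emod_lt_of_pos h (by exact_mod_cast hk : (0 : ℤ) < k)
      have := Int.emod_nonneg h hkz
      omega
  have hh₀' : (h₀ : ℤ) * h' ≡ -1 [ZMOD (k : ℤ)] := by
    refine Int.ModEq.trans ?_ hh
    rw [hh₀]
    refine (Int.modEq_iff_dvd).2 ⟨n * h', by ring⟩
  rw [omega_eq_exp, hh₀, dedekindSum_add_mul]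
  have hT : ((((h₀ : ℤ) + k * n : ℤ) : ℂ) + I * w) / k = ((h₀ : ℂ) + I * w) / k + (n : ℤ) := by
    push_cast
    field_simp
    ring
  rw [hT, eta_add_int]
  rcases Nat.eq_zero_or_pos h₀ with h0 | hpos
  · -- here `k = 1`
    have hk1 : k = 1 := by
      rw [h0, Nat.cast_zero, zero_mul] at hh₀'
      have h2 : (k : ℤ) ∣ 1 := by
        have := (Int.modEq_iff_dvd).1 hh₀'
        simpa using this
      exact Nat.dvd_one.1 (by exact_mod_cast h2)
    subst hk1
    subst h0
    rw [dedekindSum_one]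
    have e1 : ((h' : ℂ) + I / w) / ((1 : ℕ) : ℂ) = I / w + (h' : ℤ) := by
      push_cast
      ring
    have e2 : (((0 : ℕ) : ℂ) + I * w) / ((1 : ℕ) : ℂ) = I * w := by simp
    rw [e1, e2, eta_add_int, eta_I_div hw]
    have e3 : exp (Real.pi * I * h' / 12) =
        exp (Real.pi * I * (h' - (((0 : ℕ) : ℤ) + ((1 : ℕ) : ℤ) * n : ℤ)) / (12 * ((1 : ℕ) : ℂ))) *
          exp (Real.pi * I * n / 12) := by
      rw [← exp_add]
      congr 1
      push_cast
      ring
    rw [e3]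
    simp only [ofReal_zero, mul_zero, exp_zero]
    ring
  · obtain ⟨H, hH⟩ : ∃ H : ℤ, (h₀ : ℤ) * h' + 1 = k * H := by
      have := (Int.modEq_iff_dvd).1 hh₀'.symm
      obtain ⟨H, hH⟩ := this
      exact ⟨H, by linarith⟩
    have hc : Nat.Coprime h₀ k := by
      rw [← Nat.isCoprime_iff_coprime]
      exact ⟨-h', H, by linarith⟩
    have hHc : (k : ℂ) * H = h₀ * h' + 1 := by exact_mod_cast hH.symm
    have hh0 : (h₀ : ℂ) ≠ 0 := by exact_mod_cast hpos.ne'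
    set v : ℂ := (w - I * h₀) / k with hv
    have hvre : 0 < v.re := by
      rw [hv, show (w - I * h₀) / (k : ℂ) = (w - I * h₀) / ((k : ℝ) : ℂ) by norm_cast,
        div_ofReal_re]
      refine div_pos ?_ (by exact_mod_cast hk)
      simpa using hw
    have hv0 := ne_zero_of_re_pos hvre
    set w' : ℂ := -I * w / v with hw'
    have hIw : (h₀ : ℂ) + I * w = I * (k * v) := by
      rw [hv]
      field_simp
      linear_combination (h₀ : ℂ) * I_sq
    have hw'inv : I / w' = (I * h₀) / (k * w) - 1 / k := by
      rw [hw', hv]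
      field_simp
      ring
    have hw're : 0 < w'.re := by
      have h1 : 1 / w' = ((h₀ / k : ℝ) : ℂ) * (1 / w) + I * ((1 / k : ℝ) : ℂ) := by
        have : 1 / w' = -I * (I / w') := by
          linear_combination (1 / w') * I_sq
        rw [this, hw'inv]
        push_cast
        linear_combination (-((h₀ : ℂ) / (k * w))) * I_sq
      have h2 : 0 < (1 / w').re := by
        rw [h1, add_re, re_ofReal_mul, I_mul_re, ofReal_im, neg_zero, add_zero]
        exact mul_pos (div_pos (by exact_mod_cast hpos) (by exact_mod_cast hk)) (re_inv_pos hw)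
      simpa using re_inv_pos h2
    have hind := ih h₀ hlt hpos (-(k : ℤ)) H
      ((Int.modEq_iff_dvd).2 ⟨h', by linarith⟩) w' hw're
    have e1 : ((H : ℂ) + I / w') / (h₀ : ℂ) = (h' + I / w) / k := by
      rw [hw'inv]
      field_simp
      linear_combination w * hHc
    have e2 : (((-(k : ℤ) : ℤ) : ℂ) + I * w') / (h₀ : ℂ) = I / v := by
      rw [hw']
      have : w = k * v + I * h₀ := by
        rw [hv]
        field_simp
        ring
      field_simp
      push_cast
      rw [this]
      linear_combination (-(k : ℂ) * v - I * h₀) * I_sq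
    have e3 : ((h₀ : ℂ) + I * w) / k = I * v := by
      rw [hIw]
      field_simp
    have e4 : w' ^ (1 / 2 : ℂ) * v ^ (1 / 2 : ℂ) =
        exp (-(Real.pi * I / 4)) * w ^ (1 / 2 : ℂ) := by
      rw [← mul_cpow_of_re_pos hw're hvre, ← neg_I_mul_cpow_half hw, hw']
      congr 1
      field_simp
    rw [e1, e2, eta_I_div hvre, omega_eq_exp, dedekindSum_neg] at hind
    rw [hind, e3]
    have hrec := dedekindSum_add_dedekindSum hpos hk hc
    have e5 : exp (Real.pi * I * ((-dedekindSum (k : ℤ) h₀ : ℝ) : ℂ)) *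
        exp (Real.pi * I * (H - ((-(k : ℤ) : ℤ) : ℂ)) / (12 * h₀)) * exp (-(Real.pi * I / 4)) =
        exp (Real.pi * I * (dedekindSum (h₀ : ℤ) k : ℂ)) *
        exp (Real.pi * I * (h' - (((h₀ : ℤ) + k * n : ℤ) : ℂ)) / (12 * k)) *
          exp (Real.pi * I * n / 12) := by
      have hs : dedekindSum (h₀ : ℤ) k = -(1 / 4) + ((h₀ : ℝ) ^ 2 + (k : ℝ) ^ 2 + 1) / (12 * h₀ * k)
          - dedekindSum (k : ℤ) h₀ := by linarith
      rw [hs, ← exp_add, ← exp_add, ← exp_add, ← exp_add]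
      congr 1
      push_cast
      field_simp
      linear_combination 4 * hHc
    calc _ = (exp (Real.pi * I * ((-dedekindSum (k : ℤ) h₀ : ℝ) : ℂ)) *
        exp (Real.pi * I * (H - ((-(k : ℤ) : ℤ) : ℂ)) / (12 * h₀))) *
          (w' ^ (1 / 2 : ℂ) * v ^ (1 / 2 : ℂ)) * ModularForm.eta (I * v) := by ring
      _ = (exp (Real.pi * I * ((-dedekindSum (k : ℤ) h₀ : ℝ) : ℂ)) *
        exp (Real.pi * I * (H - ((-(k : ℤ) : ℤ) : ℂ)) / (12 * h₀)) * exp (-(Real.pi * I / 4))) *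
          w ^ (1 / 2 : ℂ) * ModularForm.eta (I * v) := by rw [e4]; ring
      _ = _ := by rw [e5]; ring

/-! ### The Jacobi triple product and two theta series as products -/

/-- Gaussian sums over `ℤ` converge absolutely. -/
lemma summable_exp_neg_sq {a : ℝ} (ha : 0 < a) (b : ℝ) :
    Summable fun n : ℤ => Real.exp (-a * (n : ℝ) ^ 2 + b * n) := by
  have h := (summable_jacobiTheta₂_term_iff (-(I * (b / (2 * Real.pi) : ℝ)))
    (I * ((a / Real.pi : ℝ) : ℂ))).2 (by
      rw [I_mul_im, ofReal_re]
      exact div_pos ha Real.pi_pos)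
  refine h.norm.congr fun n => ?_
  rw [norm_jacobiTheta₂_term]
  congr 1
  have h1 : (-(I * ((b / (2 * Real.pi) : ℝ) : ℂ))).im = -(b / (2 * Real.pi)) := by
    rw [neg_im, I_mul_im, ofReal_re]
  rw [I_mul_im, ofReal_re, h1]
  have := Real.pi_ne_zero
  field_simp
  ring

lemma summable_zpow_sq_mul_zpow {q z : ℂ} (hq0 : q ≠ 0) (hq : ‖q‖ < 1) (hz : z ≠ 0) :
    Summable fun n : ℤ => q ^ (n ^ 2) * z ^ n := by
  have hlog : 0 < -Real.log ‖q‖ := neg_pos.2 (Real.log_neg (norm_pos_iff.2 hq0) hq)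
  refine Summable.of_norm ((summable_exp_neg_sq hlog (Real.log ‖z‖)).congr fun n => ?_)
  rw [norm_mul, norm_zpow, norm_zpow, Real.exp_add]
  congr 1
  · rw [← Real.rpow_intCast, Real.rpow_def_of_pos (norm_pos_iff.2 hq0)]
    congr 1
    push_cast
    ring
  · rw [← Real.rpow_intCast, Real.rpow_def_of_pos (norm_pos_iff.2 hz)]

/-- The finite product `(1 - Q)(1 - Q²)⋯(1 - Q^N)`. -/
def qPochFin (Q : ℂ) (N : ℕ) : ℂ := ∏ j ∈ Finset.range N, (1 - Q ^ (j + 1))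

/-- The Gaussian binomial coefficient, meaningful for `i ≤ N`. -/
noncomputable def gaussBinom (Q : ℂ) (N i : ℕ) : ℂ :=
  qPochFin Q N / (qPochFin Q i * qPochFin Q (N - i))

lemma one_sub_pow_ne_zero {Q : ℂ} (hQ : ‖Q‖ < 1) (j : ℕ) : 1 - Q ^ (j + 1) ≠ 0 := by
  intro h
  have h1 : ‖Q ^ (j + 1)‖ = 1 := by rw [← sub_eq_zero.1 h, norm_one]
  rw [norm_pow] at h1
  exact absurd h1 (pow_lt_one₀ (norm_nonneg _) hQ (Nat.succ_ne_zero j)).ne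

lemma qPochFin_ne_zero {Q : ℂ} (hQ : ‖Q‖ < 1) (N : ℕ) : qPochFin Q N ≠ 0 :=
  Finset.prod_ne_zero_iff.2 fun j _ => one_sub_pow_ne_zero hQ j

lemma qPochFin_succ (Q : ℂ) (N : ℕ) :
    qPochFin Q (N + 1) = qPochFin Q N * (1 - Q ^ (N + 1)) :=
  Finset.prod_range_succ _ _

lemma gaussBinom_zero {Q : ℂ} (hQ : ‖Q‖ < 1) (N : ℕ) : gaussBinom Q N 0 = 1 := by
  rw [gaussBinom, Nat.sub_zero, show qPochFin Q 0 = 1 from rfl, one_mul,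
    div_self (qPochFin_ne_zero hQ N)]

lemma gaussBinom_self {Q : ℂ} (hQ : ‖Q‖ < 1) (N : ℕ) : gaussBinom Q N N = 1 := by
  rw [gaussBinom, Nat.sub_self, show qPochFin Q 0 = 1 from rfl, mul_one,
    div_self (qPochFin_ne_zero hQ N)]

lemma gaussBinom_succ_succ {Q : ℂ} (hQ : ‖Q‖ < 1) {N i : ℕ} (hi : i < N) :
    gaussBinom Q (N + 1) (i + 1) =
      gaussBinom Q N (i + 1) + Q ^ (N - i) * gaussBinom Q N i := by
  obtain ⟨M, rfl⟩ : ∃ M, N = i + 1 + M := ⟨N - (i + 1), by omega⟩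
  have e1 : i + 1 + M + 1 - (i + 1) = M + 1 := by omega
  have e2 : i + 1 + M - (i + 1) = M := by omega
  have e3 : i + 1 + M - i = M + 1 := by omega
  rw [gaussBinom, gaussBinom, gaussBinom, e1, e2, e3, qPochFin_succ Q (i + 1 + M),
    qPochFin_succ Q M, qPochFin_succ Q i]
  have h3 := one_sub_pow_ne_zero hQ i
  have h4 := one_sub_pow_ne_zero hQ M
  field_simp
  ring

/-- The finite `q`-binomial theorem. -/
lemma prod_one_add_mul_pow {Q : ℂ} (hQ : ‖Q‖ < 1) (z : ℂ) (N : ℕ) :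
    ∏ j ∈ Finset.range N, (1 + z * Q ^ j) =
      ∑ i ∈ Finset.range (N + 1), Q ^ (i.choose 2) * gaussBinom Q N i * z ^ i := by
  induction N with
  | zero => simp [gaussBinom, qPochFin]
  | succ N ih =>
    have hs : ∀ i, (i + 1).choose 2 = i + i.choose 2 := fun i => by
      rw [Nat.choose_succ_succ' i 1, Nat.choose_one_right]
    have hfst : ∑ i ∈ Finset.range (N + 1), Q ^ (i.choose 2) * gaussBinom Q N i * z ^ i =
        ∑ i ∈ Finset.range N, Q ^ (i + 1).choose 2 * gaussBinom Q N (i + 1) * z ^ (i + 1) + 1 := by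
      rw [Finset.sum_range_succ', gaussBinom_zero hQ]
      simp
    have hlst : (∑ i ∈ Finset.range (N + 1), Q ^ (i.choose 2) * gaussBinom Q N i * z ^ i) *
          (z * Q ^ N) =
        ∑ i ∈ Finset.range N, Q ^ i.choose 2 * gaussBinom Q N i * z ^ i * (z * Q ^ N) +
          Q ^ (N.choose 2) * z ^ N * (z * Q ^ N) := by
      rw [Finset.sum_range_succ, gaussBinom_self hQ, add_mul, Finset.sum_mul, mul_one]
    rw [Finset.prod_range_succ, ih, mul_add, mul_one, hlst, hfst,
      Finset.sum_range_succ' _ (N + 1), Finset.sum_range_succ _ N, gaussBinom_zero hQ,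
      gaussBinom_self hQ]
    have hmid : ∑ i ∈ Finset.range N, Q ^ (i + 1).choose 2 * gaussBinom Q (N + 1) (i + 1) *
          z ^ (i + 1) =
        ∑ i ∈ Finset.range N, Q ^ (i + 1).choose 2 * gaussBinom Q N (i + 1) * z ^ (i + 1) +
        ∑ i ∈ Finset.range N, Q ^ i.choose 2 * gaussBinom Q N i * z ^ i * (z * Q ^ N) := by
      rw [← Finset.sum_add_distrib]
      refine Finset.sum_congr rfl fun i hi => ?_
      have hi' := Finset.mem_range.1 hi
      rw [gaussBinom_succ_succ hQ hi', hs]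
      have hp : Q ^ N = Q ^ i * Q ^ (N - i) := by
        rw [← pow_add, Nat.add_sub_cancel' hi'.le]
      rw [hp]
      ring
    rw [hmid, hs N, Nat.choose_zero_succ, pow_add]
    ring

/-- The finite form of the triple product, written as a sum over all integers. -/
lemma prod_triple_fin {q z : ℂ} (hq0 : q ≠ 0) (hq : ‖q‖ < 1) (hz : z ≠ 0) (n : ℕ) :
    ∏ j ∈ Finset.range n, ((1 + z * q ^ (2 * j + 1)) * (1 + z⁻¹ * q ^ (2 * j + 1))) =
      ∑' m : ℤ, if m.natAbs ≤ n then
        q ^ (m ^ 2) * z ^ m * gaussBinom (q ^ 2) (2 * n) (n + m).toNat else 0 := by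
  have hQ : ‖q ^ 2‖ < 1 := by
    rw [norm_pow]
    exact pow_lt_one₀ (norm_nonneg _) hq two_ne_zero
  set Z : ℂ := z * q ^ (1 - 2 * n : ℤ) with hZ
  have hbin := prod_one_add_mul_pow hQ Z (2 * n)
  have hpre : ∏ j ∈ Finset.range n, (z * q ^ (-(2 * j + 1 : ℤ))) = z ^ n * q ^ (-(n : ℤ) ^ 2) := by
    induction n with
    | zero => simp
    | succ n ih =>
      rw [Finset.prod_range_succ, ih]
      · have : q ^ (-((n + 1 : ℕ) : ℤ) ^ 2) = q ^ (-(n : ℤ) ^ 2) * q ^ (-(2 * n + 1 : ℤ)) := by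
          rw [← zpow_add₀ hq0]
          congr 1
          push_cast
          ring
        rw [this]
        ring
      · rfl
      · exact prod_one_add_mul_pow hQ _ _
  have hfirst : ∏ j ∈ Finset.range n, (1 + Z * (q ^ 2) ^ j) =
      z ^ n * q ^ (-(n : ℤ) ^ 2) * ∏ j ∈ Finset.range n, (1 + z⁻¹ * q ^ (2 * j + 1)) := by
    rw [← Finset.prod_range_reflect, ← hpre, ← Finset.prod_mul_distrib]
    refine Finset.prod_congr rfl fun j hj => ?_
    have hj' := Finset.mem_range.1 hj
    have e1 : q ^ (1 - 2 * n : ℤ) * (q ^ 2) ^ (n - 1 - j) = q ^ (-(2 * j + 1 : ℤ)) := by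
      rw [← pow_mul, ← zpow_natCast, ← zpow_add₀ hq0]
      congr 1
      omega
    have e2 : q ^ (-(2 * j + 1 : ℤ)) * q ^ (2 * j + 1) = 1 := by
      rw [← zpow_natCast, ← zpow_add₀ hq0]
      push_cast
      rw [neg_add_cancel, zpow_zero]
    rw [hZ, mul_assoc, e1]
    have : z * z⁻¹ = 1 := mul_inv_cancel₀ hz
    linear_combination (-(q ^ (-(2 * j + 1 : ℤ)) * q ^ (2 * j + 1))) * this - e2
  have hsecond : ∏ j ∈ Finset.range n, (1 + Z * (q ^ 2) ^ (n + j)) =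
      ∏ j ∈ Finset.range n, (1 + z * q ^ (2 * j + 1)) := by
    refine Finset.prod_congr rfl fun j _ => ?_
    have e1 : q ^ (1 - 2 * n : ℤ) * (q ^ 2) ^ (n + j) = q ^ (2 * j + 1) := by
      rw [← pow_mul, ← zpow_natCast, ← zpow_natCast, ← zpow_add₀ hq0]
      congr 1
      push_cast
      ring
    rw [hZ, mul_assoc, e1]
  rw [two_mul, Finset.prod_range_add, hfirst, hsecond] at hbin
  have hc : z ^ n * q ^ (-(n : ℤ) ^ 2) ≠ 0 := mul_ne_zero (pow_ne_zero _ hz) (zpow_ne_zero _ hq0)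
  have hsupp : ∀ m ∉ Finset.Icc (-(n : ℤ)) n, (if m.natAbs ≤ n then
        q ^ (m ^ 2) * z ^ m * gaussBinom (q ^ 2) (2 * n) (n + m).toNat else 0) = 0 := by
    intro m hm
    rw [if_neg]
    intro h
    exact hm (Finset.mem_Icc.2 ⟨by omega, by omega⟩)
  rw [tsum_eq_sum hsupp, Finset.prod_mul_distrib]
  apply mul_left_cancel₀ hc
  calc _ = z ^ n * q ^ (-(n : ℤ) ^ 2) * (∏ j ∈ Finset.range n, (1 + z⁻¹ * q ^ (2 * j + 1))) *
        ∏ j ∈ Finset.range n, (1 + z * q ^ (2 * j + 1)) := by ring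
    _ = _ := hbin
    _ = _ := by
      rw [Finset.mul_sum]
      refine Finset.sum_nbij' (fun i => (i : ℤ) - n) (fun m => (n + m).toNat) ?_ ?_ ?_ ?_ ?_
      · intro i hi
        have := Finset.mem_range.1 hi
        exact Finset.mem_Icc.2 ⟨by omega, by omega⟩
      · intro m hm
        have := Finset.mem_Icc.1 hm
        exact Finset.mem_range.2 (by omega)
      · intro i _
        omega
      · intro m hm
        have := Finset.mem_Icc.1 hm
        omega
      · intro i hi
        have := Finset.mem_range.1 hi
        have e0 : (n + ((i : ℤ) - n)).toNat = i := by omega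
        have e1 : (2 * (i.choose 2) : ℤ) = (i : ℤ) ^ 2 - i := by
          clear * -
          induction i with
          | zero => simp
          | succ i ih =>
            rw [Nat.choose_succ_succ' i 1, Nat.choose_one_right]
            push_cast
            linarith
        have e2 : (q ^ 2) ^ i.choose 2 * q ^ ((1 - 2 * n : ℤ) * i) =
            q ^ (-(n : ℤ) ^ 2) * q ^ (((i : ℤ) - n) ^ 2) := by
          rw [← pow_mul, ← zpow_natCast, ← zpow_add₀ hq0, ← zpow_add₀ hq0]
          congr 1
          push_cast
          linear_combination e1
        have e3 : z ^ i = z ^ n * z ^ ((i : ℤ) - n) := by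
          rw [← zpow_natCast, ← zpow_natCast, ← zpow_add₀ hz]
          congr 1
          ring
        rw [if_pos (by omega), e0, hZ, mul_pow, ← zpow_natCast (q ^ (1 - 2 * n : ℤ)), ← zpow_mul,
          e3,
          two_mul n]
        linear_combination (gaussBinom (q ^ 2) (n + n) i * z ^ n * z ^ ((i : ℤ) - n)) * e2

/-- Euler's product `∏ (1 - q^n)` over `n ≥ 1`. -/
noncomputable def euler (q : ℂ) : ℂ := ∏' n : ℕ, (1 - q ^ (n + 1))

lemma summable_norm_mul_pow {q : ℂ} (hq : ‖q‖ < 1) (c : ℂ) (a b : ℕ) (ha : 0 < a) :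
    Summable fun n : ℕ => ‖c * q ^ (a * n + b)‖ := by
  have h : Summable fun n : ℕ => ‖c‖ * ‖q‖ ^ b * (‖q‖ ^ a) ^ n :=
    (summable_geometric_of_lt_one (by positivity)
      (pow_lt_one₀ (norm_nonneg _) hq ha.ne')).mul_left _
  refine h.congr fun n => ?_
  rw [norm_mul, norm_pow, pow_add, pow_mul]
  ring

lemma multipliable_one_add_mul_pow {q : ℂ} (hq : ‖q‖ < 1) (c : ℂ) (a b : ℕ) (ha : 0 < a) :
    Multipliable fun n : ℕ => 1 + c * q ^ (a * n + b) :=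
  multipliable_one_add_of_summable (summable_norm_mul_pow hq c a b ha)

lemma multipliable_one_sub_pow' {q : ℂ} (hq : ‖q‖ < 1) (a b : ℕ) (ha : 0 < a) :
    Multipliable fun n : ℕ => 1 - q ^ (a * n + b) := by
  simpa [sub_eq_add_neg] using multipliable_one_add_mul_pow hq (-1) a b ha

lemma euler_ne_zero {q : ℂ} (hq : ‖q‖ < 1) : euler q ≠ 0 := by
  have h := tprod_one_add_ne_zero_of_summable (f := fun n : ℕ => -q ^ (n + 1))
    (fun n => by simpa [sub_eq_add_neg] using one_sub_pow_ne_zero hq n)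
    (by simpa using summable_norm_mul_pow hq (-1) 1 1 one_pos)
  simpa [euler, sub_eq_add_neg] using h

lemma tendsto_qPochFin {q : ℂ} (hq : ‖q‖ < 1) :
    Tendsto (qPochFin q) atTop (𝓝 (euler q)) := by
  have h := multipliable_one_sub_pow' hq 1 1 one_pos
  simp only [one_mul] at h
  exact h.tendsto_prod_tprod_nat

lemma exists_bound_gaussBinom {q : ℂ} (hq : ‖q‖ < 1) :
    ∃ C : ℝ, ∀ N i, ‖gaussBinom q N i‖ ≤ C := by
  have h1 := tendsto_qPochFin hq
  obtain ⟨B, hB⟩ := h1.norm.bddAbove_range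
  obtain ⟨B', hB'⟩ := (h1.norm.inv₀ (norm_ne_zero_iff.2 (euler_ne_zero hq))).bddAbove_range
  have hB1 : ∀ N, ‖qPochFin q N‖ ≤ B := fun N => hB ⟨N, rfl⟩
  have hB2 : ∀ N, ‖qPochFin q N‖⁻¹ ≤ B' := fun N => hB' ⟨N, rfl⟩
  have hB0 : 0 ≤ B := (norm_nonneg _).trans (hB1 0)
  have hB0' : 0 ≤ B' := (inv_nonneg.2 (norm_nonneg _)).trans (hB2 0)
  refine ⟨B * (B' * B'), fun N i => ?_⟩
  rw [gaussBinom, norm_div, norm_mul, div_eq_mul_inv, mul_inv]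
  have := hB1 N
  have := hB2 i
  have := hB2 (N - i)
  gcongr

/-- The Jacobi triple product. -/
theorem tsum_zpow_sq_mul_zpow {q z : ℂ} (hq0 : q ≠ 0) (hq : ‖q‖ < 1) (hz : z ≠ 0) :
    ∑' m : ℤ, q ^ (m ^ 2) * z ^ m = euler (q ^ 2) *
      ((∏' n : ℕ, (1 + z * q ^ (2 * n + 1))) * ∏' n : ℕ, (1 + z⁻¹ * q ^ (2 * n + 1))) := by
  have hQ : ‖q ^ 2‖ < 1 := by
    rw [norm_pow]
    exact pow_lt_one₀ (norm_nonneg _) hq two_ne_zero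
  have hE := euler_ne_zero hQ
  obtain ⟨C, hC⟩ := exists_bound_gaussBinom hQ
  have hC0 : 0 ≤ C := (norm_nonneg _).trans (hC 0 0)
  have hlhs : Tendsto (fun n : ℕ => ∏ j ∈ Finset.range n,
      ((1 + z * q ^ (2 * j + 1)) * (1 + z⁻¹ * q ^ (2 * j + 1)))) atTop
      (𝓝 ((∏' n : ℕ, (1 + z * q ^ (2 * n + 1))) * ∏' n : ℕ, (1 + z⁻¹ * q ^ (2 * n + 1)))) := by
    simp only [Finset.prod_mul_distrib]
    exact (multipliable_one_add_mul_pow hq z 2 1 two_pos).tendsto_prod_tprod_nat.mul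
      (multipliable_one_add_mul_pow hq z⁻¹ 2 1 two_pos).tendsto_prod_tprod_nat
  have hrhs : Tendsto (fun n : ℕ => ∑' m : ℤ, if m.natAbs ≤ n then
        q ^ (m ^ 2) * z ^ m * gaussBinom (q ^ 2) (2 * n) (n + m).toNat else 0) atTop
      (𝓝 (∑' m : ℤ, q ^ (m ^ 2) * z ^ m * (euler (q ^ 2))⁻¹)) := by
    refine tendsto_tsum_of_dominated_convergence
      (bound := fun m : ℤ => ‖q ^ (m ^ 2) * z ^ m‖ * C)
      ((summable_zpow_sq_mul_zpow hq0 hq hz).norm.mul_right C) ?_ ?_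
    · intro m
      have hg : Tendsto (fun n : ℕ => gaussBinom (q ^ 2) (2 * n) (n + m).toNat) atTop
          (𝓝 (euler (q ^ 2) / (euler (q ^ 2) * euler (q ^ 2)))) := by
        have hT := tendsto_qPochFin hQ
        refine Tendsto.div (hT.comp ?_) (Tendsto.mul (hT.comp ?_) (hT.comp ?_))
          (mul_ne_zero hE hE)
        · exact tendsto_atTop.2 fun b => (eventually_ge_atTop b).mono fun n hn => by omega
        · exact tendsto_atTop.2 fun b => (eventually_ge_atTop (b + m.natAbs)).mono
            fun n hn => by omega
        · exact tendsto_atTop.2 fun b => (eventually_ge_atTop (b + m.natAbs)).mono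
            fun n hn => by omega
      rw [div_mul_cancel_left₀ hE] at hg
      refine (hg.const_mul (q ^ (m ^ 2) * z ^ m)).congr' ?_
      filter_upwards [eventually_ge_atTop m.natAbs] with n hn
      rw [if_pos hn]
    · refine Eventually.of_forall fun n m => ?_
      split_ifs
      · rw [norm_mul]
        exact mul_le_mul_of_nonneg_left (hC _ _) (norm_nonneg _)
      · rw [norm_zero]
        positivity
  have h := tendsto_nhds_unique hlhs (hrhs.congr fun n => (prod_triple_fin hq0 hq hz n).symm)
  rw [h, tsum_mul_right]
  field_simp

lemma norm_sq_lt_one {q : ℂ} (hq : ‖q‖ < 1) : ‖q ^ 2‖ < 1 := by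
  rw [norm_pow]
  exact pow_lt_one₀ (norm_nonneg _) hq two_ne_zero

/-- Euler's product over the odd exponents. -/
noncomputable def eulerOdd (q : ℂ) : ℂ := ∏' n : ℕ, (1 - q ^ (2 * n + 1))

lemma eulerOdd_mul_euler_sq {q : ℂ} (hq : ‖q‖ < 1) : eulerOdd q * euler (q ^ 2) = euler q := by
  have h := tprod_even_mul_odd (f := fun n : ℕ => 1 - q ^ (n + 1))
    (multipliable_one_sub_pow' hq 2 1 two_pos) (multipliable_one_sub_pow' hq 2 2 two_pos)
  rw [euler, euler, eulerOdd, ← h]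
  congr 1
  refine tprod_congr fun n => ?_
  rw [← pow_mul]
  ring_nf

/-- `∑ (-1)^n q^{n²} = ∏ (1 - q^n)² / (1 - q^{2n})`. -/
lemma tsum_neg_one_zpow_mul {q : ℂ} (hq0 : q ≠ 0) (hq : ‖q‖ < 1) :
    ∑' m : ℤ, (-1 : ℂ) ^ m * q ^ (m ^ 2) = euler q ^ 2 / euler (q ^ 2) := by
  have h := tsum_zpow_sq_mul_zpow hq0 hq (neg_ne_zero.2 one_ne_zero : (-1 : ℂ) ≠ 0)
  have e : ∏' n : ℕ, (1 + -1 * q ^ (2 * n + 1)) = eulerOdd q :=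
    tprod_congr fun n => by ring
  rw [inv_neg, inv_one, e] at h
  rw [tsum_congr fun m => mul_comm ((-1 : ℂ) ^ m) (q ^ (m ^ 2)), h, ← eulerOdd_mul_euler_sq hq]
  field_simp

/-- `∑ p^{2s² + s} = ∏ (1 - p^{2n})² / (1 - p^n)`. -/
lemma tsum_zpow_two_mul_sq_add {p : ℂ} (hp0 : p ≠ 0) (hp : ‖p‖ < 1) :
    ∑' s : ℤ, p ^ (2 * s ^ 2 + s) = euler (p ^ 2) ^ 2 / euler p := by
  have hp2 := norm_sq_lt_one hp
  have h := tsum_zpow_sq_mul_zpow (pow_ne_zero 2 hp0) hp2 hp0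
  have e1 : (∏' n : ℕ, (1 + p * (p ^ 2) ^ (2 * n + 1))) *
      ∏' n : ℕ, (1 + p⁻¹ * (p ^ 2) ^ (2 * n + 1)) = ∏' n : ℕ, (1 + 1 * p ^ (2 * n + 1)) := by
    have h1 := multipliable_one_add_mul_pow hp 1 4 1 (by norm_num)
    have h2 := multipliable_one_add_mul_pow hp 1 4 3 (by norm_num)
    have h3 := tprod_even_mul_odd (f := fun n : ℕ => 1 + 1 * p ^ (2 * n + 1))
      (h1.congr fun n => by ring_nf) (h2.congr fun n => by ring_nf)
    rw [← h3, mul_comm]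
    congr 1
    · refine tprod_congr fun n => ?_
      rw [← pow_mul, show 2 * (2 * n + 1) = (2 * (2 * n) + 1) + 1 by ring, pow_succ]
      field_simp
    · refine tprod_congr fun n => ?_
      ring
  have e2 : (∏' n : ℕ, (1 + 1 * p ^ (2 * n + 1))) * eulerOdd p = eulerOdd (p ^ 2) := by
    rw [eulerOdd, eulerOdd, ← (multipliable_one_add_mul_pow hp 1 2 1 two_pos).tprod_mul
      (multipliable_one_sub_pow' hp 2 1 two_pos)]
    refine tprod_congr fun n => ?_
    ring
  have e3 := eulerOdd_mul_euler_sq hp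
  have e4 := eulerOdd_mul_euler_sq hp2
  have hE := euler_ne_zero hp
  have hs : ∀ s : ℤ, p ^ (2 * s ^ 2 + s) = (p ^ 2) ^ (s ^ 2) * p ^ s := by
    intro s
    rw [zpow_add₀ hp0, zpow_mul]
    rfl
  rw [tsum_congr hs, h, e1]
  rw [eq_div_iff hE, ← e3]
  linear_combination euler ((p ^ 2) ^ 2) * euler (p ^ 2) * e2 + euler (p ^ 2) * e4

lemma qPochInf_div {q : ℂ} (hq : ‖q‖ < 1) :
    qPochInf (-q) q / qPochInf q q = euler (q ^ 2) / euler q ^ 2 := by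
  have e1 : qPochInf q q = euler q := tprod_congr fun n => by ring
  have e2 : qPochInf (-q) q * euler q = euler (q ^ 2) := by
    have h1 := multipliable_one_add_mul_pow hq 1 1 1 one_pos
    have h2 := multipliable_one_sub_pow' hq 1 1 one_pos
    simp only [one_mul] at h1 h2
    rw [euler, euler, qPochInf, tprod_congr (g := fun n : ℕ => 1 + q ^ (n + 1))
      (fun n => by ring), ← h1.tprod_mul h2]
    exact tprod_congr fun n => by ring
  rw [e1, ← e2]
  field_simp

lemma eta_eq_euler (z : ℂ) : ModularForm.eta z =
    exp (Real.pi * I * z / 12) * euler (exp (2 * Real.pi * I * z)) := by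
  rw [ModularForm.eta, euler, Function.Periodic.qParam]
  congr 1
  · congr 1
    push_cast
    ring
  · exact tprod_congr fun n => by rw [ModularForm.eta_q_eq_pow]

/-! ### Shifting the line of integration -/

/-- Quadratic decay at infinity of a function on the horizontal strip `a ≤ Im z ≤ b`. -/
def StripDecay (f : ℂ → ℂ) (a b : ℝ) : Prop :=
  ∃ C R : ℝ, ∀ z : ℂ, a ≤ z.im → z.im ≤ b → R ≤ |z.re| → ‖f z‖ ≤ C * (1 + z.re ^ 2)⁻¹

lemma integrableOn_of_decay {f : ℝ → ℂ} {S : Set ℝ} (hS : IsClosed S) (hf : ContinuousOn f S)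
    {C R : ℝ} (h : ∀ x : ℝ, R ≤ |x| → ‖f x‖ ≤ C * (1 + x ^ 2)⁻¹) : IntegrableOn f S := by
  obtain ⟨M, hM⟩ :=
    ((isCompact_Icc (a := -|R|) (b := |R|)).inter_right hS).exists_bound_of_continuousOn
    (hf.mono Set.inter_subset_right)
  refine Integrable.mono'
    (integrable_inv_one_add_sq.const_mul (|C| + |M| * (1 + R ^ 2))).integrableOn
    (hf.aestronglyMeasurable hS.measurableSet)
    ((ae_restrict_iff' hS.measurableSet).2 (Eventually.of_forall fun x hxS => ?_))
  rcases le_total R |x| with hx | hx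
  · refine (h x hx).trans ?_
    gcongr
    have : 0 ≤ |M| * (1 + R ^ 2) := by positivity
    linarith [le_abs_self C]
  · have h1 : |x| ≤ |R| := hx.trans (le_abs_self R)
    refine (hM x ⟨abs_le.1 h1, hxS⟩).trans ((le_abs_self M).trans ?_)
    have h3 : x ^ 2 ≤ R ^ 2 := sq_le_sq.2 h1
    rw [← div_eq_mul_inv, le_div_iff₀ (by positivity)]
    have : |M| * (1 + x ^ 2) ≤ |M| * (1 + R ^ 2) := by gcongr
    linarith [abs_nonneg C]

lemma integrable_of_decay {f : ℝ → ℂ} (hf : Continuous f) {C R : ℝ}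
    (h : ∀ x : ℝ, R ≤ |x| → ‖f x‖ ≤ C * (1 + x ^ 2)⁻¹) : Integrable f :=
  integrableOn_univ.1 (integrableOn_of_decay isClosed_univ hf.continuousOn h)

lemma line_re (x a : ℝ) : ((x : ℂ) + a * I).re = x := by simp
lemma line_im (x a : ℝ) : ((x : ℂ) + a * I).im = a := by simp

lemma StripDecay.integrable_line {f : ℂ → ℂ} {a b t : ℝ} (h : StripDecay f a b)
    (hat : a ≤ t) (htb : t ≤ b) (hf : Continuous fun x : ℝ => f (x + t * I)) :
    Integrable fun x : ℝ => f (x + t * I) := by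
  obtain ⟨C, R, h⟩ := h
  refine integrable_of_decay hf (C := C) (R := R) fun x hx => ?_
  have := h (x + t * I) (by rwa [line_im]) (by rwa [line_im]) (by rwa [line_re])
  rwa [line_re] at this

lemma continuous_line {f : ℂ → ℂ} {t : ℝ} (hf : ∀ z : ℂ, z.im = t → ContinuousAt f z) :
    Continuous fun x : ℝ => f (x + t * I) := by
  refine continuous_iff_continuousAt.2 fun x => ?_
  exact ContinuousAt.comp (f := fun x : ℝ => (x : ℂ) + t * I) (hf _ (line_im x t)) (by fun_prop)

/-- The integral over a horizontal line does not change when the line moves inside a strip of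
holomorphy. -/
theorem integral_line_eq {f : ℂ → ℂ} {a b : ℝ} (hab : a ≤ b)
    (hf : ∀ z : ℂ, a ≤ z.im → z.im ≤ b → DifferentiableAt ℂ f z) (hd : StripDecay f a b) :
    ∫ x : ℝ, f (x + a * I) = ∫ x : ℝ, f (x + b * I) := by
  have hia := hd.integrable_line le_rfl hab
    (continuous_line fun z hz => (hf z hz.ge (hz.le.trans hab)).continuousAt)
  have hib := hd.integrable_line hab le_rfl
    (continuous_line fun z hz => (hf z (hab.trans hz.ge) hz.le).continuousAt)
  have hlim := ((intervalIntegral_tendsto_integral hia tendsto_neg_atTop_atBot tendsto_id).sub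
    (intervalIntegral_tendsto_integral hib tendsto_neg_atTop_atBot tendsto_id))
  obtain ⟨C, R, h⟩ := hd
  have hinv : Tendsto (fun X : ℝ => C * (1 + X ^ 2)⁻¹ * |b - a|) atTop (𝓝 0) := by
    have : Tendsto (fun X : ℝ => (1 + X ^ 2)⁻¹) atTop (𝓝 0) :=
      tendsto_inv_atTop_zero.comp (tendsto_atTop_add_const_left _ _ (tendsto_pow_atTop two_ne_zero))
    simpa using (this.const_mul C).mul_const |b - a|
  have hside : ∀ σ : ℝ → ℝ, (∀ X, |σ X| = |X|) → Tendsto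
      (fun X : ℝ => I • ∫ y : ℝ in a..b, f (σ X + y * I)) atTop (𝓝 0) := by
    intro σ hσ
    refine squeeze_zero_norm' ?_ hinv
    filter_upwards [eventually_ge_atTop R] with X hX
    rw [norm_smul, norm_I, one_mul]
    refine intervalIntegral.norm_integral_le_of_norm_le_const fun y hy => ?_
    rw [Set.uIoc_of_le hab] at hy
    have h2 := h (σ X + y * I) (by rw [line_im]; exact hy.1.le) (by rw [line_im]; exact hy.2)
      (by rw [line_re, hσ]; exact hX.trans (le_abs_self X))
    rw [line_re, ← sq_abs, hσ, sq_abs] at h2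
    exact h2
  have hzero : Tendsto (fun X : ℝ => (∫ x : ℝ in -X..X, f (x + a * I)) -
      ∫ x : ℝ in -X..X, f (x + b * I)) atTop (𝓝 (0 - 0)) := by
    refine ((hside (fun X => -X) fun X => abs_neg X).sub (hside (fun X => X) fun X => rfl)).congr'
      ?_
    filter_upwards with X
    have hrect := integral_boundary_rect_eq_zero_of_differentiableOn f (-X + a * I) (X + b * I) (by
      intro z hz
      have hz2 := hz.2
      simp only [add_im, neg_im, ofReal_im, mul_im, I_re, I_im, mul_one, mul_zero, add_zero,
        neg_zero, zero_add, ofReal_re, Set.uIcc_of_le hab, Set.mem_preimage] at hz2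
      exact (hf z hz2.1 hz2.2).differentiableWithinAt)
    simp only [add_re, add_im, neg_re, neg_im, ofReal_re, ofReal_im, mul_re, mul_im, I_re, I_im,
      mul_one, mul_zero, add_zero, neg_zero, zero_add, sub_self] at hrect
    linear_combination -hrect
  rw [sub_zero] at hzero
  exact sub_eq_zero.1 (tendsto_nhds_unique hlim hzero)

lemma integral_div_sq_add_sq {β : ℝ} (hβ : 0 < β) :
    Integrable (fun x : ℝ => β / (x ^ 2 + β ^ 2)) ∧ ∫ x : ℝ, β / (x ^ 2 + β ^ 2) = Real.pi := by
  have e : (fun x : ℝ => β / (x ^ 2 + β ^ 2)) = fun x => β⁻¹ * (1 + (x * β⁻¹) ^ 2)⁻¹ := by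
    funext x
    field_simp
    ring
  rw [e]
  refine ⟨(integrable_inv_one_add_sq.comp_mul_right' (inv_ne_zero hβ.ne')).const_mul _, ?_⟩
  rw [integral_const_mul, Measure.integral_comp_mul_right (fun y : ℝ => (1 + y ^ 2)⁻¹),
    integral_univ_inv_one_add_sq, inv_inv, abs_of_pos hβ, smul_eq_mul]
  field_simp

/-- A rational kernel with residue `1` at the origin whose other poles `± i R` are out of the way:
its integral over the line `Im v = t` is half of a full turn around the origin. -/
lemma integral_rational_kernel {t R : ℝ} (ht : 0 < t) (hR : t < R) :
    ∫ x : ℝ, (R : ℂ) ^ 2 / ((x + t * I) * ((x + t * I) ^ 2 + R ^ 2)) = -(Real.pi * I) := by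
  set f : ℝ → ℂ := fun x => (R : ℂ) ^ 2 / ((x + t * I) * ((x + t * I) ^ 2 + R ^ 2)) with hf
  have hne : ∀ (x β : ℝ), β ≠ 0 → (x : ℂ) + β * I ≠ 0 := by
    intro x β hβ h
    have := congrArg Complex.im h
    rw [line_im] at this
    exact hβ this
  have hfac : ∀ x : ℝ, ((x : ℂ) + t * I) ^ 2 + R ^ 2 =
      (x + ((t - R : ℝ) : ℂ) * I) * (x + ((t + R : ℝ) : ℂ) * I) := by
    intro x
    push_cast
    linear_combination (R : ℂ) ^ 2 * I_sq
  have h1 : ∀ x : ℝ, (x : ℂ) + t * I ≠ 0 := fun x => hne x t ht.ne'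
  have h2 : ∀ x : ℝ, (x : ℂ) + ((t - R : ℝ) : ℂ) * I ≠ 0 := fun x => hne x _ (by linarith)
  have h3 : ∀ x : ℝ, (x : ℂ) + ((t + R : ℝ) : ℂ) * I ≠ 0 := fun x => hne x _ (by linarith)
  have hcont : Continuous f := by
    refine Continuous.div (by fun_prop) (by fun_prop) fun x => ?_
    rw [hfac]
    exact mul_ne_zero (h1 x) (mul_ne_zero (h2 x) (h3 x))
  have hR0 : 0 < R := ht.trans hR
  have hfi : Integrable f := by
    refine integrable_of_decay hcont (C := 2 * R ^ 2) (R := 1) fun x hx => ?_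
    have hn : ∀ β : ℝ, |x| ≤ ‖(x : ℂ) + β * I‖ := fun β => by
      have := abs_re_le_norm ((x : ℂ) + β * I)
      rwa [line_re] at this
    rw [hf]
    dsimp only
    rw [hfac, norm_div, norm_mul, norm_mul, norm_pow, norm_real, Real.norm_of_nonneg hR0.le,
      ← div_eq_mul_inv]
    have hd : |x| * |x| ≤ ‖(x : ℂ) + t * I‖ * (‖(x : ℂ) + ((t - R : ℝ) : ℂ) * I‖ *
        ‖(x : ℂ) + ((t + R : ℝ) : ℂ) * I‖) := by
      calc |x| * |x| = 1 * (|x| * |x|) := (one_mul _).symm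
        _ ≤ _ := by
          have := hn t
          have := hn (t - R)
          have := hn (t + R)
          gcongr
          linarith
    have hx2 : 1 ≤ x ^ 2 := by
      rw [← sq_abs]
      nlinarith
    rw [abs_mul_abs_self] at hd
    calc _ ≤ R ^ 2 / (x * x) := by gcongr; nlinarith
      _ ≤ _ := by
        rw [div_le_div_iff₀ (by nlinarith) (by positivity)]
        nlinarith [sq_nonneg R]
  have hsym : ∀ x : ℝ, f x + f (-x) = -(I * (((2 * (t / (x ^ 2 + t ^ 2)) +
      ((R - t) / (x ^ 2 + (R - t) ^ 2)) - ((t + R) / (x ^ 2 + (t + R) ^ 2)) : ℝ)) : ℂ)) := by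
    intro x
    have hq : ∀ β : ℝ, β ≠ 0 → (x : ℂ) ^ 2 + (β : ℂ) ^ 2 ≠ 0 := by
      intro β hβ
      have : x ^ 2 + β ^ 2 ≠ 0 := by positivity
      exact_mod_cast this
    have hpf : ∀ y : ℝ, f y = 1 / (y + t * I) - (1 / 2) * (1 / (y + ((t - R : ℝ) : ℂ) * I) +
        1 / (y + ((t + R : ℝ) : ℂ) * I)) := by
      intro y
      rw [hf]
      dsimp only
      rw [hfac]
      have n1 := h1 y
      have n2 := h2 y
      have n3 := h3 y
      have hB : (y : ℂ) + ((t - R : ℝ) : ℂ) * I = (y + t * I) - R * I := by push_cast; ring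
      have hC : (y : ℂ) + ((t + R : ℝ) : ℂ) * I = (y + t * I) + R * I := by push_cast; ring
      generalize (y : ℂ) + ((t - R : ℝ) : ℂ) * I = B at *
      generalize (y : ℂ) + ((t + R : ℝ) : ℂ) * I = C at *
      generalize (y : ℂ) + t * I = A at *
      field_simp
      rw [hB, hC]
      linear_combination (2 * (R : ℂ) ^ 2) * I_sq
    have hinv : ∀ β : ℝ, β ≠ 0 → 1 / ((x : ℂ) + β * I) + 1 / (((-x : ℝ) : ℂ) + β * I) =
        -(2 * I * β) / ((x : ℂ) ^ 2 + (β : ℂ) ^ 2) := by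
      intro β hβ
      have e1 := hne x β hβ
      have e2 := hne (-x) β hβ
      rw [div_add_div _ _ e1 e2, div_eq_div_iff (mul_ne_zero e1 e2) (hq β hβ)]
      push_cast
      linear_combination (2 * I * (β : ℂ) ^ 3) * I_sq
    have i1 := hinv t ht.ne'
    have i2 := hinv (t - R) (by linarith)
    have i3 := hinv (t + R) (by linarith)
    have e2 : -(2 * I * ((t - R : ℝ) : ℂ)) / ((x : ℂ) ^ 2 + ((t - R : ℝ) : ℂ) ^ 2) =
        2 * I * (((R - t : ℝ) : ℂ) / ((x : ℂ) ^ 2 + ((R - t : ℝ) : ℂ) ^ 2)) := by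
      rw [show ((t - R : ℝ) : ℂ) = -((R - t : ℝ) : ℂ) by push_cast; ring, neg_sq]
      ring
    rw [e2] at i2
    rw [hpf, hpf]
    push_cast at i1 i2 i3 ⊢
    linear_combination i1 - (1 / 2) * i2 - (1 / 2) * i3
  obtain ⟨k1, v1⟩ := integral_div_sq_add_sq ht
  obtain ⟨k2, v2⟩ := integral_div_sq_add_sq (sub_pos.2 hR)
  obtain ⟨k3, v3⟩ := integral_div_sq_add_sq (add_pos ht hR0)
  have hreal : ∫ x : ℝ, (2 * (t / (x ^ 2 + t ^ 2)) + (R - t) / (x ^ 2 + (R - t) ^ 2) -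
      (t + R) / (x ^ 2 + (t + R) ^ 2)) = 2 * Real.pi := by
    have hs := integral_sub (f := fun x : ℝ => 2 * (t / (x ^ 2 + t ^ 2)) +
      (R - t) / (x ^ 2 + (R - t) ^ 2)) ((k1.const_mul 2).add k2) k3
    rw [hs, integral_add (k1.const_mul 2) k2, integral_const_mul, v1, v2, v3]
    ring
  have hsum : ∫ x : ℝ, (f x + f (-x)) = -(I * ((2 * Real.pi : ℝ) : ℂ)) := by
    rw [integral_congr_ae (Eventually.of_forall hsym), integral_neg, integral_const_mul,
      integral_complex_ofReal, hreal]
  rw [integral_add hfi hfi.comp_neg, integral_neg_eq_self] at hsum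
  push_cast at hsum
  linear_combination (1 / 2) * hsum

lemma integral_rational_kernel_neg {t R : ℝ} (ht : t < 0) (hR : -t < R) :
    ∫ x : ℝ, (R : ℂ) ^ 2 / ((x + t * I) * ((x + t * I) ^ 2 + R ^ 2)) = Real.pi * I := by
  have h := integral_rational_kernel (neg_pos.2 ht) hR
  rw [← integral_neg_eq_self] at h
  have e : ∀ x : ℝ, (R : ℂ) ^ 2 / ((((-x : ℝ) : ℂ) + ((-t : ℝ) : ℂ) * I) *
      ((((-x : ℝ) : ℂ) + ((-t : ℝ) : ℂ) * I) ^ 2 + R ^ 2)) =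
      -((R : ℂ) ^ 2 / ((x + t * I) * ((x + t * I) ^ 2 + R ^ 2))) := by
    intro x
    rw [show ((-x : ℝ) : ℂ) + ((-t : ℝ) : ℂ) * I = -(x + t * I) by push_cast; ring, neg_sq, neg_mul,
      div_neg]
  rw [integral_congr_ae (Eventually.of_forall e), integral_neg] at h
  linear_combination -h

/-- Moving a horizontal line across a simple pole `p` of `f = g / (z - p)` changes the integral by
`2πi g(p)`. -/
theorem integral_line_sub_integral_line {f g : ℂ → ℂ} {a b : ℝ} {p : ℂ} (ha : a < p.im)
    (hb : p.im < b) (hg : ∀ z : ℂ, a ≤ z.im → z.im ≤ b → DifferentiableAt ℂ g z)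
    (hfg : ∀ z : ℂ, a ≤ z.im → z.im ≤ b → z ≠ p → f z = g z / (z - p))
    (hd : StripDecay f a b) :
    (∫ x : ℝ, f (x + a * I)) - ∫ x : ℝ, f (x + b * I) = 2 * Real.pi * I * g p := by
  have hab : a ≤ b := (ha.trans hb).le
  set R : ℝ := b - a + 1 with hR
  have hR0 : 0 < R := by linarith
  have hfac : ∀ z : ℂ, (z - p) ^ 2 + (R : ℂ) ^ 2 = (z - p - R * I) * (z - p + R * I) := by
    intro z
    linear_combination (R : ℂ) ^ 2 * I_sq
  have hden : ∀ z : ℂ, a ≤ z.im → z.im ≤ b → (z - p) ^ 2 + (R : ℂ) ^ 2 ≠ 0 := by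
    intro z h1 h2
    rw [hfac]
    refine mul_ne_zero (fun h => ?_) (fun h => ?_)
    · have := congrArg Complex.im h
      simp at this
      linarith
    · have := congrArg Complex.im h
      simp at this
      linarith
  -- subtract a multiple of the rational kernel to make the singularity removable
  set E : ℂ → ℂ := fun z => (R : ℂ) ^ 2 / ((z - p) ^ 2 + R ^ 2) with hE
  set φ : ℂ → ℂ := fun z => g z - g p * E z with hφ
  have hEd : ∀ z : ℂ, a ≤ z.im → z.im ≤ b → DifferentiableAt ℂ E z := fun z h1 h2 =>
    DifferentiableAt.div (by fun_prop) (by fun_prop) (hden z h1 h2)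
  have hEp : E p = 1 := by
    have : (R : ℂ) ≠ 0 := by exact_mod_cast hR0.ne'
    simp only [hE, sub_self, ne_eq, OfNat.ofNat_ne_zero, not_false_eq_true, zero_pow, zero_add]
    exact div_self (pow_ne_zero 2 this)
  have hφp : φ p = 0 := by simp [hφ, hEp]
  have hφd : ∀ z : ℂ, a ≤ z.im → z.im ≤ b → DifferentiableAt ℂ φ z := fun z h1 h2 =>
    (hg z h1 h2).sub ((hEd z h1 h2).const_mul _)
  have hψd : ∀ z : ℂ, a ≤ z.im → z.im ≤ b → DifferentiableAt ℂ (dslope φ p) z := by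
    intro z h1 h2
    rcases eq_or_ne z p with rfl | hz
    · have hs : {z' : ℂ | a < z'.im ∧ z'.im < b} ∈ 𝓝 z :=
        ((isOpen_lt continuous_const continuous_im).inter
          (isOpen_lt continuous_im continuous_const)).mem_nhds ⟨ha, hb⟩
      have h3 := (Complex.differentiableOn_dslope (f := φ) hs).2 fun z' hz' =>
        (hφd z' hz'.1.le hz'.2.le).differentiableWithinAt
      exact h3.differentiableAt hs
    · exact (differentiableAt_dslope_of_ne hz).2 (hφd z h1 h2)
  have hψ : ∀ z : ℂ, a ≤ z.im → z.im ≤ b → z ≠ p →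
      dslope φ p z = f z - g p * ((R : ℂ) ^ 2 / ((z - p) * ((z - p) ^ 2 + R ^ 2))) := by
    intro z h1 h2 hz
    have h3 := sub_ne_zero.2 hz
    rw [dslope_of_ne _ hz, slope_def_field, hφp, sub_zero, hfg z h1 h2 hz]
    simp only [hφ, hE]
    field_simp
  have hKd : StripDecay (fun z => (R : ℂ) ^ 2 / ((z - p) * ((z - p) ^ 2 + R ^ 2))) a b := by
    refine ⟨2 * R ^ 2 * 8, 1 + 2 * |p.re| + 2, fun z h1 h2 hz => ?_⟩
    have hx : |z.re| / 2 ≤ |z.re - p.re| := by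
      have := abs_sub_abs_le_abs_sub z.re p.re
      linarith [abs_nonneg p.re]
    have hn : ∀ β : ℝ, |z.re| / 2 ≤ ‖z - p + β * I‖ := fun β => by
      have := abs_re_le_norm (z - p + β * I)
      simp only [add_re, sub_re, mul_re, ofReal_re, I_re, mul_zero, ofReal_im, I_im, mul_one,
        sub_self, add_zero] at this
      exact hx.trans this
    have n1 := hn 0
    have n2 := hn (-R)
    have n3 := hn R
    rw [ofReal_zero, zero_mul, add_zero] at n1
    rw [ofReal_neg, neg_mul, ← sub_eq_add_neg] at n2
    dsimp only
    rw [hfac, norm_div, norm_mul, norm_mul, norm_pow, norm_real, Real.norm_of_nonneg hR0.le,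
      ← div_eq_mul_inv]
    have hz3 : 3 ≤ |z.re| := by linarith [abs_nonneg p.re]
    have hz2 : 9 ≤ z.re ^ 2 := by
      rw [← sq_abs]
      nlinarith
    have hd : 1 * ((|z.re| / 2) * (|z.re| / 2)) ≤
        ‖z - p‖ * (‖z - p - R * I‖ * ‖z - p + R * I‖) := by
      gcongr
      linarith
    have hd' : 1 * ((|z.re| / 2) * (|z.re| / 2)) = z.re ^ 2 / 4 := by
      rw [← sq_abs]
      ring
    rw [hd'] at hd
    calc _ ≤ R ^ 2 / (z.re ^ 2 / 4) := by gcongr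
      _ ≤ _ := by
        rw [div_le_div_iff₀ (by positivity) (by positivity)]
        nlinarith [sq_nonneg R]
  have hψdec : StripDecay (dslope φ p) a b := by
    obtain ⟨C₁, R₁, h1⟩ := hd
    obtain ⟨C₂, R₂, h2⟩ := hKd
    refine ⟨C₁ + ‖g p‖ * C₂, max (max R₁ R₂) (|p.re| + 1), fun z hza hzb hz => ?_⟩
    have hzp : z ≠ p := by
      rintro rfl
      have := (le_max_right _ _).trans hz
      linarith
    rw [hψ z hza hzb hzp]
    refine (norm_sub_le _ _).trans ?_
    rw [norm_mul, add_mul, mul_assoc]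
    have e1 := h1 z hza hzb (((le_max_left _ _).trans (le_max_left _ _)).trans hz)
    have e2 := h2 z hza hzb (((le_max_right _ _).trans (le_max_left _ _)).trans hz)
    gcongr
  have heq := integral_line_eq hab hψd hψdec
  have hline : ∀ t : ℝ, a ≤ t → t ≤ b → t ≠ p.im →
      ∫ x : ℝ, dslope φ p (x + t * I) = (∫ x : ℝ, f (x + t * I)) -
        g p * ∫ x : ℝ, (R : ℂ) ^ 2 / ((x + ((t - p.im : ℝ) : ℂ) * I) *
          ((x + ((t - p.im : ℝ) : ℂ) * I) ^ 2 + R ^ 2)) := by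
    intro t h1 h2 ht
    have hzp : ∀ z : ℂ, z.im = t → z ≠ p := by
      rintro z hz rfl
      exact ht hz.symm
    have hKi := hKd.integrable_line h1 h2 (continuous_line
      (f := fun z => (R : ℂ) ^ 2 / ((z - p) * ((z - p) ^ 2 + R ^ 2))) fun z hz =>
      ContinuousAt.div (by fun_prop) (by fun_prop) (mul_ne_zero (sub_ne_zero.2 (hzp z hz))
        (hden z (h1.trans hz.ge) (hz.le.trans h2))))
    have hfi : Integrable fun x : ℝ => f (x + t * I) := by
      refine hd.integrable_line h1 h2 ?_
      have : (fun x : ℝ => f (x + t * I)) = fun x : ℝ => g (x + t * I) / (x + t * I - p) := by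
        funext x
        exact hfg _ (by rwa [line_im]) (by rwa [line_im]) (hzp _ (line_im x t))
      rw [this]
      exact continuous_line (f := fun z => g z / (z - p)) fun z hz =>
        ContinuousAt.div (hg z (h1.trans hz.ge) (hz.le.trans h2)).continuousAt (by fun_prop)
          (sub_ne_zero.2 (hzp z hz))
    have hcongr : ∀ x : ℝ, dslope φ p (x + t * I) = f (x + t * I) -
        g p * ((R : ℂ) ^ 2 / ((x + t * I - p) * ((x + t * I - p) ^ 2 + R ^ 2))) := fun x =>
      hψ _ (by rwa [line_im]) (by rwa [line_im]) (hzp _ (line_im x t))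
    rw [integral_congr_ae (Eventually.of_forall hcongr), integral_sub hfi (hKi.const_mul _),
      integral_const_mul, ← integral_sub_right_eq_self (fun x : ℝ => (R : ℂ) ^ 2 /
        ((x + ((t - p.im : ℝ) : ℂ) * I) * ((x + ((t - p.im : ℝ) : ℂ) * I) ^ 2 + R ^ 2))) p.re]
    congr 2
    refine integral_congr_ae (Eventually.of_forall fun x => ?_)
    have : (x : ℂ) + t * I - p = ((x - p.re : ℝ) : ℂ) + ((t - p.im : ℝ) : ℂ) * I := by
      conv_lhs => rw [← re_add_im p]
      push_cast
      ring
    simp only [this]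
  rw [hline a le_rfl hab ha.ne, hline b hab le_rfl hb.ne',
    integral_rational_kernel_neg (sub_neg.2 ha) (by linarith),
    integral_rational_kernel (sub_pos.2 hb) (by linarith)] at heq
  linear_combination heq

/-! ### The Mordell integrand, its poles and its residues -/

lemma norm_exp_quadratic_le {A : ℂ} (hA : 0 < A.re) (B : ℂ) (V : ℝ) :
    ∃ C : ℝ, ∀ z : ℂ, |z.im| ≤ V → ‖exp (-(A * z ^ 2) + B * z)‖ ≤ C * (1 + z.re ^ 2)⁻¹ := by
  set b : ℝ := 2 * |A.im| * V + |B.re| with hb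
  set c : ℝ := A.re * V ^ 2 + |B.im| * V with hc
  refine ⟨Real.exp (b ^ 2 / (2 * A.re) + c) * (1 + 2 / A.re), fun z hz => ?_⟩
  rw [norm_exp]
  have hre : (-(A * z ^ 2) + B * z).re ≤ -(A.re / 2) * z.re ^ 2 + (b ^ 2 / (2 * A.re) + c) := by
    have e : (-(A * z ^ 2) + B * z).re = -A.re * z.re ^ 2 + A.re * z.im ^ 2 +
        2 * A.im * z.re * z.im + B.re * z.re - B.im * z.im := by
      simp only [add_re, neg_re, mul_re, sq, mul_im]
      ring
    rw [e]
    have h1 : z.im ^ 2 ≤ V ^ 2 := by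
      rw [← sq_abs]
      gcongr
    have h2 : A.im * z.re * z.im ≤ |A.im| * V * |z.re| := by
      calc A.im * z.re * z.im ≤ |A.im * z.re * z.im| := le_abs_self _
        _ = |A.im| * |z.im| * |z.re| := by rw [abs_mul, abs_mul]; ring
        _ ≤ _ := by gcongr
    have h3 : B.re * z.re ≤ |B.re| * |z.re| := by
      rw [← abs_mul]
      exact le_abs_self _
    have h4 : -(B.im * z.im) ≤ |B.im| * V := by
      calc -(B.im * z.im) ≤ |B.im * z.im| := neg_le_abs _
        _ = |B.im| * |z.im| := abs_mul _ _
        _ ≤ _ := by gcongr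
    have h5 : b * |z.re| ≤ A.re / 2 * z.re ^ 2 + b ^ 2 / (2 * A.re) := by
      have h6 : 0 ≤ (A.re * |z.re| - b) ^ 2 / (2 * A.re) := by positivity
      have h7 : (A.re * |z.re| - b) ^ 2 / (2 * A.re) =
          A.re / 2 * z.re ^ 2 + b ^ 2 / (2 * A.re) - b * |z.re| := by
        rw [← sq_abs z.re]
        field_simp
        ring
      linarith
    rw [hb] at h5
    rw [hc]
    nlinarith
  refine (Real.exp_le_exp.2 hre).trans ?_
  rw [Real.exp_add, mul_comm, mul_assoc]
  gcongr
  have h9 : Real.exp (-(A.re / 2) * z.re ^ 2) ≤ (1 + A.re / 2 * z.re ^ 2)⁻¹ := by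
    rw [neg_mul, Real.exp_neg]
    gcongr
    linarith [Real.add_one_le_exp (A.re / 2 * z.re ^ 2)]
  refine h9.trans ?_
  rw [← div_eq_mul_inv, inv_eq_one_div, div_le_div_iff₀ (by positivity) (by positivity)]
  have h10 : 2 / A.re * (A.re / 2 * z.re ^ 2) = z.re ^ 2 := by field_simp
  have h11 : 0 ≤ 2 / A.re := by positivity
  nlinarith

/-- Gaussian times the character of frequency `μ / (2k)`. -/
noncomputable def gaussChar (k : ℕ) (w : ℂ) (μ : ℤ) (x : ℂ) : ℂ :=
  exp (-(2 * Real.pi * w * x ^ 2 / k) + Real.pi * I * μ * x / k)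

/-- The denominator of the Mordell integrand with phase `c`. -/
noncomputable def mordellDen (k : ℕ) (w : ℂ) (c : ℝ) (x : ℂ) : ℂ :=
  1 + exp (2 * Real.pi * I * c - 2 * Real.pi * w * x / k)

/-- The imaginary part of the `n`-th pole, in units of `i / w`. -/
noncomputable def poleHeight (k : ℕ) (c : ℝ) (n : ℤ) : ℝ := k * (c + 1 / 2 + n)

/-- The integral over the horizontal line through `i s / w`. -/
noncomputable def lineIntegral (k : ℕ) (w : ℂ) (c : ℝ) (μ : ℤ) (s : ℝ) : ℂ :=
  ∫ x : ℝ, gaussChar k w μ (x + ((s * (1 / w).re : ℝ) : ℂ) * I) /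
    mordellDen k w c (x + ((s * (1 / w).re : ℝ) : ℂ) * I)

/-- The Mordell integral with phase `c`. -/
noncomputable def mordellJ (k : ℕ) (w : ℂ) (c : ℝ) : ℂ :=
  ∫ x : ℝ, exp (-(2 * Real.pi * w * x ^ 2 / k)) / mordellDen k w c x

section

variable {k : ℕ} {w : ℂ}

lemma mordellDen_eq_zero_iff (hk : 0 < k) (hw : 0 < w.re) (c : ℝ) (x : ℂ) :
    mordellDen k w c x = 0 ↔ ∃ n : ℤ, x = I * (poleHeight k c n : ℂ) / w := by
  have hw0 := ne_zero_of_re_pos hw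
  have hk0 : (k : ℂ) ≠ 0 := by exact_mod_cast hk.ne'
  have h1 : mordellDen k w c x = 0 ↔
      exp (2 * Real.pi * I * c - 2 * Real.pi * w * x / k) = exp (Real.pi * I) := by
    rw [mordellDen, exp_pi_mul_I, add_comm, add_eq_zero_iff_eq_neg]
  rw [h1, exp_eq_exp_iff_exists_int]
  constructor
  · rintro ⟨n, hn⟩
    refine ⟨-n - 1, ?_⟩
    have hx : x = (2 * Real.pi * I * c - (Real.pi * I + n * (2 * Real.pi * I))) * k /
        (2 * Real.pi * w) := by
      rw [← hn]
      field_simp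
      ring
    rw [hx, poleHeight]
    push_cast
    field_simp
    ring
  · rintro ⟨n, rfl⟩
    refine ⟨-n - 1, ?_⟩
    rw [poleHeight]
    push_cast
    field_simp
    ring

lemma poleHeight_im (w : ℂ) (T : ℝ) : (I * (T : ℂ) / w).im = T * (1 / w).re := by
  rw [mul_div_assoc, I_mul_im, ← mul_one_div, re_ofReal_mul]

lemma poleHeight_lt_iff (hk : 0 < k) (c : ℝ) (m n : ℤ) :
    poleHeight k c m < poleHeight k c n ↔ m < n := by
  have : (0 : ℝ) < k := by exact_mod_cast hk
  rw [poleHeight, poleHeight, mul_lt_mul_iff_right₀ this, add_lt_add_iff_left, Int.cast_lt]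

lemma differentiable_gaussChar (k : ℕ) (w : ℂ) (μ : ℤ) : Differentiable ℂ (gaussChar k w μ) := by
  unfold gaussChar
  fun_prop

lemma differentiable_mordellDen (k : ℕ) (w : ℂ) (c : ℝ) :
    Differentiable ℂ (mordellDen k w c) := by
  unfold mordellDen
  fun_prop

/-- The numerator is Gaussian, and for `|Re z|` large the exponential in the denominator is either
small or large, which bounds the denominator below by `1 / 2`. -/
lemma stripDecay_mordell (hk : 0 < k) (hw : 0 < w.re) (c : ℝ) (μ : ℤ) (a b : ℝ) :
    StripDecay (fun z => gaussChar k w μ z / mordellDen k w c z) a b := by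
  set V : ℝ := max |a| |b| with hV
  have hA : 0 < (2 * Real.pi * w / k : ℂ).re := by
    have : (2 * Real.pi * w / k : ℂ) = ((2 * Real.pi / k : ℝ) : ℂ) * w := by
      push_cast
      ring
    rw [this, re_ofReal_mul]
    positivity
  obtain ⟨C, hC⟩ := norm_exp_quadratic_le hA (Real.pi * I * μ / k) V
  refine ⟨C * 2, (1 + |w.im| * V * (2 * Real.pi / k)) / (w.re * (2 * Real.pi / k)),
    fun z h1 h2 hz => ?_⟩
  have him : |z.im| ≤ V := abs_le_max_abs_abs h1 h2
  have hnum : ‖gaussChar k w μ z‖ ≤ C * (1 + z.re ^ 2)⁻¹ := by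
    refine le_of_eq_of_le ?_ (hC z him)
    rw [gaussChar]
    congr 2
    ring
  have hden : 1 / 2 ≤ ‖mordellDen k w c z‖ := by
    set y : ℝ := (2 * Real.pi * I * c - 2 * Real.pi * w * z / k : ℂ).re with hy
    have hY : ‖exp (2 * Real.pi * I * c - 2 * Real.pi * w * z / k)‖ = Real.exp y := norm_exp _
    have hye : y = -(2 * Real.pi / k) * (w.re * z.re - w.im * z.im) := by
      have : (2 * Real.pi * I * c - 2 * Real.pi * w * z / k : ℂ) =
          ((2 * Real.pi * c : ℝ) : ℂ) * I + ((-(2 * Real.pi / k) : ℝ) : ℂ) * (w * z) := by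
        push_cast
        ring
      rw [hy, this, add_re, re_ofReal_mul, re_ofReal_mul, I_re, mul_zero, zero_add, mul_re]
    have hbig : 1 ≤ |y| := by
      have hp : 0 < 2 * Real.pi / k := by positivity
      rw [hye, abs_mul, abs_neg, abs_of_pos hp]
      have h3 : w.re * |z.re| - |w.im| * V ≤ |w.re * z.re - w.im * z.im| := by
        have := abs_sub_abs_le_abs_sub (w.re * z.re) (w.im * z.im)
        rw [abs_mul, abs_mul, abs_of_pos hw] at this
        have h4 : |w.im| * |z.im| ≤ |w.im| * V := by gcongr
        linarith
      rw [div_le_iff₀ (by positivity)] at hz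
      nlinarith
    have hexp1 : (2 : ℝ) ≤ Real.exp 1 := by linarith [Real.add_one_le_exp (1 : ℝ)]
    rw [mordellDen]
    rcases le_abs.1 hbig with h3 | h3
    · have h4 : 2 ≤ Real.exp y := hexp1.trans (Real.exp_le_exp.2 h3)
      have h5 := norm_sub_le_norm_add (exp (2 * Real.pi * I * c - 2 * Real.pi * w * z / k)) 1
      rw [hY, norm_one, add_comm] at h5
      linarith
    · have h4 : Real.exp y ≤ 1 / 2 := by
        rw [← neg_neg y, Real.exp_neg, one_div]
        exact inv_anti₀ two_pos (hexp1.trans (Real.exp_le_exp.2 h3))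
      have h5 := norm_sub_le_norm_add 1 (exp (2 * Real.pi * I * c - 2 * Real.pi * w * z / k))
      rw [hY, norm_one] at h5
      linarith
  rw [norm_div, div_eq_mul_inv]
  have h6 : ‖mordellDen k w c z‖⁻¹ ≤ 2 := by
    rw [show (2 : ℝ) = (1 / 2)⁻¹ by norm_num]
    exact inv_anti₀ (by norm_num) hden
  calc _ ≤ (C * (1 + z.re ^ 2)⁻¹) * 2 := by
        gcongr
        exact (norm_nonneg _).trans hnum
    _ = _ := by ring

lemma mordellDen_ne_zero_of_im (hk : 0 < k) (hw : 0 < w.re) {c s : ℝ} {z : ℂ}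
    (hz : z.im = s * (1 / w).re) (hs : ∀ n, poleHeight k c n ≠ s) : mordellDen k w c z ≠ 0 := by
  intro h
  obtain ⟨n, rfl⟩ := (mordellDen_eq_zero_iff hk hw c z).1 h
  rw [poleHeight_im] at hz
  exact hs n (mul_right_cancel₀ (re_inv_pos hw).ne' hz)

lemma lineIntegral_eq_of_no_pole (hk : 0 < k) (hw : 0 < w.re) (c : ℝ) (μ : ℤ) {s t : ℝ}
    (hst : s ≤ t) (hp : ∀ n, ¬(s ≤ poleHeight k c n ∧ poleHeight k c n ≤ t)) :
    lineIntegral k w c μ s = lineIntegral k w c μ t := by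
  have hρ := re_inv_pos hw
  refine integral_line_eq (f := fun z => gaussChar k w μ z / mordellDen k w c z)
    (by gcongr) (fun z h1 h2 => ?_) (stripDecay_mordell hk hw c μ _ _)
  refine (differentiable_gaussChar k w μ z).div (differentiable_mordellDen k w c z) fun h => ?_
  obtain ⟨n, rfl⟩ := (mordellDen_eq_zero_iff hk hw c z).1 h
  rw [poleHeight_im] at h1 h2
  exact hp n ⟨le_of_mul_le_mul_right h1 hρ, le_of_mul_le_mul_right h2 hρ⟩

/-- `2πi` times the residue of the Mordell integrand at `i T / w`. -/
noncomputable def mordellRes (k : ℕ) (w : ℂ) (μ : ℤ) (T : ℝ) : ℂ :=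
  I * k / w * exp ((2 * Real.pi * T ^ 2 - Real.pi * μ * T) / (k * w))

lemma lineIntegral_sub_of_one_pole (hk : 0 < k) (hw : 0 < w.re) (c : ℝ) (μ : ℤ) {s t : ℝ} (n : ℤ)
    (hs : s < poleHeight k c n) (ht : poleHeight k c n < t)
    (hp : ∀ m, m ≠ n → ¬(s ≤ poleHeight k c m ∧ poleHeight k c m ≤ t)) :
    lineIntegral k w c μ s - lineIntegral k w c μ t = mordellRes k w μ (poleHeight k c n) := by
  have hρ := re_inv_pos hw
  have hw0 := ne_zero_of_re_pos hw
  have hk0 : (k : ℂ) ≠ 0 := by exact_mod_cast hk.ne'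
  have hpi : (Real.pi : ℂ) ≠ 0 := by exact_mod_cast Real.pi_ne_zero
  set p : ℂ := I * (poleHeight k c n : ℂ) / w with hpdef
  have hpim : p.im = poleHeight k c n * (1 / w).re := poleHeight_im w _
  have hDp : mordellDen k w c p = 0 := (mordellDen_eq_zero_iff hk hw c p).2 ⟨n, rfl⟩
  have hderiv : deriv (mordellDen k w c) p = 2 * Real.pi * w / k := by
    have h1 : HasDerivAt (mordellDen k w c)
        (exp (2 * Real.pi * I * c - 2 * Real.pi * w * p / k) * (-(2 * Real.pi * w / k))) p := by
      have h2 : HasDerivAt (fun x : ℂ => 2 * Real.pi * I * c - 2 * Real.pi * w * x / k)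
          (-(2 * Real.pi * w / k)) p := by
        have := (((hasDerivAt_id p).const_mul (2 * Real.pi * w)).div_const (k : ℂ)).const_sub
          (2 * Real.pi * I * c)
        simpa using this
      exact h2.cexp.const_add 1
    rw [h1.deriv]
    have h3 : exp (2 * Real.pi * I * c - 2 * Real.pi * w * p / k) = -1 := by
      rw [mordellDen] at hDp
      linear_combination hDp
    rw [h3]
    ring
  have hslope : ∀ z : ℂ, z ≠ p → dslope (mordellDen k w c) p z = mordellDen k w c z / (z - p) := by
    intro z hz
    rw [dslope_of_ne _ hz, slope_def_field, hDp, sub_zero]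
  have hslope0 : ∀ z : ℂ, s * (1 / w).re ≤ z.im → z.im ≤ t * (1 / w).re →
      dslope (mordellDen k w c) p z ≠ 0 := by
    intro z h1 h2
    rcases eq_or_ne z p with rfl | hz
    · rw [dslope_same, hderiv]
      exact div_ne_zero (mul_ne_zero (mul_ne_zero two_ne_zero hpi) hw0) hk0
    · rw [hslope z hz]
      refine div_ne_zero (fun h => ?_) (sub_ne_zero.2 hz)
      obtain ⟨m, rfl⟩ := (mordellDen_eq_zero_iff hk hw c z).1 h
      rw [poleHeight_im] at h1 h2
      refine hp m (fun hm => hz (by rw [hm])) ⟨le_of_mul_le_mul_right h1 hρ,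
        le_of_mul_le_mul_right h2 hρ⟩
  have hdd : Differentiable ℂ (dslope (mordellDen k w c) p) := by
    have := (Complex.differentiableOn_dslope (f := mordellDen k w c) (s := Set.univ) (c := p)
      univ_mem).2 (differentiable_mordellDen k w c).differentiableOn
    exact differentiableOn_univ.1 this
  have h := integral_line_sub_integral_line (p := p)
    (f := fun z => gaussChar k w μ z / mordellDen k w c z)
    (g := fun z => gaussChar k w μ z / dslope (mordellDen k w c) p z)
    (a := s * (1 / w).re) (b := t * (1 / w).re)
    (by rw [hpim]; gcongr) (by rw [hpim]; gcongr)
    (fun z h1 h2 => (differentiable_gaussChar k w μ z).div (hdd z) (hslope0 z h1 h2))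
    (fun z h1 h2 hz => by
      rw [hslope z hz]
      have := sub_ne_zero.2 hz
      field_simp)
    (stripDecay_mordell hk hw c μ _ _)
  refine h.trans ?_
  rw [dslope_same, hderiv, mordellRes, gaussChar]
  have hexp : -(2 * Real.pi * w * p ^ 2 / k) + Real.pi * I * μ * p / k =
      (2 * Real.pi * (poleHeight k c n : ℂ) ^ 2 - Real.pi * μ * (poleHeight k c n : ℂ)) /
        (k * w) := by
    rw [hpdef]
    field_simp
    linear_combination (-2 * (poleHeight k c n : ℂ) ^ 2 + μ * (poleHeight k c n : ℂ)) * I_sq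
  rw [hexp]
  field_simp

end

/-- `1` if `T` lies between `0` and `s > 0`, `-1` if it lies between `s < 0` and `0`, and `0`
otherwise: the number of times the line through `T` is crossed on the way from `0` to `s`. -/
noncomputable def crossing (T s : ℝ) : ℝ :=
  if 0 < T ∧ T < s then 1 else if s < T ∧ T < 0 then -1 else 0

section

variable {k : ℕ} {w : ℂ}

/-- The index of the last pole not above the height `s`. -/
noncomputable def lastPole (k : ℕ) (c s : ℝ) : ℤ := ⌊s / k - c - 1 / 2⌋

lemma poleHeight_le_iff (hk : 0 < k) (c s : ℝ) (n : ℤ) :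
    poleHeight k c n ≤ s ↔ n ≤ lastPole k c s := by
  have hk' : (0 : ℝ) < k := by exact_mod_cast hk
  rw [lastPole, Int.le_floor, poleHeight, mul_comm, ← le_div_iff₀ hk']
  constructor <;> intro h <;> linarith

lemma lineIntegral_eq_lastPole (hk : 0 < k) (hw : 0 < w.re) (c : ℝ) (μ : ℤ) {s : ℝ}
    (hs : ∀ n, poleHeight k c n ≠ s) : lineIntegral k w c μ s =
      lineIntegral k w c μ (poleHeight k c (lastPole k c s) + k / 2) := by
  have hsucc : poleHeight k c (lastPole k c s + 1) = poleHeight k c (lastPole k c s) + k := by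
    rw [poleHeight, poleHeight]
    push_cast
    ring
  have h1 : poleHeight k c (lastPole k c s) < s :=
    lt_of_le_of_ne ((poleHeight_le_iff hk c s _).2 le_rfl) (hs _)
  have h2 : s < poleHeight k c (lastPole k c s) + k := by
    rw [← hsucc, ← not_le, poleHeight_le_iff hk]
    omega
  -- both heights lie strictly between two consecutive poles
  have key : ∀ a b : ℝ, poleHeight k c (lastPole k c s) < a →
      b < poleHeight k c (lastPole k c s) + k →
      ∀ n, ¬(a ≤ poleHeight k c n ∧ poleHeight k c n ≤ b) := by
    rintro a b ha hb n ⟨h3, h4⟩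
    have h5 := (poleHeight_lt_iff hk c _ _).1 (ha.trans_le h3)
    rw [← hsucc] at hb
    have h6 := (poleHeight_lt_iff hk c _ _).1 (h4.trans_lt hb)
    omega
  rcases le_total s (poleHeight k c (lastPole k c s) + k / 2) with h | h
  · exact lineIntegral_eq_of_no_pole hk hw c μ h (key _ _ h1 (by linarith))
  · exact (lineIntegral_eq_of_no_pole hk hw c μ h (key _ _ (by linarith) h2)).symm

lemma lineIntegral_sub_grid (hk : 0 < k) (hw : 0 < w.re) (c : ℝ) (μ : ℤ) (m : ℤ) (j : ℕ) :
    lineIntegral k w c μ (poleHeight k c m + k / 2) -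
      lineIntegral k w c μ (poleHeight k c (m + j) + k / 2) =
      ∑ n ∈ Finset.Ioc m (m + j), mordellRes k w μ (poleHeight k c n) := by
  have hk' : (0 : ℝ) < k := by exact_mod_cast hk
  induction j with
  | zero => simp
  | succ j ih =>
    have hstep : poleHeight k c (m + j + 1) = poleHeight k c (m + j) + k := by
      rw [poleHeight, poleHeight]
      push_cast
      ring
    have hstep' : poleHeight k c (m + j + 1 + 1) = poleHeight k c (m + j) + k + k := by
      rw [poleHeight, poleHeight]
      push_cast
      ring
    have h := lineIntegral_sub_of_one_pole hk hw c μ (s := poleHeight k c (m + j) + k / 2)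
      (t := poleHeight k c (m + j + 1) + k / 2) (m + j + 1) (by linarith) (by linarith) (by
        rintro i hi ⟨h1, h2⟩
        have h3 := (poleHeight_lt_iff hk c (m + j) i).1 (by linarith)
        have h4 := (poleHeight_lt_iff hk c i (m + j + 1 + 1)).1 (by linarith)
        omega)
    have hI : Finset.Ioc m (m + (j + 1 : ℕ)) = insert (m + j + 1) (Finset.Ioc m (m + j)) := by
      ext x
      simp only [Finset.mem_Ioc, Finset.mem_insert]
      push_cast
      omega
    rw [hI, Finset.sum_insert (by simp), ← ih, ← h]
    push_cast
    ring_nf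

lemma lineIntegral_sub (hk : 0 < k) (hw : 0 < w.re) (c : ℝ) (μ : ℤ) {s t : ℝ} (hst : s ≤ t)
    (hs : ∀ n, poleHeight k c n ≠ s) (ht : ∀ n, poleHeight k c n ≠ t) :
    lineIntegral k w c μ s - lineIntegral k w c μ t =
      ∑ n ∈ Finset.Ioc (lastPole k c s) (lastPole k c t),
        mordellRes k w μ (poleHeight k c n) := by
  have hle : lastPole k c s ≤ lastPole k c t := by
    unfold lastPole
    gcongr
  obtain ⟨j, hj⟩ := Int.le.dest hle
  rw [lineIntegral_eq_lastPole hk hw c μ hs, lineIntegral_eq_lastPole hk hw c μ ht, ← hj,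
    lineIntegral_sub_grid hk hw]

/-- Moving the line of integration from `ℝ` to the height `s` picks up the residues of the poles
that are crossed, with a sign. -/
theorem hasSum_crossing_mul_res (hk : 0 < k) (hw : 0 < w.re) (c : ℝ) (μ : ℤ) {s : ℝ}
    (h0 : ∀ n, poleHeight k c n ≠ 0) (hs : ∀ n, poleHeight k c n ≠ s) :
    HasSum (fun n : ℤ => (crossing (poleHeight k c n) s : ℂ) *
        mordellRes k w μ (poleHeight k c n))
      (lineIntegral k w c μ 0 - lineIntegral k w c μ s) := by
  rcases le_total 0 s with h | h
  · rw [lineIntegral_sub hk hw c μ h h0 hs]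
    have hc : ∀ n, crossing (poleHeight k c n) s =
        if n ∈ Finset.Ioc (lastPole k c 0) (lastPole k c s) then 1 else 0 := by
      intro n
      have hmem : n ∈ Finset.Ioc (lastPole k c 0) (lastPole k c s) ↔
          0 < poleHeight k c n ∧ poleHeight k c n < s := by
        rw [Finset.mem_Ioc, ← poleHeight_le_iff hk, ← not_le, ← poleHeight_le_iff hk, not_le,
          (hs n).le_iff_lt]
      rw [crossing, if_neg (fun h' : s < _ ∧ _ => absurd (h'.1.trans h'.2) (not_lt.2 h))]
      exact if_congr hmem.symm rfl rfl
    have := hasSum_sum_of_ne_finset_zero (s := Finset.Ioc (lastPole k c 0) (lastPole k c s))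
      (f := fun n : ℤ => (crossing (poleHeight k c n) s : ℂ) *
        mordellRes k w μ (poleHeight k c n)) (L := SummationFilter.unconditional ℤ) (fun n hn => by
          rw [hc, if_neg hn, ofReal_zero, zero_mul])
    convert this using 1
    exact Finset.sum_congr rfl fun n hn => by rw [hc, if_pos hn, ofReal_one, one_mul]
  · rw [← neg_sub, lineIntegral_sub hk hw c μ h hs h0]
    have hc : ∀ n, crossing (poleHeight k c n) s =
        if n ∈ Finset.Ioc (lastPole k c s) (lastPole k c 0) then -1 else 0 := by
      intro n
      have hmem : n ∈ Finset.Ioc (lastPole k c s) (lastPole k c 0) ↔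
          s < poleHeight k c n ∧ poleHeight k c n < 0 := by
        rw [Finset.mem_Ioc, ← poleHeight_le_iff hk, ← not_le, ← poleHeight_le_iff hk, not_le,
          (h0 n).le_iff_lt]
      rw [crossing, if_neg (fun h' : 0 < _ ∧ _ => absurd (h'.1.trans h'.2) (not_lt.2 h))]
      exact if_congr hmem.symm rfl rfl
    have := hasSum_sum_of_ne_finset_zero (s := Finset.Ioc (lastPole k c s) (lastPole k c 0))
      (f := fun n : ℤ => (crossing (poleHeight k c n) s : ℂ) *
        mordellRes k w μ (poleHeight k c n)) (L := SummationFilter.unconditional ℤ) (fun n hn => by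
          rw [hc, if_neg hn, ofReal_zero, zero_mul])
    convert this using 1
    rw [← Finset.sum_neg_distrib]
    exact Finset.sum_congr rfl fun n hn => by
      rw [hc, if_pos hn, ofReal_neg, ofReal_one, neg_one_mul]

/-- At the saddle height `μ / 4` the character is absorbed into a Gaussian factor and a change of
the phase. -/
lemma lineIntegral_saddle (hk : 0 < k) (hw : 0 < w.re) (c : ℝ) (μ : ℤ) :
    lineIntegral k w c μ (μ / 4) =
      exp (-(Real.pi * μ ^ 2 / (8 * k * w))) * mordellJ k w (c - μ / (4 * k)) := by
  have hw0 := ne_zero_of_re_pos hw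
  have hk0 : (k : ℂ) ≠ 0 := by exact_mod_cast hk.ne'
  rw [lineIntegral, mordellJ, ← integral_const_mul,
    ← integral_sub_right_eq_self _ ((μ / 4 : ℝ) * (1 / w).im)]
  refine integral_congr_ae (Eventually.of_forall fun x => ?_)
  have hx : ((x - (μ / 4 : ℝ) * (1 / w).im : ℝ) : ℂ) + (((μ / 4 : ℝ) * (1 / w).re : ℝ) : ℂ) * I =
      x + I * μ / (4 * w) := by
    have h1 : (1 / w : ℂ) = ((1 / w).re : ℂ) + ((1 / w).im : ℂ) * I := (re_add_im _).symm
    have h2 : I * (μ : ℂ) / (4 * w) = I * (μ / 4) * (1 / w) := by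
      field_simp
    rw [h2]
    push_cast
    linear_combination (-(I * μ / 4 : ℂ)) * h1 - ((μ / 4 : ℂ) * ((1 / w).im : ℂ)) * I_sq
  dsimp only
  rw [hx, gaussChar, mul_div_assoc', ← exp_add, mordellDen, mordellDen]
  congr 2
  · field_simp
    linear_combination (16 * μ ^ 2 : ℂ) * I_sq
  · congr 1
    push_cast
    field_simp
    ring

end

/-! ### Convergence of the series -/

/-- For `n → ∞` the power `qⁿ` is small and for `n → -∞` it is large, so `1 + ζ qⁿ`
stays away from `0`. -/
lemma eventually_norm_inv_one_add_le {q ζ : ℂ} (hq0 : q ≠ 0) (hq : ‖q‖ < 1) (hζ : ζ ≠ 0) :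
    ∀ᶠ n : ℤ in cofinite, ‖(1 + ζ * q ^ n)⁻¹‖ ≤ 2 := by
  have hpos := norm_pos_iff.2 hq0
  have hnorm : ∀ n : ℤ, ‖ζ * q ^ n‖ = ‖ζ‖ * ‖q‖ ^ n := fun n => by rw [norm_mul, norm_zpow]
  have hfin : ∀ n : ℤ, 1 / 2 ≤ ‖1 + ζ * q ^ n‖ → ‖(1 + ζ * q ^ n)⁻¹‖ ≤ 2 := by
    intro n hn
    rw [norm_inv, show (2 : ℝ) = (1 / 2)⁻¹ by norm_num]
    exact inv_anti₀ (by norm_num) hn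
  rw [Int.cofinite_eq, eventually_sup]
  constructor
  · have h1 : Tendsto (fun n : ℤ => ‖ζ‖ * ‖q‖ ^ n) atBot atTop := by
      have h2 : Tendsto (fun n : ℕ => ‖ζ‖ * (‖q‖⁻¹) ^ n) atTop atTop :=
        (tendsto_pow_atTop_atTop_of_one_lt ((one_lt_inv₀ hpos).2 hq)).const_mul_atTop
          (norm_pos_iff.2 hζ)
      have h3 : Tendsto (fun n : ℤ => (-n).toNat) atBot atTop :=
        tendsto_atTop.2 fun b => (eventually_le_atBot (-b : ℤ)).mono fun n hn => by omega
      refine (h2.comp h3).congr' ?_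
      filter_upwards [eventually_le_atBot 0] with n hn
      rw [Function.comp_apply, inv_pow, ← zpow_natCast, Int.toNat_of_nonneg (by omega), zpow_neg,
        inv_inv]
    filter_upwards [h1.eventually_ge_atTop 2] with n hn
    apply hfin
    have := norm_sub_le_norm_add (ζ * q ^ n) 1
    rw [hnorm, norm_one, add_comm] at this
    linarith
  · have h1 : Tendsto (fun n : ℤ => ‖ζ‖ * ‖q‖ ^ n) atTop (𝓝 0) := by
      have h2 : Tendsto (fun n : ℕ => ‖ζ‖ * ‖q‖ ^ n) atTop (𝓝 (‖ζ‖ * 0)) :=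
        (tendsto_pow_atTop_nhds_zero_of_lt_one hpos.le hq).const_mul _
      rw [mul_zero] at h2
      have h3 : Tendsto (fun n : ℤ => n.toNat) atTop atTop :=
        tendsto_atTop.2 fun b => (eventually_ge_atTop (b : ℤ)).mono fun n hn => by omega
      refine (h2.comp h3).congr' ?_
      filter_upwards [eventually_ge_atTop 0] with n hn
      rw [Function.comp_apply, ← zpow_natCast, Int.toNat_of_nonneg hn]
    filter_upwards [h1.eventually_le_const (show (0 : ℝ) < 1 / 2 by norm_num)] with n hn
    apply hfin
    have := norm_sub_le_norm_add 1 (ζ * q ^ n)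
    rw [hnorm, norm_one] at this
    linarith

lemma summable_mul_inv_one_add {q ζ : ℂ} (hq0 : q ≠ 0) (hq : ‖q‖ < 1) (hζ : ζ ≠ 0) {f : ℤ → ℂ}
    (hf : Summable f) : Summable fun n : ℤ => f n / (1 + ζ * q ^ n) := by
  refine Summable.of_norm_bounded_eventually (hf.norm.mul_right 2) ?_
  filter_upwards [eventually_norm_inv_one_add_le hq0 hq hζ] with n hn
  rw [div_eq_mul_inv, norm_mul]
  gcongr

lemma summable_oTerm {r q : ℂ} (hq0 : q ≠ 0) (hq : ‖q‖ < 1) : Summable (oTerm r q) := by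
  have h1 := summable_zpow_sq_mul_zpow hq0 hq (neg_ne_zero.2 one_ne_zero : (-1 : ℂ) ≠ 0)
  refine ((summable_mul_inv_one_add hq0 hq (exp_ne_zero (2 * Real.pi * I * r)) h1).mul_left
    (-1)).congr fun n => ?_
  rw [oTerm, zpow_add₀ (neg_ne_zero.2 one_ne_zero), zpow_one]
  ring

lemma summable_uTerm {r z : ℂ} (hz : 0 < z.im) : Summable (uTerm r z) := by
  have hq : ‖exp (2 * Real.pi * I * z)‖ < 1 := UpperHalfPlane.norm_exp_two_pi_I_lt_one ⟨z, hz⟩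
  set p := exp (Real.pi * I * z) with hp
  have hqp : exp (2 * Real.pi * I * z) = p ^ 2 := by
    rw [hp, ← exp_nat_mul]
    congr 1
    push_cast
    ring
  have hp1 : ‖p‖ < 1 := by
    rw [hqp, norm_pow] at hq
    exact (sq_lt_one_iff₀ (norm_nonneg p)).1 hq
  have h1 := summable_zpow_sq_mul_zpow (exp_ne_zero _ : p ≠ 0) hp1 (exp_ne_zero _ : p ≠ 0)
  refine (summable_mul_inv_one_add (exp_ne_zero _) hq (neg_ne_zero.2 (exp_ne_zero
    (2 * Real.pi * I * r))) h1).congr fun m => ?_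
  have heven : 2 ∣ m ^ 2 + m := by
    rw [show m ^ 2 + m = m * (m + 1) by ring]
    exact (Int.even_mul_succ_self m).two_dvd
  have e : p ^ (m ^ 2) * p ^ m = exp (2 * Real.pi * I * z) ^ ((m ^ 2 + m) / 2) := by
    rw [hqp, ← zpow_add₀ (exp_ne_zero _), ← zpow_natCast, ← zpow_mul]
    congr 1
    rw [Nat.cast_ofNat, Int.mul_ediv_cancel' heven]
  rw [uTerm, e, neg_mul, ← sub_eq_add_neg]

lemma summable_exp_neg_abs {a : ℝ} (ha : 0 < a) (x : ℝ) :
    Summable fun n : ℤ => Real.exp (-(a * |(n : ℝ) + x|)) := by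
  have hnat : Summable fun n : ℕ => Real.exp (-(a * n)) := by
    have := Real.summable_exp_nat_mul_iff.2 (neg_lt_zero.2 ha)
    refine this.congr fun n => ?_
    congr 1
    ring
  have h0 : Summable fun n : ℤ => Real.exp (-(a * |(n : ℝ)|)) := by
    refine Summable.of_nat_of_neg (hnat.congr fun n => ?_) (hnat.congr fun n => ?_)
    · rw [Int.cast_natCast, Nat.abs_cast]
    · rw [Int.cast_neg, abs_neg, Int.cast_natCast, Nat.abs_cast]
  refine Summable.of_nonneg_of_le (fun n => (Real.exp_pos _).le) (fun n => ?_)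
    (h0.mul_left (Real.exp (a * |x|)))
  rw [← Real.exp_add]
  gcongr
  have h1 : |(n : ℝ)| ≤ |(n : ℝ) + x| + |x| := by
    have := abs_sub (n + x : ℝ) x
    rwa [add_sub_cancel_right] at this
  nlinarith

/-! ### Rearranging sums over residue classes -/

/-- Every integer is `k l + a N` for exactly one `0 ≤ N < k` and one `l`, when `a` is a unit
modulo `k`. -/
lemma bijective_mul_add {k : ℕ} (hk : 0 < k) {a b : ℤ} (hab : a * b ≡ 1 [ZMOD k]) :
    Function.Bijective fun x : Fin k × ℤ => (k : ℤ) * x.2 + a * (x.1 : ℕ) := by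
  have hk' : (0 : ℤ) < k := by exact_mod_cast hk
  constructor
  · rintro ⟨N, l⟩ ⟨N', l'⟩ h
    dsimp only at h
    have h1 : (N : ℤ) ≡ (N' : ℤ) [ZMOD k] := by
      have h2 : a * (N : ℕ) ≡ a * (N' : ℕ) [ZMOD k] :=
        (Int.modEq_iff_dvd).2 ⟨l - l', by linear_combination -h⟩
      have h3 := h2.mul_left b
      have h4 : ∀ x : ℤ, b * (a * x) ≡ x [ZMOD k] := fun x => by
        have := hab.mul_right x
        rwa [one_mul, mul_comm a b, mul_assoc] at this
      exact ((h4 _).symm.trans h3).trans (h4 _)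
    have h5 : (N : ℕ) = N' :=
      Nat.ModEq.eq_of_lt_of_lt ((Int.natCast_modEq_iff).1 h1) N.2 N'.2
    have h6 : N = N' := Fin.ext h5
    subst h6
    have h7 : l = l' := by
      apply mul_left_cancel₀ hk'.ne'
      linarith
    rw [h7]
  · intro n
    have hmod : 0 ≤ (b * n) % k := Int.emod_nonneg _ hk'.ne'
    have hlt : (b * n) % k < k := Int.emod_lt_of_pos _ hk'
    have h1 : a * ((b * n) % k) ≡ n [ZMOD k] := by
      have h2 : a * ((b * n) % k) ≡ a * (b * n) [ZMOD k] := (Int.mod_modEq _ _).mul_left a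
      have h3 := hab.mul_right n
      rw [one_mul, mul_assoc] at h3
      exact h2.trans h3
    obtain ⟨l, hl⟩ := (Int.modEq_iff_dvd).1 h1
    refine ⟨(⟨((b * n) % k).toNat, by omega⟩, l), ?_⟩
    dsimp only
    rw [Int.toNat_of_nonneg hmod, ← hl]
    ring

lemma tsum_eq_sum_tsum_mul_add {k : ℕ} (hk : 0 < k) {a b : ℤ} (hab : a * b ≡ 1 [ZMOD k])
    {g : ℤ → ℂ} (hg : Summable g) :
    ∑' n, g n = ∑ N ∈ Finset.range k, ∑' l : ℤ, g (k * l + a * N) := by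
  set e := Equiv.ofBijective _ (bijective_mul_add hk hab)
  have h1 : Summable fun x => g (e x) := e.summable_iff.2 hg
  rw [← e.tsum_eq g, h1.tsum_prod, tsum_fintype, ← Fin.sum_univ_eq_sum_range
    (fun N => ∑' l : ℤ, g (k * l + a * N))]
  rfl

/-! ### Poisson summation and the expansion of the Appell sum -/

/-- The frequencies `μ ≡ k (mod 2)` dual to the lattice `k ℤ` twisted by the sign `(-1)^{k l}`. -/
def freq (k : ℕ) (j : ℤ) : ℤ := k + 2 * j

/-- The root of unity attached to the residue class `N` and the frequency `μ`. -/
noncomputable def classPhase (k : ℕ) (h' N μ : ℤ) : ℂ :=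
  exp (Real.pi * I * h' * (N + (μ * N - 2 * N ^ 2) / k))

/-- The heights `n + k/2 + k r`, `n ∈ ℤ`, of all the poles, in units of `i / w`. -/
noncomputable def poleT (k : ℕ) (r : ℝ) (n : ℤ) : ℝ := n + k / 2 + k * r

/-- The contribution of the pole `n` to the Poisson dual sum at the frequency with index `j`. -/
noncomputable def resTerm (k : ℕ) (w : ℂ) (h' : ℤ) (r : ℝ) (n j : ℤ) : ℂ :=
  classPhase k h' n (freq k j) * (crossing (poleT k r n) (freq k j / 4) *
    mordellRes k w (freq k j) (poleT k r n))

section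

variable {k : ℕ} {w : ℂ}

lemma poleHeight_eq_poleT (hk : 0 < k) (r : ℝ) (N i : ℤ) :
    poleHeight k (N / k + r) i = poleT k r (k * i + N) := by
  rw [poleHeight, poleT]
  push_cast
  field_simp
  ring

lemma norm_classPhase (k : ℕ) (h' N μ : ℤ) : ‖classPhase k h' N μ‖ = 1 := by
  have : (Real.pi * I * h' * (N + (μ * N - 2 * N ^ 2) / k) : ℂ) =
      ((Real.pi * h' * (N + (μ * N - 2 * N ^ 2) / k) : ℝ) : ℂ) * I := by
    push_cast
    ring
  rw [classPhase, this, norm_exp_ofReal_mul_I]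

lemma classPhase_add_mul (hk : 0 < k) (h' N i j : ℤ) :
    classPhase k h' (k * i + N) (freq k j) = classPhase k h' N (freq k j) := by
  have hk0 : (k : ℂ) ≠ 0 := by exact_mod_cast hk.ne'
  rw [classPhase, classPhase, exp_eq_exp_iff_exists_int]
  refine ⟨h' * (k * i + j * i - 2 * i * N - k * i ^ 2), ?_⟩
  rw [freq]
  push_cast
  field_simp
  ring

lemma exists_le_abs_poleT (k : ℕ) (r : ℝ) (hT : ∀ n, poleT k r n ≠ 0) :
    ∃ t : ℝ, 0 < t ∧ ∀ n, t ≤ |poleT k r n| := by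
  set x : ℝ := k / 2 + k * r with hx
  refine ⟨|x - round x|, abs_pos.2 fun h => hT (-round x) ?_, fun n => ?_⟩
  · rw [poleT]
    push_cast
    linarith
  · have := round_le x (-n)
    refine this.trans (le_of_eq ?_)
    rw [poleT]
    congr 1
    push_cast
    ring

lemma norm_mordellRes (k : ℕ) (w : ℂ) (μ : ℤ) (T : ℝ) : ‖mordellRes k w μ T‖ =
    k / ‖w‖ * Real.exp (Real.pi * (1 / w).re / k * (T * (2 * T - μ))) := by
  have : ((2 * Real.pi * T ^ 2 - Real.pi * μ * T) / (k * w) : ℂ) =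
      ((Real.pi / k * (T * (2 * T - μ)) : ℝ) : ℂ) * (1 / w) := by
    push_cast
    rw [div_mul_eq_div_div]
    ring
  rw [mordellRes, norm_mul, norm_div, norm_mul, norm_I, one_mul, norm_natCast, norm_exp, this,
    re_ofReal_mul]
  congr 2
  ring

/-- Before the saddle, the residues decay exponentially both in the pole and in the frequency. -/
lemma norm_crossing_mul_res_le (hk : 0 < k) (hw : 0 < w.re) {t T : ℝ} (ht : 0 < t) (hT : t ≤ |T|)
    (μ : ℤ) : ‖(crossing T (μ / 4) : ℂ) * mordellRes k w μ T‖ ≤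
      k / ‖w‖ * (Real.exp (-(Real.pi * (1 / w).re / k * t * |T|)) *
        Real.exp (-(Real.pi * (1 / w).re / k * t / 4 * |(μ : ℝ)|))) := by
  have hρ := re_inv_pos hw
  set a : ℝ := Real.pi * (1 / w).re / k with ha
  have ha0 : 0 < a := by positivity
  have key : |crossing T (μ / 4)| ≠ 0 → |crossing T (μ / 4)| = 1 ∧
      T * (2 * T - μ) ≤ -(t * |T| + t / 4 * |(μ : ℝ)|) := by
    unfold crossing
    split_ifs with h1 h2
    · intro _
      have hμ : 0 < (μ : ℝ) := by linarith [h1.1, h1.2]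
      rw [abs_of_pos h1.1] at hT ⊢
      rw [abs_of_pos hμ]
      refine ⟨abs_one, ?_⟩
      nlinarith [h1.1, h1.2, mul_nonneg (sub_nonneg.2 hT) hμ.le]
    · intro _
      have hμ : (μ : ℝ) < 0 := by linarith [h2.1, h2.2]
      rw [abs_of_neg h2.2] at hT ⊢
      rw [abs_of_neg hμ]
      refine ⟨by rw [abs_neg, abs_one], ?_⟩
      nlinarith [h2.1, h2.2, mul_nonneg (sub_nonneg.2 hT) (neg_nonneg.2 hμ.le)]
    · intro h
      exact absurd abs_zero h
  rw [norm_mul, norm_real, Real.norm_eq_abs, norm_mordellRes]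
  by_cases h0 : |crossing T (μ / 4)| = 0
  · rw [h0, zero_mul]
    positivity
  · obtain ⟨h1, h2⟩ := key h0
    rw [h1, one_mul, ← Real.exp_add]
    gcongr
    rw [← ha]
    nlinarith

lemma abs_freq (k : ℕ) (j : ℤ) : |(freq k j : ℝ)| = 2 * |(j : ℝ) + k / 2| := by
  rw [← abs_two (α := ℝ), ← abs_mul, freq, abs_two]
  congr 1
  push_cast
  ring

lemma summable_resTerm (hk : 0 < k) (hw : 0 < w.re) (h' : ℤ) {r : ℝ}
    (hT : ∀ n, poleT k r n ≠ 0) :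
    Summable fun p : ℤ × ℤ => resTerm k w h' r p.1 p.2 := by
  have hρ := re_inv_pos hw
  obtain ⟨t, ht, hle⟩ := exists_le_abs_poleT k r hT
  set a : ℝ := Real.pi * (1 / w).re / k with ha
  have s1 := summable_exp_neg_abs (show 0 < a * t by positivity) (k / 2 + k * r)
  have s2 := summable_exp_neg_abs (show 0 < a * t / 4 * 2 by positivity) (k / 2)
  have s3 := (s1.mul_of_nonneg s2 (fun n => (Real.exp_pos _).le)
    (fun n => (Real.exp_pos _).le)).mul_left (k / ‖w‖)
  refine Summable.of_norm_bounded s3 fun p => ?_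
  rw [resTerm, norm_mul, norm_classPhase, one_mul]
  refine (norm_crossing_mul_res_le hk hw ht (hle p.1) (freq k p.2)).trans (le_of_eq ?_)
  rw [abs_freq, poleT, ← ha]
  congr 4
  · ring_nf
  · ring

lemma mordellDen_add_int (k : ℕ) (w : ℂ) (c : ℝ) (n : ℤ) (x : ℂ) :
    mordellDen k w (c + n) x = mordellDen k w c x := by
  rw [mordellDen, mordellDen]
  congr 1
  rw [exp_eq_exp_iff_exists_int]
  exact ⟨n, by push_cast; ring⟩

lemma mordellJ_add_int (k : ℕ) (w : ℂ) (c : ℝ) (n : ℤ) :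
    mordellJ k w (c + n) = mordellJ k w c := by
  simp only [mordellJ, mordellDen_add_int]

lemma exists_norm_mordellJ_le (hk : 0 < k) (w : ℂ) (c : ℝ) :
    ∃ B : ℝ, ∀ j : ℤ, ‖mordellJ k w (c - freq k j / (4 * k))‖ ≤ B := by
  refine ⟨∑ i ∈ Finset.range (2 * k), ‖mordellJ k w (c - freq k i / (4 * k))‖, fun j => ?_⟩
  have h0 : 0 ≤ j % (2 * k : ℤ) := Int.emod_nonneg _ (by omega)
  have h1 : j % (2 * k : ℤ) < 2 * k := Int.emod_lt_of_pos _ (by omega)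
  have h2 : c - (freq k j : ℝ) / (4 * k) =
      c - (freq k ((j % (2 * k : ℤ)).toNat : ℤ) : ℝ) / (4 * k) +
        ((-(j / (2 * k : ℤ)) : ℤ) : ℝ) := by
    have h3 : (j : ℝ) = ((j % (2 * k : ℤ) : ℤ) : ℝ) + 2 * k * ((j / (2 * k : ℤ) : ℤ) : ℝ) := by
      exact_mod_cast (Int.emod_add_mul_ediv j (2 * k)).symm
    rw [Int.toNat_of_nonneg h0, freq, freq]
    push_cast
    rw [h3]
    field_simp
    ring
  rw [h2, mordellJ_add_int]
  exact Finset.single_le_sum (f := fun i : ℕ => ‖mordellJ k w (c - freq k i / (4 * k))‖)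
    (fun i _ => norm_nonneg _) (Finset.mem_range.2 (by omega))

lemma summable_gauss_mul_mordellJ (hk : 0 < k) (hw : 0 < w.re) (c : ℝ) :
    Summable fun j : ℤ => ‖exp (-(Real.pi * (freq k j : ℂ) ^ 2 / (8 * k * w))) *
      mordellJ k w (c - freq k j / (4 * k))‖ := by
  have hρ := re_inv_pos hw
  obtain ⟨B, hB⟩ := exists_norm_mordellJ_le hk w c
  set a : ℝ := Real.pi * (1 / w).re / (2 * k) with ha
  have ha0 : 0 < a := by positivity
  refine Summable.of_nonneg_of_le (fun j => norm_nonneg _) (fun j => ?_)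
    (((summable_exp_neg_sq ha0 (-(a * k))).mul_left (Real.exp (-(a * k ^ 2 / 4)))).mul_right B)
  have e : (-(Real.pi * (freq k j : ℂ) ^ 2 / (8 * k * w))) =
      ((-(Real.pi * (freq k j : ℝ) ^ 2 / (8 * k)) : ℝ) : ℂ) * (1 / w) := by
    push_cast
    rw [div_mul_eq_div_div]
    ring
  rw [norm_mul, norm_exp, e, re_ofReal_mul, ← Real.exp_add]
  have e2 : -(Real.pi * (freq k j : ℝ) ^ 2 / (8 * k)) * (1 / w).re =
      -(a * k ^ 2 / 4) + (-a * (j : ℝ) ^ 2 + -(a * k) * j) := by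
    rw [ha, freq]
    push_cast
    field_simp
    ring
  rw [e2]
  gcongr
  exact hB j

/-- Poisson summation for the values of the Mordell integrand on the residue class of `y`. -/
lemma poisson_class (hk : 0 < k) (hw : 0 < w.re) {c : ℝ} (y : ℤ)
    (h0 : ∀ n, poleHeight k c n ≠ 0)
    (hsum : Summable fun j : ℤ => exp (-(Real.pi * I * freq k j * y / k)) *
      lineIntegral k w c (freq k j) 0) :
    ∑' l : ℤ, exp (Real.pi * I * k * l) *
        (gaussChar k w 0 (k * l + y) / mordellDen k w c (k * l + y)) =
      1 / k * ∑' j : ℤ, exp (-(Real.pi * I * freq k j * y / k)) *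
        lineIntegral k w c (freq k j) 0 := by
  have hk' : (0 : ℝ) < k := by exact_mod_cast hk
  have hk0 : (k : ℂ) ≠ 0 := by exact_mod_cast hk.ne'
  have hden : ∀ x : ℝ, mordellDen k w c x ≠ 0 := fun x =>
    mordellDen_ne_zero_of_im hk hw (s := 0) (by simp) h0
  set φ : ℝ → ℂ := fun t => exp (Real.pi * I * k * t) *
    (gaussChar k w 0 (k * t + y) / mordellDen k w c (k * t + y)) with hφ
  have hcast : ∀ t : ℝ, (k : ℂ) * t + y = ((k * t + y : ℝ) : ℂ) := fun t => by push_cast; ring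
  have hcont : Continuous φ := by
    refine Continuous.mul (by fun_prop) (Continuous.div ?_ ?_ fun t => ?_)
    · exact (differentiable_gaussChar k w 0).continuous.comp (by fun_prop)
    · exact (differentiable_mordellDen k w c).continuous.comp (by fun_prop)
    · rw [hcast]
      exact hden _
  have hdecay : φ =O[cocompact ℝ] fun x : ℝ => |x| ^ (-(2 : ℝ)) := by
    obtain ⟨C, R, hC⟩ := stripDecay_mordell hk hw c 0 0 0
    refine Asymptotics.IsBigO.of_bound (|C| * 4) ?_
    filter_upwards [tendsto_norm_cocompact_atTop.eventually_ge_atTop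
      (2 * |(y : ℝ)| + 2 * |R| + 1)] with t ht
    rw [Real.norm_eq_abs] at ht
    have h1 : |t| / 2 ≤ |k * t + y| := by
      have h2 := abs_sub_abs_le_abs_sub (k * t : ℝ) (-y)
      rw [sub_neg_eq_add, abs_neg, abs_mul, Nat.abs_cast] at h2
      have h3 : (1 : ℝ) ≤ k := by exact_mod_cast hk
      have h4 : |t| ≤ k * |t| := le_mul_of_one_le_left (abs_nonneg _) h3
      linarith [abs_nonneg R]
    have h5 := hC ((k * t + y : ℝ) : ℂ) (by simp) (by simp) (by
      rw [ofReal_re]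
      linarith [le_abs_self R, abs_nonneg (y : ℝ)])
    rw [ofReal_re] at h5
    have h6 : ‖exp (Real.pi * I * k * t)‖ = 1 := by
      rw [show (Real.pi * I * k * t : ℂ) = ((Real.pi * k * t : ℝ) : ℂ) * I by push_cast; ring,
        norm_exp_ofReal_mul_I]
    rw [hφ]
    dsimp only
    rw [norm_mul, h6, one_mul, hcast]
    refine h5.trans ?_
    have ht0 : 0 < |t| := by linarith [abs_nonneg R, abs_nonneg (y : ℝ)]
    rw [Real.rpow_neg (abs_nonneg t), Real.rpow_two, norm_inv, norm_pow, Real.norm_eq_abs, abs_abs,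
      mul_assoc]
    have h7 : (1 + (k * t + y) ^ 2)⁻¹ ≤ 4 * (|t| ^ 2)⁻¹ := by
      rw [← div_eq_mul_inv, inv_eq_one_div, div_le_div_iff₀ (by positivity) (by positivity)]
      have : (|t| / 2) ^ 2 ≤ (k * t + y) ^ 2 := by
        rw [← sq_abs (k * t + y)]
        gcongr
      nlinarith
    have : 0 ≤ (1 + (k * t + y) ^ 2)⁻¹ := by positivity
    calc _ ≤ |C| * (1 + (k * t + y) ^ 2)⁻¹ := by gcongr; exact le_abs_self C
      _ ≤ _ := by gcongr
  have hF : ∀ j : ℤ, FourierTransform.fourier φ (j : ℝ) =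
      1 / k * (exp (-(Real.pi * I * freq k (-j) * y / k)) *
        lineIntegral k w c (freq k (-j)) 0) := by
    intro j
    set G : ℝ → ℂ := fun x => gaussChar k w (freq k (-j)) x / mordellDen k w c x with hG
    have hline : lineIntegral k w c (freq k (-j)) 0 = ∫ x : ℝ, G x := by
      rw [lineIntegral]
      simp [hG]
    have hsub : ∫ x : ℝ, G x = k * ∫ t : ℝ, G (k * t + y) := by
      rw [Measure.integral_comp_mul_left (fun t : ℝ => G (t + y)),
        integral_add_right_eq_self (fun t : ℝ => G t), abs_of_pos (inv_pos.2 hk'), real_smul]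
      push_cast
      field_simp
    rw [hline, hsub, Real.fourier_real_eq_integral_exp_smul, mul_left_comm,
      ← mul_assoc (1 / (k : ℂ)),
      one_div_mul_cancel hk0, one_mul, ← integral_const_mul]
    refine integral_congr_ae (Eventually.of_forall fun t => ?_)
    simp only [hG, hφ, smul_eq_mul, ← hcast]
    rw [← mul_assoc, ← exp_add, mul_div_assoc', mul_div_assoc', gaussChar, gaussChar, ← exp_add,
      ← exp_add]
    congr 2
    rw [freq]
    push_cast
    field_simp
    ring
  have hsum' : Summable fun j : ℤ => FourierTransform.fourier φ (j : ℝ) := by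
    simp only [hF]
    exact ((Equiv.neg ℤ).summable_iff.2 hsum).mul_left _
  have hP := Real.tsum_eq_tsum_fourier_of_rpow_decay_of_summable hcont one_lt_two hdecay hsum' 0
  simp only [zero_add, QuotientAddGroup.mk_zero, fourier_eval_zero, mul_one] at hP
  simp only [hF] at hP
  rw [← tsum_mul_left]
  refine Eq.trans ?_ (hP.trans ((Equiv.neg ℤ).tsum_eq fun j : ℤ => 1 / (k : ℂ) *
    (exp (-(Real.pi * I * freq k j * y / k)) * lineIntegral k w c (freq k j) 0)))
  refine tsum_congr fun l => ?_
  rw [hφ]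
  push_cast
  rfl

end

section

variable {k : ℕ} {w : ℂ}

lemma norm_qparam_lt_one (hk : 0 < k) (hw : 0 < w.re) (h : ℤ) :
    ‖exp (2 * Real.pi * I / k * (h + I * w))‖ < 1 := by
  have e : (2 * Real.pi * I / k * (h + I * w) : ℂ) =
      ((2 * Real.pi / k * h : ℝ) : ℂ) * I + ((-(2 * Real.pi / k) : ℝ) : ℂ) * w := by
    push_cast
    linear_combination (2 * Real.pi / k * w : ℂ) * I_sq
  rw [norm_exp, e, add_re, re_ofReal_mul, re_ofReal_mul, I_re, mul_zero, zero_add,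
    Real.exp_lt_one_iff,
    neg_mul, neg_lt_zero]
  have := Real.pi_pos
  positivity

/-- The terms of `O_r(q)` on a residue class modulo `k`, in terms of the Mordell integrand. -/
lemma oTerm_class (hk : 0 < k) {h h' : ℤ} (hh : h * h' ≡ -1 [ZMOD (k : ℤ)]) (w : ℂ) (r : ℝ)
    (N l : ℤ) :
    oTerm r (exp (2 * Real.pi * I / k * (h + I * w))) (k * l + -h' * N) =
      -(exp (Real.pi * I * h' * (N - 2 * N ^ 2 / k)) * (exp (Real.pi * I * k * l) *
        (gaussChar k w 0 (k * l + ((-h' * N : ℤ) : ℂ)) /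
          mordellDen k w (N / k + r) (k * l + ((-h' * N : ℤ) : ℂ))))) := by
  have hk0 : (k : ℂ) ≠ 0 := by exact_mod_cast hk.ne'
  obtain ⟨H, hH⟩ := (Int.modEq_iff_dvd).1 hh.symm
  have hHc : (h : ℂ) * h' + 1 = k * H := by exact_mod_cast (by linarith : h * h' + 1 = k * H)
  set n : ℤ := k * l + -h' * N with hn
  have hnc : (k : ℂ) * l + ((-h' * N : ℤ) : ℂ) = n := by
    rw [hn]
    push_cast
    ring
  have e1 : (-1 : ℂ) ^ (n + 1) = -exp (Real.pi * I * n) := by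
    rw [zpow_add₀ (neg_ne_zero.2 one_ne_zero), zpow_one, ← exp_pi_mul_I, ← exp_int_mul]
    rw [exp_pi_mul_I, mul_neg_one, mul_comm]
  have hnum : exp (Real.pi * I * n) * exp (2 * Real.pi * I / k * (h + I * w)) ^ (n ^ 2) =
      exp (Real.pi * I * h' * (N - 2 * N ^ 2 / k)) * exp (Real.pi * I * k * l) *
        gaussChar k w 0 n := by
    rw [← exp_int_mul, gaussChar, ← exp_add, ← exp_add, ← exp_add, exp_eq_exp_iff_exists_int]
    refine ⟨h * k * l ^ 2 - 2 * h * l * h' * N + h' * H * N ^ 2 - h' * N, ?_⟩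
    rw [hn]
    push_cast
    field_simp
    linear_combination (2 * k ^ 2 * l ^ 2 * w - 4 * k * l * h' * N * w + 2 * h' ^ 2 * N ^ 2 * w) *
      I_sq + (2 * I * h' * N ^ 2) * hHc
  have hden : 1 + exp (2 * Real.pi * I * r) * exp (2 * Real.pi * I / k * (h + I * w)) ^ n =
      mordellDen k w (N / k + r) n := by
    rw [← exp_int_mul, mordellDen, ← exp_add]
    congr 1
    rw [exp_eq_exp_iff_exists_int]
    refine ⟨h * l - H * N, ?_⟩
    rw [hn]
    push_cast
    field_simp
    linear_combination (k * l * w - h' * N * w) * I_sq - (I * N) * hHc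
  rw [oTerm, hnc, e1, hden, ← mul_div_assoc, neg_mul, hnum]
  ring

lemma exp_mul_exp_eq_classPhase (k : ℕ) (h' N j : ℤ) :
    exp (Real.pi * I * h' * (N - 2 * N ^ 2 / k)) *
      exp (-(Real.pi * I * freq k j * ((-h' * N : ℤ) : ℂ) / k)) = classPhase k h' N (freq k j) := by
  rw [classPhase, ← exp_add]
  congr 1
  push_cast
  field_simp
  ring

/-- The integral of the frequency `μ` along the saddle line, up to the phase of the class `N`. -/
noncomputable def saddleTerm (k : ℕ) (w : ℂ) (h' : ℤ) (r : ℝ) (N j : ℤ) : ℂ :=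
  classPhase k h' N (freq k j) * (exp (-(Real.pi * (freq k j : ℂ) ^ 2 / (8 * k * w))) *
    mordellJ k w ((N : ℝ) / k + r - freq k j / (4 * k)))

lemma summable_saddleTerm (hk : 0 < k) (hw : 0 < w.re) (h' : ℤ) (r : ℝ) (N : ℤ) :
    Summable (saddleTerm k w h' r N) := by
  refine Summable.of_norm ((summable_gauss_mul_mordellJ hk hw (N / k + r)).congr fun j => ?_)
  rw [saddleTerm, norm_mul _ (_ * _), norm_classPhase, one_mul]

lemma classPhase_mul_lineIntegral (hk : 0 < k) (hw : 0 < w.re) (h' : ℤ) {r : ℝ}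
    (hT0 : ∀ n, poleT k r n ≠ 0) (hT1 : ∀ n j, poleT k r n ≠ freq k j / 4) (N j : ℤ) :
    classPhase k h' N (freq k j) * lineIntegral k w (N / k + r) (freq k j) 0 =
      saddleTerm k w h' r N j + ∑' i : ℤ, resTerm k w h' r (k * i + N) j := by
  have h1 := hasSum_crossing_mul_res hk hw (N / k + r) (freq k j) (s := freq k j / 4)
    (fun n => by rw [poleHeight_eq_poleT hk]; exact hT0 _)
    (fun n => by rw [poleHeight_eq_poleT hk]; exact hT1 _ _)
  have h2 := (h1.mul_left (classPhase k h' N (freq k j))).tsum_eq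
  rw [lineIntegral_saddle hk hw] at h2
  simp only [poleHeight_eq_poleT hk] at h2
  have h3 : ∀ i : ℤ, resTerm k w h' r (k * i + N) j = classPhase k h' N (freq k j) *
      (crossing (poleT k r (k * i + N)) (freq k j / 4) *
        mordellRes k w (freq k j) (poleT k r (k * i + N))) := fun i => by
    rw [resTerm, classPhase_add_mul hk]
  rw [tsum_congr h3, h2, saddleTerm]
  ring

/-- The Appell sum over the residue class `-h' N` modulo `k`. -/
lemma tsum_oTerm_class (hk : 0 < k) (hw : 0 < w.re) {h h' : ℤ}
    (hh : h * h' ≡ -1 [ZMOD (k : ℤ)]) {r : ℝ} (hT0 : ∀ n, poleT k r n ≠ 0)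
    (hT1 : ∀ n j, poleT k r n ≠ freq k j / 4) (N : ℤ) :
    ∑' l : ℤ, oTerm r (exp (2 * Real.pi * I / k * (h + I * w))) (k * l + -h' * N) =
      -(1 / k * (∑' j : ℤ, saddleTerm k w h' r N j +
        ∑' i : ℤ, ∑' j : ℤ, resTerm k w h' r (k * i + N) j)) := by
  have hk0 : (k : ℤ) ≠ 0 := by exact_mod_cast hk.ne'
  have hres : Summable fun p : ℤ × ℤ => resTerm k w h' r (k * p.2 + N) p.1 :=
    (summable_resTerm hk hw h' hT0).comp_injective
      (i := fun p : ℤ × ℤ => ((k : ℤ) * p.2 + N, p.1)) (by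
      rintro ⟨a, b⟩ ⟨c, d⟩ hab
      simp only [Prod.mk.injEq, add_left_inj] at hab
      exact Prod.ext hab.2 (mul_left_cancel₀ hk0 hab.1))
  have hres1 : Summable fun j : ℤ => ∑' i : ℤ, resTerm k w h' r (k * i + N) j := hres.prod
  have hcomm : ∑' i : ℤ, ∑' j : ℤ, resTerm k w h' r (k * i + N) j =
      ∑' j : ℤ, ∑' i : ℤ, resTerm k w h' r (k * i + N) j :=
    Summable.tsum_comm (f := fun j i : ℤ => resTerm k w h' r (k * i + N) j) hres
  have hs := (summable_saddleTerm hk hw h' r N).add hres1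
  set P : ℂ := exp (Real.pi * I * h' * (N - 2 * N ^ 2 / k)) with hP
  have hP0 : P ≠ 0 := exp_ne_zero _
  have hterm : ∀ j : ℤ, P * (exp (-(Real.pi * I * freq k j * ((-h' * N : ℤ) : ℂ) / k)) *
      lineIntegral k w ((N : ℝ) / k + r) (freq k j) 0) =
      saddleTerm k w h' r N j + ∑' i : ℤ, resTerm k w h' r (k * i + N) j := fun j => by
    rw [← classPhase_mul_lineIntegral hk hw h' hT0 hT1, ← exp_mul_exp_eq_classPhase k, hP,
      ← mul_assoc]
  have hs2 : Summable fun j : ℤ => exp (-(Real.pi * I * freq k j * ((-h' * N : ℤ) : ℂ) / k)) *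
      lineIntegral k w ((N : ℝ) / k + r) (freq k j) 0 := by
    rw [← summable_mul_left_iff hP0]
    exact hs.congr fun j => (hterm j).symm
  have hpois := poisson_class hk hw (-h' * N)
    (fun n => by rw [poleHeight_eq_poleT hk]; exact hT0 _) hs2
  rw [tsum_congr fun l => oTerm_class hk hh w r N l, tsum_neg, tsum_mul_left, hpois,
    mul_left_comm, ← hP, ← tsum_mul_left, tsum_congr hterm,
    (summable_saddleTerm hk hw h' r N).tsum_add hres1, hcomm]

/-- The Appell sum as a Gaussian sum of Mordell integrals plus a sum over residues. -/
theorem tsum_oTerm_eq (hk : 0 < k) (hw : 0 < w.re) {h h' : ℤ}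
    (hh : h * h' ≡ -1 [ZMOD (k : ℤ)]) {r : ℝ} (hT0 : ∀ n, poleT k r n ≠ 0)
    (hT1 : ∀ n j, poleT k r n ≠ freq k j / 4) :
    ∑' n : ℤ, oTerm r (exp (2 * Real.pi * I / k * (h + I * w))) n =
      -(1 / k * ∑ N ∈ Finset.range k, ∑' j : ℤ, saddleTerm k w h' r N j +
        1 / k * ∑' n : ℤ, ∑' j : ℤ, resTerm k w h' r n j) := by
  have hres := summable_resTerm hk hw h' hT0
  have hq := norm_qparam_lt_one hk hw h
  have hA : -h' * h ≡ 1 [ZMOD (k : ℤ)] := by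
    have := hh.neg
    rwa [neg_neg, ← neg_mul, neg_mul_comm, mul_comm] at this
  have hn := tsum_eq_sum_tsum_mul_add hk (a := 1) (b := 1) (by rw [mul_one]) hres.prod
  simp only [one_mul] at hn
  rw [tsum_eq_sum_tsum_mul_add hk hA (summable_oTerm (exp_ne_zero _) hq),
    Finset.sum_congr rfl fun (N : ℕ) _ => tsum_oTerm_class hk hw hh hT0 hT1 (N : ℤ),
    Finset.sum_neg_distrib, ← Finset.mul_sum, Finset.sum_add_distrib, mul_add, hn]

end

/-! ### Summation of the residues over the frequencies -/

lemma hasSum_ite_le_zpow {Q : ℂ} (hQ0 : Q ≠ 0) (hQ : ‖Q‖ < 1) (j₀ : ℤ) :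
    HasSum (fun j : ℤ => if j₀ ≤ j then Q ^ j else 0) (Q ^ j₀ / (1 - Q)) := by
  have hinj : Function.Injective fun i : ℕ => j₀ + (i : ℤ) := fun a b hab => by
    simpa using hab
  rw [← hinj.hasSum_iff]
  · have := (hasSum_geometric_of_norm_lt_one hQ).mul_left (Q ^ j₀)
    rw [← div_eq_mul_inv] at this
    refine this.congr_fun fun i => ?_
    simp [zpow_add₀ hQ0]
  · intro j hj
    rw [if_neg]
    intro hle
    exact hj ⟨(j - j₀).toNat, by simp [Int.toNat_of_nonneg (sub_nonneg.2 hle)]⟩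

lemma hasSum_ite_lt_zpow {Q : ℂ} (hQ : 1 < ‖Q‖) (j₀ : ℤ) :
    HasSum (fun j : ℤ => if j < j₀ then -Q ^ j else 0) (Q ^ j₀ / (1 - Q)) := by
  have hQ0 : Q ≠ 0 := by
    rintro rfl
    simp at hQ
    linarith
  have hQ1 : 1 - Q ≠ 0 := by
    intro h
    rw [← sub_eq_zero.1 h, norm_one] at hQ
    exact lt_irrefl _ hQ
  have h := hasSum_ite_le_zpow (inv_ne_zero hQ0) (by rw [norm_inv]; exact inv_lt_one_of_one_lt₀ hQ)
    (1 - j₀)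
  have h2 := ((Equiv.neg ℤ).hasSum_iff.2 h).neg
  have e : -(Q⁻¹ ^ (1 - j₀) / (1 - Q⁻¹)) = Q ^ j₀ / (1 - Q) := by
    have : 1 - Q⁻¹ ≠ 0 := by
      rw [← neg_ne_zero, neg_sub]
      intro h0
      apply hQ1
      field_simp at h0
      linear_combination h0
    have e1 : Q * (1 - Q⁻¹) = -(1 - Q) := by
      field_simp
      ring
    rw [inv_zpow', neg_sub, zpow_sub_one₀ hQ0, ← div_eq_mul_inv, div_div, e1, div_neg, neg_neg]
  rw [e] at h2
  refine h2.congr_fun fun j => ?_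
  simp only [Function.comp, Equiv.neg_apply, inv_zpow', neg_neg]
  by_cases hj : j < j₀
  · rw [if_pos hj, if_pos (by omega)]
  · rw [if_neg hj, if_neg (by omega), neg_zero]

section

variable {k : ℕ} {w : ℂ}

/-- A pole is crossed exactly by the frequencies beyond four times its height; whichever side of
the real axis it lies on, summing over them gives the same closed form. -/
lemma tsum_crossing_mul_zpow {T : ℝ} (hT : T ≠ 0) {j₀ : ℤ}
    (hj : ∀ j, T < freq k j / 4 ↔ j₀ ≤ j) (hne : ∀ j, T ≠ freq k j / 4) {Q : ℂ}
    (hQ0 : Q ≠ 0) (hpos : 0 < T → ‖Q‖ < 1) (hneg : T < 0 → 1 < ‖Q‖) :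
    ∑' j : ℤ, (crossing T (freq k j / 4) : ℂ) * Q ^ j = Q ^ j₀ / (1 - Q) := by
  rcases lt_or_gt_of_ne hT with h | h
  · rw [← (hasSum_ite_lt_zpow (hneg h) j₀).tsum_eq]
    refine tsum_congr fun j => ?_
    have h1 : ¬ (0 < T ∧ T < (freq k j : ℝ) / 4) := fun h2 => by linarith [h2.1]
    have h2 : (freq k j : ℝ) / 4 < T ↔ j < j₀ := by
      rw [← not_le (a := j₀), ← hj, not_lt, lt_iff_le_and_ne]
      simp [(hne j).symm]
    rw [crossing, if_neg h1]
    by_cases h3 : j < j₀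
    · rw [if_pos ⟨h2.2 h3, h⟩, if_pos h3]
      push_cast
      ring
    · rw [if_neg fun h4 => h3 (h2.1 h4.1), if_neg h3]
      simp
  · rw [← (hasSum_ite_le_zpow hQ0 (hpos h) j₀).tsum_eq]
    refine tsum_congr fun j => ?_
    have h1 : ¬ ((freq k j : ℝ) / 4 < T ∧ T < 0) := fun h2 => by linarith [h2.2]
    rw [crossing]
    by_cases h3 : j₀ ≤ j
    · rw [if_pos ⟨h, (hj j).2 h3⟩, if_pos h3]
      simp
    · rw [if_neg fun h4 => h3 ((hj j).1 h4.2), if_neg h1, if_neg h3]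
      simp

/-- The ratio of the geometric series formed by the residues at the pole `n`. -/
noncomputable def resRatio (k : ℕ) (w : ℂ) (h' : ℤ) (r : ℝ) (n : ℤ) : ℂ :=
  exp (2 * (Real.pi * I * h' * n - Real.pi * poleT k r n / w) / k)

lemma norm_resRatio (k : ℕ) (w : ℂ) (h' : ℤ) (r : ℝ) (n : ℤ) :
    ‖resRatio k w h' r n‖ = Real.exp (-(2 * Real.pi * (1 / w).re / k * poleT k r n)) := by
  have e : (2 * (Real.pi * I * h' * n - Real.pi * poleT k r n / w) / k : ℂ) =
      ((2 * Real.pi * h' * n / k : ℝ) : ℂ) * I +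
        ((-(2 * Real.pi * poleT k r n / k) : ℝ) : ℂ) * (1 / w) := by
    push_cast
    ring
  rw [resRatio, norm_exp, e, add_re, re_ofReal_mul, re_ofReal_mul, I_re]
  congr 1
  ring

/-- The residues at one pole form a geometric series in the frequency, starting at the index `j₀` of
the first frequency that crosses it. -/
lemma tsum_resTerm (hk : 0 < k) (hw : 0 < w.re) (h' : ℤ) {r : ℝ} {n j₀ : ℤ}
    (hT : poleT k r n ≠ 0) (hj : ∀ j, poleT k r n < freq k j / 4 ↔ j₀ ≤ j)
    (hne : ∀ j, poleT k r n ≠ freq k j / 4) :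
    ∑' j : ℤ, resTerm k w h' r n j = I * k / w *
      (exp (Real.pi * I * h' * (n - 2 * n ^ 2 / k) + 2 * Real.pi * (poleT k r n : ℂ) ^ 2 / (k * w) +
        (k + 2 * j₀) * (Real.pi * I * h' * n - Real.pi * poleT k r n / w) / k) /
          (1 - resRatio k w h' r n)) := by
  have hk0 : (k : ℂ) ≠ 0 := by exact_mod_cast hk.ne'
  have hρ := re_inv_pos hw
  set T := poleT k r n with hTdef
  have hsum := tsum_crossing_mul_zpow (k := k) hT hj hne (Q := resRatio k w h' r n) (exp_ne_zero _)
    (fun h => by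
      rw [norm_resRatio, Real.exp_lt_one_iff, neg_lt_zero]
      positivity)
    (fun h => by
      rw [norm_resRatio, Real.one_lt_exp_iff, ← mul_neg]
      have := neg_pos.2 h
      positivity)
  have hterm : ∀ j : ℤ, resTerm k w h' r n j =
      I * k / w * exp (Real.pi * I * h' * (n - 2 * n ^ 2 / k) +
        2 * Real.pi * (T : ℂ) ^ 2 / (k * w) + (Real.pi * I * h' * n - Real.pi * T / w)) *
        ((crossing T (freq k j / 4) : ℂ) * resRatio k w h' r n ^ j) := by
    intro j
    have e : classPhase k h' n (freq k j) *
        exp ((2 * Real.pi * (T : ℂ) ^ 2 - Real.pi * freq k j * T) / (k * w)) =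
        exp (Real.pi * I * h' * (n - 2 * n ^ 2 / k) + 2 * Real.pi * (T : ℂ) ^ 2 / (k * w) +
        (Real.pi * I * h' * n - Real.pi * T / w)) * resRatio k w h' r n ^ j := by
      rw [classPhase, resRatio, ← exp_int_mul, ← exp_add, ← exp_add, freq, ← hTdef]
      congr 1
      push_cast
      field_simp
      ring
    rw [resTerm, mordellRes, ← hTdef]
    linear_combination ((crossing T (freq k j / 4) : ℂ) * (I * k / w)) * e
  have e : (k + 2 * j₀ : ℂ) * (Real.pi * I * h' * n - Real.pi * T / w) / k =
      (Real.pi * I * h' * n - Real.pi * T / w) +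
        j₀ * (2 * (Real.pi * I * h' * n - Real.pi * T / w) / k) := by
    field_simp
  rw [tsum_congr hterm, tsum_mul_left, hsum, mul_assoc, ← mul_div_assoc, e, ← add_assoc, exp_add _
    (_ * _), exp_int_mul, resRatio]

lemma abs_mul_lt_of_abs_lt (hk : 0 < k) {r : ℝ} (hr : |r| < 1 / (8 * k)) :
    |(k : ℝ) * r| < 1 / 8 := by
  have hk' : (0 : ℝ) < k := by exact_mod_cast hk
  rw [abs_mul, abs_of_pos hk']
  calc (k : ℝ) * |r| < k * (1 / (8 * k)) := by gcongr
    _ = 1 / 8 := by field_simp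

lemma poleT_ne_zero_of_odd (hk : Odd k) {r : ℝ} (hr : |r| < 1 / (8 * k)) (n : ℤ) :
    poleT k r n ≠ 0 := by
  have hkr := abs_lt.1 (abs_mul_lt_of_abs_lt hk.pos hr)
  obtain ⟨κ, hκ⟩ := hk
  have hκr : (k : ℝ) = 2 * κ + 1 := by exact_mod_cast hκ
  rw [poleT]
  intro h
  rw [hκr] at hkr h
  have h1 : (-1 : ℝ) < n + κ := by linarith
  have h2 : (n + κ : ℝ) < 0 := by linarith
  have h3 : -1 < n + κ := by exact_mod_cast h1
  have h4 : n + κ < 0 := by exact_mod_cast h2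
  omega

lemma poleT_ne_freq_of_odd (hk : Odd k) {r : ℝ} (hr : |r| < 1 / (8 * k)) (n j : ℤ) :
    poleT k r n ≠ freq k j / 4 := by
  have hkr := abs_lt.1 (abs_mul_lt_of_abs_lt hk.pos hr)
  obtain ⟨κ, hκ⟩ := hk
  have hκr : (k : ℝ) = 2 * κ + 1 := by exact_mod_cast hκ
  intro h
  rw [poleT, freq] at h
  push_cast at h
  rw [hκr] at hkr h
  have h1 : (2 * n + κ : ℝ) < j := by linarith
  have h2 : (j : ℝ) < 2 * n + κ + 1 := by linarith
  have h3 : 2 * n + κ < j := by exact_mod_cast h1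
  have h4 : j < 2 * n + κ + 1 := by exact_mod_cast h2
  omega

lemma poleT_ne_zero_of_even (hk : Even k) (hk0 : 0 < k) {r : ℝ} (hr : |r| < 1 / (8 * k))
    (hr0 : r ≠ 0) (n : ℤ) : poleT k r n ≠ 0 := by
  have hk' : (k : ℝ) ≠ 0 := by exact_mod_cast hk0.ne'
  have hkr := abs_lt.1 (abs_mul_lt_of_abs_lt hk0 hr)
  have hkr0 : (k : ℝ) * r ≠ 0 := mul_ne_zero hk' hr0
  obtain ⟨κ, hκ⟩ := hk
  have hκr : (k : ℝ) = κ + κ := by exact_mod_cast hκ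
  rw [poleT]
  intro h
  have h1 : (-1 : ℝ) < n + κ := by linarith
  have h2 : (n + κ : ℝ) < 1 := by linarith
  have h3 : -1 < n + κ := by exact_mod_cast h1
  have h4 : n + κ < 1 := by exact_mod_cast h2
  have h5 : (n : ℝ) + κ = 0 := by exact_mod_cast (by omega : n + κ = 0)
  exact hkr0 (by linarith)

lemma poleT_ne_freq_of_even (hk : Even k) (hk0 : 0 < k) {r : ℝ} (hr : |r| < 1 / (8 * k))
    (hr0 : r ≠ 0) (n j : ℤ) : poleT k r n ≠ freq k j / 4 := by
  have hk' : (k : ℝ) ≠ 0 := by exact_mod_cast hk0.ne'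
  have hkr := abs_lt.1 (abs_mul_lt_of_abs_lt hk0 hr)
  have hkr0 : (k : ℝ) * r ≠ 0 := mul_ne_zero hk' hr0
  obtain ⟨κ, hκ⟩ := hk
  have hκr : (k : ℝ) = κ + κ := by exact_mod_cast hκ
  intro h
  rw [poleT, freq] at h
  push_cast at h
  have h1 : (2 * n + κ - 1 : ℝ) < j := by linarith
  have h2 : (j : ℝ) < 2 * n + κ + 1 := by linarith
  have h3 : 2 * n + κ - 1 < j := by exact_mod_cast h1
  have h4 : j < 2 * n + κ + 1 := by exact_mod_cast h2
  have h5 : (j : ℝ) = 2 * n + κ := by exact_mod_cast (by omega : j = 2 * n + κ)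
  exact hkr0 (by linarith)

/-- For `k` odd the residues at the pole `n` add up to a term of the series `U`. -/
lemma tsum_resTerm_of_odd (hk : Odd k) (hw : 0 < w.re) {h' : ℤ} (hh' : Even h') {r : ℝ}
    (hr : |r| < 1 / (8 * k)) (n : ℤ) :
    1 / k * ∑' j : ℤ, resTerm k w h' r n j = I / w * exp (2 * Real.pi * k * r ^ 2 / w) *
      exp (-(Real.pi * r / w)) * uTerm (I * r / w) ((h' + I / w) / k / 2) (2 * n + k) := by
  have hkp : 0 < k := hk.pos
  have hk0 : (k : ℂ) ≠ 0 := by exact_mod_cast hkp.ne'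
  have hw0 : w ≠ 0 := ne_zero_of_re_pos hw
  have hT := poleT_ne_zero_of_odd hk hr n
  have hne := poleT_ne_freq_of_odd hk hr n
  obtain ⟨κ, hκ⟩ := hk
  obtain ⟨g, hg⟩ := hh'
  have hκr : (k : ℝ) = 2 * κ + 1 := by exact_mod_cast hκ
  have hkr := abs_lt.1 (abs_mul_lt_of_abs_lt hkp hr)
  -- the first frequency that crosses the pole is `2 (2 n + k) + 1`, for either sign of `r`
  have hcmp : ∀ j, poleT k r n < freq k j / 4 ↔ 2 * n + κ + 1 ≤ j := by
    intro j
    rw [poleT, freq]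
    push_cast
    rw [hκr] at hkr ⊢
    constructor
    · intro h
      have : 2 * n + κ < j := by
        by_contra hc
        have : (j : ℝ) ≤ 2 * n + κ := by exact_mod_cast not_lt.1 hc
        linarith
      omega
    · intro h
      have : (2 * n + κ + 1 : ℝ) ≤ j := by exact_mod_cast h
      linarith
  have hκc : (κ : ℂ) = (k - 1) / 2 := by
    rw [show (k : ℂ) = 2 * κ + 1 by exact_mod_cast hκ]
    ring
  have hgc : (h' : ℂ) = 2 * g := by
    rw [hg]
    push_cast
    ring
  have hz : (2 * Real.pi * I * ((h' + I / w) / k / 2) : ℂ) =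
      Real.pi * I * h' / k - Real.pi / (k * w) := by
    linear_combination (Real.pi / (k * w)) * I_sq
  have hexp : ((2 * n + k) ^ 2 + (2 * n + k)) / 2 = (2 * n + k) * (n + κ + 1) := by
    refine Int.ediv_eq_of_eq_mul_left two_ne_zero ?_
    rw [hκ]
    push_cast
    ring
  have hTc : (poleT k r n : ℂ) = (2 * n + k) / 2 + k * r := by
    rw [poleT]
    push_cast
    ring
  have hnum : exp (Real.pi * I * h' * (n - 2 * n ^ 2 / k) +
      2 * Real.pi * (poleT k r n : ℂ) ^ 2 / (k * w) + (k + 2 * ((2 * n + κ + 1 : ℤ) : ℂ)) *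
        (Real.pi * I * h' * n - Real.pi * poleT k r n / w) / k) =
      exp (2 * Real.pi * k * r ^ 2 / w) * exp (-(Real.pi * r / w)) *
        exp (Real.pi * I * h' / k - Real.pi / (k * w)) ^ ((2 * n + k) * (n + κ + 1) : ℤ) := by
    rw [← exp_int_mul, ← exp_add, ← exp_add, exp_eq_exp_iff_exists_int]
    refine ⟨g * (n - κ - 1), ?_⟩
    rw [hTc]
    push_cast
    rw [hκc, hgc]
    field_simp
    ring
  have hden : resRatio k w h' r n = exp (2 * Real.pi * I * (I * r / w)) *
      exp (Real.pi * I * h' / k - Real.pi / (k * w)) ^ (2 * n + k : ℤ) := by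
    rw [← exp_int_mul, resRatio, ← exp_add, exp_eq_exp_iff_exists_int]
    refine ⟨-g, ?_⟩
    rw [hTc]
    push_cast
    rw [hgc]
    field_simp
    linear_combination (-(2 * k * r : ℂ)) * I_sq
  rw [tsum_resTerm hkp hw h' hT hcmp hne, hnum, hden, uTerm, hz, hexp]
  field_simp

/-- For `k` even and `r > 0` the residues at the pole `n = -s - k/2` add up to the term `s` of the
series `O` at the transformed point; for `r < 0` there is one more frequency, which gives a term of
a theta series. -/
lemma tsum_resTerm_of_even (hk : Even k) (hk0 : 0 < k) (hw : 0 < w.re) {h' : ℤ} (hh' : Odd h')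
    {r : ℝ} (hr : |r| < 1 / (8 * k)) (hr0 : r ≠ 0) {κ : ℕ} (hκ : k = κ + κ) {q₁ : ℂ}
    (hq₁ : q₁ = exp (2 * Real.pi * I * ((h' + I / w) / k))) (s : ℤ) :
    1 / k * ∑' j : ℤ, resTerm k w h' r (-s - κ) j = I / w * exp (2 * Real.pi * k * r ^ 2 / w) *
      (oTerm (r / (I * w)) q₁ s + if r < 0 then (-1) ^ s * q₁ ^ (s ^ 2) else 0) := by
  have hk' : (0 : ℝ) < k := by exact_mod_cast hk0
  have hk0' : (k : ℂ) ≠ 0 := by exact_mod_cast hk0.ne'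
  have hT := poleT_ne_zero_of_even hk hk0 hr hr0 (-s - κ)
  have hne := poleT_ne_freq_of_even hk hk0 hr hr0 (-s - κ)
  have hkr := abs_lt.1 (abs_mul_lt_of_abs_lt hk0 hr)
  obtain ⟨g, hg⟩ := hh'
  have hκr : (k : ℝ) = κ + κ := by exact_mod_cast hκ
  have hκc : (κ : ℂ) = k / 2 := by
    rw [show (k : ℂ) = κ + κ by exact_mod_cast hκ]
    ring
  have hgc : (h' : ℂ) = 2 * g + 1 := by exact_mod_cast hg
  have hz : (2 * Real.pi * I * ((h' + I / w) / k) : ℂ) =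
      2 * Real.pi * I * h' / k - 2 * Real.pi / (k * w) := by
    linear_combination (2 * Real.pi / (k * w)) * I_sq
  have hTc : (poleT k r (-s - κ) : ℂ) = -s + k * r := by
    rw [poleT]
    push_cast
    rw [hκc]
    ring
  have hy : (2 * Real.pi * I * (r / (I * w)) : ℂ) = 2 * Real.pi * r / w := by
    field_simp
  have hneg1 : ∀ n : ℤ, (-1 : ℂ) ^ n = exp (n * (Real.pi * I)) := fun n => by
    rw [exp_int_mul, exp_pi_mul_I]
  set Y : ℂ := exp (2 * Real.pi * r / w) with hY
  have hY0 : Y ≠ 0 := exp_ne_zero _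
  have hq0 : q₁ ≠ 0 := by rw [hq₁]; exact exp_ne_zero _
  have hqs : q₁ ^ s ≠ 0 := zpow_ne_zero _ hq0
  have hR : resRatio k w h' r (-s - κ) = -(q₁ ^ s * Y)⁻¹ := by
    rw [neg_eq_neg_one_mul (_)⁻¹, ← exp_pi_mul_I, hq₁, hY, ← exp_int_mul, ← exp_add, ← exp_neg,
      ← exp_add,
      resRatio, hz, exp_eq_exp_iff_exists_int]
    refine ⟨-g - 1, ?_⟩
    rw [hTc]
    push_cast
    rw [hκc, hgc]
    field_simp
    ring
  have hR1 : 1 - resRatio k w h' r (-s - κ) ≠ 0 := by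
    intro h
    have h1 := norm_resRatio k w h' r (-s - κ)
    rw [← sub_eq_zero.1 h, norm_one, eq_comm, Real.exp_eq_one_iff, neg_eq_zero] at h1
    have hρ := re_inv_pos hw
    have : 2 * Real.pi * (1 / w).re / k ≠ 0 := by positivity
    exact hT ((mul_eq_zero.1 h1).resolve_left this)
  have hD : 1 + Y * q₁ ^ s ≠ 0 := by
    intro h
    apply hR1
    rw [hR]
    field_simp
    linear_combination h
  have hnum : exp (Real.pi * I * h' * (((-s - κ : ℤ) : ℂ) - 2 * ((-s - κ : ℤ) : ℂ) ^ 2 / k) +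
      2 * Real.pi * (poleT k r (-s - κ) : ℂ) ^ 2 / (k * w) +
        (k + 2 * ((2 * (-s - κ) + κ : ℤ) : ℂ)) *
        (Real.pi * I * h' * ((-s - κ : ℤ) : ℂ) - Real.pi * poleT k r (-s - κ) / w) / k) =
      exp (2 * Real.pi * k * r ^ 2 / w) * ((-1) ^ s * q₁ ^ (s ^ 2)) := by
    rw [hneg1, hq₁, hz, ← exp_int_mul, ← exp_add, ← exp_add, exp_eq_exp_iff_exists_int]
    refine ⟨-g * s - s - κ * (2 * g + 1), ?_⟩
    rw [hTc]
    push_cast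
    rw [hκc, hgc]
    field_simp
    ring
  have hsucc : exp (Real.pi * I * h' * (((-s - κ : ℤ) : ℂ) - 2 * ((-s - κ : ℤ) : ℂ) ^ 2 / k) +
      2 * Real.pi * (poleT k r (-s - κ) : ℂ) ^ 2 / (k * w) +
        (k + 2 * ((2 * (-s - κ) + κ + 1 : ℤ) : ℂ)) *
        (Real.pi * I * h' * ((-s - κ : ℤ) : ℂ) - Real.pi * poleT k r (-s - κ) / w) / k) =
      exp (2 * Real.pi * k * r ^ 2 / w) * ((-1) ^ s * q₁ ^ (s ^ 2)) *
        resRatio k w h' r (-s - κ) := by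
    rw [← hnum, resRatio, ← exp_add]
    congr 1
    push_cast
    ring
  have hO : oTerm (r / (I * w)) q₁ s = -((-1) ^ s * q₁ ^ (s ^ 2)) / (1 + Y * q₁ ^ s) := by
    rw [oTerm, hy, zpow_add₀ (neg_ne_zero.2 one_ne_zero), zpow_one]
    ring
  set X : ℂ := q₁ ^ s * Y with hX
  have hX0 : X ≠ 0 := mul_ne_zero hqs hY0
  rw [mul_comm Y, ← hX] at hO hD
  rw [hR] at hR1
  have h1 : ∀ a : ℂ, a / (1 - -X⁻¹) = a + -a / (1 + X) := fun a => by
    rw [add_comm, eq_comm, div_add' _ _ _ hD, div_eq_div_iff hD hR1]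
    field_simp
    ring
  have h2 : ∀ a : ℂ, a * -X⁻¹ / (1 - -X⁻¹) = -a / (1 + X) := fun a => by
    rw [div_eq_div_iff hR1 hD]
    field_simp
    ring
  have h3 : (1 / k : ℂ) * (I * k / w) = I / w := by field_simp
  rcases lt_or_gt_of_ne hr0 with hneg | hpos
  -- the threshold `4 T = -4 s + 4 k r` is just below or just above the frequency `-4 s`
  · have hcmp : ∀ j, poleT k r (-s - κ) < freq k j / 4 ↔ 2 * (-s - κ) + κ ≤ j := by
      intro j
      have hkr0 : (k : ℝ) * r < 0 := mul_neg_of_pos_of_neg hk' hneg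
      rw [poleT, freq]
      push_cast
      constructor
      · intro h
        by_contra hc
        have : (j : ℝ) + 1 ≤ 2 * (-s - κ) + κ := by exact_mod_cast not_le.1 hc
        linarith
      · intro h
        have : (2 * (-s - κ) + κ : ℝ) ≤ j := by exact_mod_cast h
        linarith
    rw [tsum_resTerm hk0 hw h' hT hcmp hne, hnum, hO, if_pos hneg, hR, h1,
      ← mul_assoc (1 / k : ℂ), h3]
    ring
  · have hcmp : ∀ j, poleT k r (-s - κ) < freq k j / 4 ↔ 2 * (-s - κ) + κ + 1 ≤ j := by
      intro j
      have hkr0 : 0 < (k : ℝ) * r := mul_pos hk' hpos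
      rw [poleT, freq]
      push_cast
      constructor
      · intro h
        by_contra hc
        have : (j : ℝ) ≤ 2 * (-s - κ) + κ := by exact_mod_cast Int.lt_add_one_iff.1 (not_le.1 hc)
        linarith
      · intro h
        have : (2 * (-s - κ) + κ + 1 : ℝ) ≤ j := by exact_mod_cast h
        linarith
    rw [tsum_resTerm hk0 hw h' hT hcmp hne, hsucc, hO, if_neg (not_lt.2 hpos.le), hR,
      h2, ← mul_assoc (1 / k : ℂ), h3]
    ring

end

/-! ### Gaussian sums of the integrals along the saddle lines -/

lemma sum_range_add_int {k : ℕ} {g : ℤ → ℂ} (hg : ∀ n, g (k + n) = g n) (a : ℤ) :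
    ∑ N ∈ Finset.range k, g (N + a) = ∑ N ∈ Finset.range k, g N := by
  have step : ∀ a : ℤ, ∑ N ∈ Finset.range k, g (N + (a + 1)) = ∑ N ∈ Finset.range k, g (N + a) := by
    intro a
    have h1 := Finset.sum_range_succ (fun N : ℕ => g (N + a)) k
    have h2 := Finset.sum_range_succ' (fun N : ℕ => g (N + a)) k
    rw [h1, hg] at h2
    have h3 : ∀ N : ℕ, g (((N + 1 : ℕ) : ℤ) + a) = g (N + (a + 1)) := fun N => by
      congr 1
      push_cast
      ring
    simp only [h3, Nat.cast_zero, zero_add] at h2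
    exact (add_right_cancel h2).symm
  induction a using Int.induction_on with
  | zero => simp
  | succ n ih => rw [step, ih]
  | pred n ih => rw [← ih, ← step, sub_add_cancel]

lemma sum_range_neg_int {k : ℕ} {g : ℤ → ℂ} (hg : ∀ n, g (k + n) = g n) :
    ∑ N ∈ Finset.range k, g (-N) = ∑ N ∈ Finset.range k, g N := by
  rw [← Finset.sum_range_reflect, ← sum_range_add_int hg (1 - k : ℤ)]
  refine Finset.sum_congr rfl fun N hN => ?_
  rw [Finset.mem_range] at hN
  congr 1
  omega

lemma tsum_int_split {g : ℤ → ℂ} (hg : Summable g) (c : ℤ) :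
    ∑' j, g j = ∑' s : ℤ, g (2 * s + c) + ∑' s : ℤ, g (2 * s + 1 + c) := by
  have h := tsum_eq_sum_tsum_mul_add (k := 2) Nat.two_pos (a := 1) (b := 1) (by rw [mul_one])
    ((Equiv.addRight c).summable_iff.2 hg)
  rw [show ∑' n, (g ∘ Equiv.addRight c) n = ∑' n, g n from (Equiv.addRight c).tsum_eq g] at h
  rw [h]
  simp [Finset.sum_range_succ]

section

variable {k : ℕ} {w : ℂ}

lemma saddleTerm_add (hk : 0 < k) (w : ℂ) (h' : ℤ) (r : ℝ) (j n : ℤ) :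
    saddleTerm k w h' r (k + n) j = saddleTerm k w h' r n j := by
  have h1 := classPhase_add_mul hk h' n 1 j
  rw [mul_one] at h1
  have h2 : ((k + n : ℤ) : ℝ) / k + r - freq k j / (4 * k) =
      n / k + r - freq k j / (4 * k) + (1 : ℤ) := by
    push_cast
    field_simp
    ring
  rw [saddleTerm, saddleTerm, h1, h2, mordellJ_add_int]

lemma sum_saddleTerm_add (hk : 0 < k) (w : ℂ) (h' : ℤ) (r : ℝ) (j s : ℤ) :
    ∑ N ∈ Finset.range k, saddleTerm k w h' r N j =
      ∑ N ∈ Finset.range k, saddleTerm k w h' r (N + s) j :=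
  (sum_range_add_int (k := k) (g := fun n => saddleTerm k w h' r n j)
    (fun n => saddleTerm_add hk w h' r j n) s).symm

lemma sum_saddleTerm_neg_sub (hk : 0 < k) (w : ℂ) (h' : ℤ) (r : ℝ) (j s : ℤ) :
    ∑ N ∈ Finset.range k, saddleTerm k w h' r N j =
      ∑ N ∈ Finset.range k, saddleTerm k w h' r (-N - s) j := by
  rw [sum_saddleTerm_add hk w h' r j (-s)]
  refine (sum_range_neg_int (k := k) (g := fun n => saddleTerm k w h' r (n + -s) j)
    fun n => ?_).symm
  rw [add_assoc, saddleTerm_add hk]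

lemma sum_tsum_saddleTerm (hk : 0 < k) (hw : 0 < w.re) (h' : ℤ) (r : ℝ) {i : ℤ → ℤ}
    (hi : Function.Injective i) {a : ℂ} {b : ℤ → ℂ}
    (hab : ∀ s, ∑ N ∈ Finset.range k, saddleTerm k w h' r N (i s) = a * b s) :
    ∑ N ∈ Finset.range k, ∑' s : ℤ, saddleTerm k w h' r N (i s) = a * ∑' s : ℤ, b s := by
  have hs : ∀ N ∈ Finset.range k, Summable fun s : ℤ => saddleTerm k w h' r N (i s) := fun N _ =>
    (summable_saddleTerm hk hw h' r N).comp_injective hi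
  rw [← Summable.tsum_finsetSum hs, ← tsum_mul_left]
  exact tsum_congr hab

lemma mordellIntegrand_eq_of_even (hk : Even k) (ν : ℤ) (r : ℝ) (w : ℂ) (x : ℝ) :
    mordellIntegrand 1 k ν r w x =
      exp (-(2 * Real.pi * w * x ^ 2 / k)) / mordellDen k w ((ν : ℝ) / k + r) x := by
  rw [mordellIntegrand, mordellDen, Nat.even_iff.1 hk]
  congr 3
  push_cast
  ring

lemma mordellIntegrand_eq_of_odd (hk : Odd k) (σ ν : ℤ) (r : ℝ) (w : ℂ) (x : ℝ) :
    mordellIntegrand σ k ν r w x = exp (-(2 * Real.pi * w * x ^ 2 / k)) /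
      mordellDen k w (σ * ((ν : ℝ) / k - 1 / (4 * k)) + r) x := by
  rw [mordellIntegrand, mordellDen, Nat.odd_iff.1 hk]
  congr 3
  push_cast
  field_simp
  ring

lemma mordellI_eq_of_odd (hk : Odd k) (σ ν : ℤ) (r : ℝ) (w : ℂ) :
    mordellI σ k ν r w = mordellJ k w (σ * ((ν : ℝ) / k - 1 / (4 * k)) + r) := by
  rw [mordellI, if_pos hk, mordellJ]
  simp only [mordellIntegrand_eq_of_odd hk]

/-- For `k` odd the Gaussian factors form a theta series, and what remains are the integrals
`I⁺` (from the frequencies `4 s + 1`) and `I⁻` (from the frequencies `-(4 s + 1)`). -/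
lemma sum_saddleTerm_of_odd (hk : Odd k) (hw : 0 < w.re) {h' : ℤ} (hh' : Even h') (r : ℝ) :
    ∑ N ∈ Finset.range k, ∑' j : ℤ, saddleTerm k w h' r N j =
      (∑ ν ∈ Finset.range k, exp (2 * Real.pi * I * h' / k * (-(ν : ℂ) ^ 2 + (ν : ℂ) / 2)) *
        (mordellI 1 k ν r w + mordellI (-1) k ν r w)) * (exp (-(Real.pi / (8 * k * w))) *
      ∑' s : ℤ, exp (Real.pi * I * h' / k - Real.pi / (k * w)) ^ (2 * s ^ 2 + s)) := by
  have hkp : 0 < k := hk.pos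
  have hkodd := hk
  obtain ⟨κ, hκ⟩ := hk
  obtain ⟨g, hg⟩ := hh'
  have hgc : (h' : ℂ) = 2 * g := by
    rw [hg]
    push_cast
    ring
  set p : ℂ := exp (Real.pi * I * h' / k - Real.pi / (k * w)) with hp
  set b : ℤ → ℂ := fun s => exp (-(Real.pi / (8 * k * w))) * p ^ (2 * s ^ 2 + s) with hb
  have hphase : ∀ ν s : ℤ, ∀ μ : ℤ, (μ = 4 * s + 1) →
      classPhase k h' (ν + s) μ * exp (-(Real.pi * (μ : ℂ) ^ 2 / (8 * k * w))) =
      exp (2 * Real.pi * I * h' / k * (-(ν : ℂ) ^ 2 + (ν : ℂ) / 2)) * b s := by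
    rintro ν s μ rfl
    simp only [hb]
    rw [classPhase, hp, ← exp_int_mul, ← exp_add, ← exp_add, ← exp_add, exp_eq_exp_iff_exists_int]
    refine ⟨g * (ν + s), ?_⟩
    push_cast
    rw [hgc]
    field_simp
    ring
  have hphase' : ∀ ν s : ℤ, ∀ μ : ℤ, (μ = -(4 * s + 1)) →
      classPhase k h' (-ν - s) μ * exp (-(Real.pi * (μ : ℂ) ^ 2 / (8 * k * w))) =
      exp (2 * Real.pi * I * h' / k * (-(ν : ℂ) ^ 2 + (ν : ℂ) / 2)) * b s := by
    rintro ν s μ rfl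
    simp only [hb]
    rw [classPhase, hp, ← exp_int_mul, ← exp_add, ← exp_add, ← exp_add, exp_eq_exp_iff_exists_int]
    refine ⟨-g * (ν + s), ?_⟩
    push_cast
    rw [hgc]
    field_simp
    ring
  have hplus : ∀ ν s : ℤ, saddleTerm k w h' r (ν + s) (2 * s + -κ) =
      exp (2 * Real.pi * I * h' / k * (-(ν : ℂ) ^ 2 + (ν : ℂ) / 2)) * mordellI 1 k ν r w * b s := by
    intro ν s
    have hμ : freq k (2 * s + -κ) = 4 * s + 1 := by
      rw [freq, hκ]
      push_cast
      ring
    rw [saddleTerm, ← mul_assoc, hphase ν s _ hμ, hμ, mordellI_eq_of_odd hkodd, mul_right_comm]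
    congr 3
    push_cast
    field_simp
    ring
  have hminus : ∀ ν s : ℤ, saddleTerm k w h' r (-ν - s) (2 * (-1 - s) + 1 + -κ) =
      exp (2 * Real.pi * I * h' / k * (-(ν : ℂ) ^ 2 + (ν : ℂ) / 2)) * mordellI (-1) k ν r w *
        b s := by
    intro ν s
    have hμ : freq k (2 * (-1 - s) + 1 + -κ) = -(4 * s + 1) := by
      rw [freq, hκ]
      push_cast
      ring
    rw [saddleTerm, ← mul_assoc, hphase' ν s _ hμ, hμ, mordellI_eq_of_odd hkodd, mul_right_comm]
    congr 3
    push_cast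
    field_simp
    ring
  have hinj1 : Function.Injective fun s : ℤ => 2 * s + -(κ : ℤ) := fun x y hxy => by
    simpa using hxy
  have hinj2 : Function.Injective fun s : ℤ => 2 * (-1 - s) + 1 + -(κ : ℤ) := fun x y hxy => by
    simpa using hxy
  have hab1 : ∀ s : ℤ, ∑ N ∈ Finset.range k, saddleTerm k w h' r N (2 * s + -κ) =
      (∑ ν ∈ Finset.range k, exp (2 * Real.pi * I * h' / k * (-(ν : ℂ) ^ 2 + (ν : ℂ) / 2)) *
        mordellI 1 k ν r w) * b s := fun s => by
      rw [sum_saddleTerm_add hkp w h' r _ s, Finset.sum_mul]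
      refine Finset.sum_congr rfl fun ν _ => ?_
      rw [hplus, Int.cast_natCast]
  have hab2 : ∀ s : ℤ, ∑ N ∈ Finset.range k, saddleTerm k w h' r N (2 * (-1 - s) + 1 + -κ) =
      (∑ ν ∈ Finset.range k, exp (2 * Real.pi * I * h' / k * (-(ν : ℂ) ^ 2 + (ν : ℂ) / 2)) *
        mordellI (-1) k ν r w) * b s := fun s => by
      rw [sum_saddleTerm_neg_sub hkp w h' r _ s, Finset.sum_mul]
      refine Finset.sum_congr rfl fun ν _ => ?_
      rw [hminus, Int.cast_natCast]
  have hsum1 := sum_tsum_saddleTerm hkp hw h' r hinj1 hab1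
  have hsum2 := sum_tsum_saddleTerm hkp hw h' r hinj2 hab2
  have hsplit : ∀ N : ℤ, ∑' j : ℤ, saddleTerm k w h' r N j =
      ∑' s : ℤ, saddleTerm k w h' r N (2 * s + -κ) +
        ∑' s : ℤ, saddleTerm k w h' r N (2 * (-1 - s) + 1 + -κ) := fun N => by
    rw [tsum_int_split (summable_saddleTerm hkp hw h' r N) (-κ),
      ← (Equiv.subLeft (-1 : ℤ)).tsum_eq (fun s => saddleTerm k w h' r N (2 * s + 1 + -κ))]
    rfl
  rw [Finset.sum_congr rfl fun (N : ℕ) _ => hsplit N, Finset.sum_add_distrib, hsum1, hsum2,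
    ← add_mul, ← Finset.sum_add_distrib, hb, tsum_mul_left]
  simp only [mul_add]

/-- For `k` even the frequencies `4 s` give a theta series and the integrals `I⁺`, while the
contributions of the frequencies `4 s + 2` cancel in pairs. -/
lemma sum_saddleTerm_of_even (hk : Even k) (hkp : 0 < k) (hw : 0 < w.re) {h' : ℤ} (hh' : Odd h')
    (r : ℝ) {q₁ : ℂ} (hq₁ : q₁ = exp (2 * Real.pi * I * ((h' + I / w) / k))) :
    ∑ N ∈ Finset.range k, ∑' j : ℤ, saddleTerm k w h' r N j =
      (∑ ν ∈ Finset.range k, (-1) ^ ν * exp (-(2 * Real.pi * I * h' * (ν : ℂ) ^ 2 / k)) *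
        mordellJ k w ((ν : ℝ) / k + r)) * ∑' s : ℤ, (-1) ^ s * q₁ ^ (s ^ 2) := by
  obtain ⟨κ, hκ⟩ := hk
  obtain ⟨g, hg⟩ := hh'
  have hgc : (h' : ℂ) = 2 * g + 1 := by exact_mod_cast hg
  have hz : (2 * Real.pi * I * ((h' + I / w) / k) : ℂ) =
      2 * Real.pi * I * h' / k - 2 * Real.pi / (k * w) := by
    linear_combination (2 * Real.pi / (k * w)) * I_sq
  have hneg1 : ∀ n : ℤ, (-1 : ℂ) ^ n = exp (n * (Real.pi * I)) := fun n => by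
    rw [exp_int_mul, exp_pi_mul_I]
  have hphase : ∀ ν s : ℤ, ∀ μ : ℤ, (μ = 4 * s) →
      classPhase k h' (ν + s) μ * exp (-(Real.pi * (μ : ℂ) ^ 2 / (8 * k * w))) =
      (-1) ^ ν * exp (-(2 * Real.pi * I * h' * (ν : ℂ) ^ 2 / k)) *
        ((-1) ^ s * q₁ ^ (s ^ 2)) := by
    rintro ν s μ rfl
    rw [classPhase, hneg1, hneg1, hq₁, hz, ← exp_int_mul, ← exp_add, ← exp_add, ← exp_add,
      ← exp_add, exp_eq_exp_iff_exists_int]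
    refine ⟨g * (ν + s), ?_⟩
    push_cast
    rw [hgc]
    field_simp
    ring
  have hphase' : ∀ ν s : ℤ, ∀ μ : ℤ, (μ = 4 * s + 2) →
      classPhase k h' (ν + s) μ * exp (-(Real.pi * (μ : ℂ) ^ 2 / (8 * k * w))) =
      (-1) ^ ν * exp (2 * Real.pi * I * h' * (-(ν : ℂ) ^ 2 + ν) / k - Real.pi / (2 * k * w)) *
        ((-1) ^ s * q₁ ^ (s ^ 2 + s)) := by
    rintro ν s μ rfl
    rw [classPhase, hneg1, hneg1, hq₁, hz, ← exp_int_mul, ← exp_add, ← exp_add, ← exp_add,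
      ← exp_add, exp_eq_exp_iff_exists_int]
    refine ⟨g * (ν + s), ?_⟩
    push_cast
    rw [hgc]
    field_simp
    ring
  have hinj1 : Function.Injective fun s : ℤ => 2 * s + -(κ : ℤ) := fun x y hxy => by
    simpa using hxy
  have hinj2 : Function.Injective fun s : ℤ => 2 * s + 1 + -(κ : ℤ) := fun x y hxy => by
    simpa using hxy
  have hab1 : ∀ s : ℤ, ∑ N ∈ Finset.range k, saddleTerm k w h' r N (2 * s + -κ) =
      (∑ ν ∈ Finset.range k, (-1) ^ ν * exp (-(2 * Real.pi * I * h' * (ν : ℂ) ^ 2 / k)) *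
        mordellJ k w ((ν : ℝ) / k + r)) * ((-1) ^ s * q₁ ^ (s ^ 2)) := fun s => by
      rw [sum_saddleTerm_add hkp w h' r _ s, Finset.sum_mul]
      refine Finset.sum_congr rfl fun ν _ => ?_
      have hμ : freq k (2 * s + -κ) = 4 * s := by
        rw [freq, hκ]
        push_cast
        ring
      rw [saddleTerm, ← mul_assoc, hphase ν s _ hμ, hμ, mul_right_comm, zpow_natCast,
        Int.cast_natCast]
      congr 3
      push_cast
      field_simp
      ring
  have hab2 : ∀ s : ℤ, ∑ N ∈ Finset.range k, saddleTerm k w h' r N (2 * s + 1 + -κ) =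
      (∑ ν ∈ Finset.range k, (-1) ^ ν *
        exp (2 * Real.pi * I * h' * (-(ν : ℂ) ^ 2 + ν) / k - Real.pi / (2 * k * w)) *
          mordellJ k w ((ν : ℝ) / k + r - 1 / (2 * k))) * ((-1) ^ s * q₁ ^ (s ^ 2 + s)) :=
    fun s => by
      rw [sum_saddleTerm_add hkp w h' r _ s, Finset.sum_mul]
      refine Finset.sum_congr rfl fun ν _ => ?_
      have hμ : freq k (2 * s + 1 + -κ) = 4 * s + 2 := by
        rw [freq, hκ]
        push_cast
        ring
      rw [saddleTerm, ← mul_assoc, hphase' ν s _ hμ, hμ, mul_right_comm, zpow_natCast,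
        Int.cast_natCast]
      congr 3
      push_cast
      field_simp
      ring
  have hsum1 := sum_tsum_saddleTerm hkp hw h' r hinj1 hab1
  have hsum2 := sum_tsum_saddleTerm hkp hw h' r hinj2 hab2
  -- the substitution `s ↦ -1 - s` changes the sign of the terms
  have hzero : ∑' s : ℤ, (-1 : ℂ) ^ s * q₁ ^ (s ^ 2 + s) = 0 := by
    have h1 := (Equiv.subLeft (-1 : ℤ)).tsum_eq (fun s => (-1 : ℂ) ^ s * q₁ ^ (s ^ 2 + s))
    have h2 : ∀ s : ℤ, (-1 : ℂ) ^ (-1 - s) * q₁ ^ ((-1 - s) ^ 2 + (-1 - s)) =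
        -((-1 : ℂ) ^ s * q₁ ^ (s ^ 2 + s)) := fun s => by
      have h3 : (-1 : ℂ) ^ (-1 - s) = -(-1 : ℂ) ^ s := by
        rw [show -1 - s = -(s + 1) by ring, zpow_neg, ← inv_zpow, inv_neg, inv_one,
          zpow_add₀ (neg_ne_zero.2 one_ne_zero), zpow_one, mul_neg_one]
      rw [h3, neg_mul]
      congr 3
      ring
    simp only [Equiv.subLeft_apply] at h1
    rw [tsum_congr h2, tsum_neg] at h1
    linear_combination (-1 / 2 : ℂ) * h1
  have hsplit : ∀ N : ℤ, ∑' j : ℤ, saddleTerm k w h' r N j =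
      ∑' s : ℤ, saddleTerm k w h' r N (2 * s + -κ) +
        ∑' s : ℤ, saddleTerm k w h' r N (2 * s + 1 + -κ) := fun N =>
    tsum_int_split (summable_saddleTerm hkp hw h' r N) (-κ)
  rw [Finset.sum_congr rfl fun (N : ℕ) _ => hsplit N, Finset.sum_add_distrib, hsum1, hsum2, hzero,
    mul_zero, add_zero]

end

/-! ### The transformation of the eta quotient and of `O` -/

section

variable {k : ℕ} {w : ℂ}

lemma norm_exp_two_pi_mul_lt_one {z : ℂ} (hz : 0 < z.im) : ‖exp (2 * Real.pi * I * z)‖ < 1 := by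
  have e : (2 * Real.pi * I * z : ℂ) = ((2 * Real.pi : ℝ) : ℂ) * (I * z) := by
    push_cast
    ring
  rw [norm_exp, e, re_ofReal_mul, Real.exp_lt_one_iff, I_mul_re, mul_neg, neg_lt_zero]
  have := Real.pi_pos
  positivity

lemma im_pos_of_re_pos (hk : 0 < k) (hw : 0 < w.re) (h : ℤ) : 0 < ((h + I * w) / k : ℂ).im := by
  rw [show ((h + I * w) / k : ℂ) = ((h + I * w) / ((k : ℝ) : ℂ)) by rw [ofReal_natCast],
    div_ofReal_im, add_im, intCast_im, zero_add, I_mul_im]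
  positivity

lemma im_inv_pos_of_re_pos (hk : 0 < k) (hw : 0 < w.re) (h : ℤ) : 0 < ((h + I / w) / k : ℂ).im := by
  have h1 := im_pos_of_re_pos hk (re_inv_pos hw) h
  rwa [mul_one_div] at h1

lemma eta_ne_zero {z : ℂ} (hz : 0 < z.im) : ModularForm.eta z ≠ 0 := by
  rw [eta_eq_euler]
  exact mul_ne_zero (exp_ne_zero _) (euler_ne_zero (norm_exp_two_pi_mul_lt_one hz))

lemma eta_quotient_eq_euler {z : ℂ} : ModularForm.eta (2 * z) / ModularForm.eta z ^ 2 =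
    euler (exp (2 * Real.pi * I * z) ^ 2) / euler (exp (2 * Real.pi * I * z)) ^ 2 := by
  have e1 : exp (2 * Real.pi * I * (2 * z)) = exp (2 * Real.pi * I * z) ^ 2 := by
    rw [← exp_nat_mul]
    congr 1
    push_cast
    ring
  have e2 : exp (Real.pi * I * (2 * z) / 12) = exp (Real.pi * I * z / 12) ^ 2 := by
    rw [← exp_nat_mul]
    congr 1
    push_cast
    ring
  rw [eta_eq_euler, eta_eq_euler z, e1, e2, mul_pow,
    mul_div_mul_left _ _ (pow_ne_zero 2 (exp_ne_zero _))]

lemma oFun_eq_eta {z : ℂ} (hz : 0 < z.im) (r : ℂ) : oFun r (exp (2 * Real.pi * I * z)) =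
    4 * (ModularForm.eta (2 * z) / ModularForm.eta z ^ 2) *
      ∑' n : ℤ, oTerm r (exp (2 * Real.pi * I * z)) n := by
  rw [oFun, qPochInf_div (norm_exp_two_pi_mul_lt_one hz), eta_quotient_eq_euler]

lemma cpow_half_mul_self (hw : w ≠ 0) : w ^ (1 / 2 : ℂ) * w ^ (1 / 2 : ℂ) = w := by
  rw [← cpow_add _ _ hw, add_halves, cpow_one]

lemma cpow_neg_half (hw : w ≠ 0) : w ^ (-(1 / 2) : ℂ) = w ^ (1 / 2 : ℂ) / w := by
  have h : w ^ (1 / 2 : ℂ) ≠ 0 := by simp [cpow_eq_zero_iff, hw]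
  rw [eq_div_iff hw, cpow_neg, inv_mul_eq_iff_eq_mul₀ h, cpow_half_mul_self hw]

lemma omega_ne_zero (h : ℤ) (k : ℕ) : omega h k ≠ 0 := exp_ne_zero _

/-- As `h'` is even, `h' / 2` is an inverse of `-2 h` modulo `k`, so that `η(2 z)` is transformed
with `(2 h, h' / 2, 2 w)` in place of `(h, h', w)`. -/
lemma eta_quotient_of_odd (hk : 0 < k) (hw : 0 < w.re) {h h' : ℤ}
    (hh : h * h' ≡ -1 [ZMOD (k : ℤ)]) (hh' : Even h') :
    ModularForm.eta (2 * ((h + I * w) / k)) / ModularForm.eta ((h + I * w) / k) ^ 2 =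
      omega h k ^ 2 / omega (2 * h) k * (w ^ (1 / 2 : ℂ) / (Real.sqrt 2 : ℂ)) *
        exp (Real.pi * I * h' / (8 * k)) *
        (ModularForm.eta ((h' + I / w) / k / 2) / ModularForm.eta ((h' + I / w) / k) ^ 2) := by
  have hw0 : w ≠ 0 := ne_zero_of_re_pos hw
  obtain ⟨g, rfl⟩ := hh'
  have hh2 : 2 * h * g ≡ -1 [ZMOD (k : ℤ)] := by
    have : 2 * h * g = h * (g + g) := by ring
    rwa [this]
  have hw2 : 0 < (2 * w).re := by
    simpa using hw
  have t1 := eta_transform k hk h (g + g) hh w hw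
  have t2 := eta_transform k hk (2 * h) g hh2 (2 * w) hw2
  have e1 : ((g : ℂ) + I / (2 * w)) / k = (((g + g : ℤ) : ℂ) + I / w) / k / 2 := by
    push_cast
    field_simp
    ring
  have e2 : (((2 * h : ℤ) : ℂ) + I * (2 * w)) / k = 2 * ((h + I * w) / k) := by
    push_cast
    ring
  have e3 : (2 * w) ^ (1 / 2 : ℂ) = (Real.sqrt 2 : ℂ) * w ^ (1 / 2 : ℂ) := by
    rw [mul_cpow_of_re_pos (by norm_num) hw, Real.sqrt_eq_rpow, ofReal_cpow (by norm_num)]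
    norm_num
  rw [e1, e2, e3] at t2
  have hs : (Real.sqrt 2 : ℂ) ≠ 0 := by
    rw [ofReal_ne_zero]
    positivity
  have hwh : w ^ (1 / 2 : ℂ) ≠ 0 := by simp [cpow_eq_zero_iff, hw0]
  have e4 : exp (Real.pi * I * ((g + g : ℤ) : ℂ) / (8 * k)) *
      exp (Real.pi * I * (g - (2 * h : ℤ)) / (12 * k)) =
      exp (Real.pi * I * (((g + g : ℤ) : ℂ) - h) / (12 * k)) ^ 2 := by
    rw [← exp_nat_mul, ← exp_add]
    congr 1
    push_cast
    field_simp
    ring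
  rw [t1, t2]
  set E1 := exp (Real.pi * I * ((g + g : ℤ) : ℂ) / (8 * k))
  set E2 := exp (Real.pi * I * (g - (2 * h : ℤ)) / (12 * k))
  have hE3 := exp_ne_zero (Real.pi * I * (((g + g : ℤ) : ℂ) - h) / (12 * k))
  set E3 := exp (Real.pi * I * (((g + g : ℤ) : ℂ) - h) / (12 * k))
  have ho := omega_ne_zero h k
  have ho2 := omega_ne_zero (2 * h) k
  set X := ModularForm.eta (2 * ((h + I * w) / k))
  set Y := ModularForm.eta ((h + I * w) / k)
  set W := w ^ (1 / 2 : ℂ)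
  set S := (Real.sqrt 2 : ℂ)
  rw [show omega h k ^ 2 / omega (2 * h) k * (W / S) * E1 *
    (omega (2 * h) k * (S * W) * E2 * X / (omega h k * W * E3 * Y) ^ 2) =
    (E1 * E2) * X / (E3 ^ 2 * Y ^ 2) by field_simp, e4]
  field_simp

/-- Here `η(2 z)` is transformed with the modulus `k / 2`, keeping `h` and `h'`. -/
lemma eta_quotient_of_even (hk : 0 < k) (hke : Even k) (hw : 0 < w.re) {h h' : ℤ}
    (hh : h * h' ≡ -1 [ZMOD (k : ℤ)]) :
    ModularForm.eta (2 * ((h + I * w) / k)) / ModularForm.eta ((h + I * w) / k) ^ 2 =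
      omega h k ^ 2 / omega h (k / 2) * w ^ (1 / 2 : ℂ) *
        (ModularForm.eta (2 * ((h' + I / w) / k)) / ModularForm.eta ((h' + I / w) / k) ^ 2) := by
  have hw0 : w ≠ 0 := ne_zero_of_re_pos hw
  obtain ⟨κ, hκ⟩ := hke
  have hκ2 : k / 2 = κ := by omega
  have hκpos : 0 < κ := by omega
  have hkc : (k : ℂ) = 2 * κ := by
    rw [hκ]
    push_cast
    ring
  have hhκ : h * h' ≡ -1 [ZMOD (κ : ℤ)] :=
    hh.of_dvd ⟨2, by rw [hκ]; push_cast; ring⟩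
  have t1 := eta_transform k hk h h' hh w hw
  have t2 := eta_transform κ hκpos h h' hhκ w hw
  have e1 : ((h' : ℂ) + I / w) / κ = 2 * ((h' + I / w) / k) := by
    rw [hkc]
    field_simp
  have e2 : ((h : ℂ) + I * w) / κ = 2 * ((h + I * w) / k) := by
    rw [hkc]
    field_simp
  rw [e1, e2] at t2
  have hwh : w ^ (1 / 2 : ℂ) ≠ 0 := by simp [cpow_eq_zero_iff, hw0]
  have e4 : exp (Real.pi * I * (h' - h) / (12 * κ)) =
      exp (Real.pi * I * (h' - h) / (12 * k)) ^ 2 := by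
    rw [← exp_nat_mul, hkc]
    congr 1
    push_cast
    field_simp
  rw [t1, t2, e4, hκ2]
  have ho := omega_ne_zero h k
  have ho2 := omega_ne_zero h κ
  field_simp

/-- The transformation of `O` for `k` odd: the residues give `U`, the saddle lines the integrals. -/
theorem oFun_of_odd (hk : Odd k) (hw : 0 < w.re) {h h' : ℤ} (hh : h * h' ≡ -1 [ZMOD (k : ℤ)])
    (hh' : Even h') {r : ℝ} (hr : |r| < 1 / (8 * k)) :
    oFun r (exp (2 * Real.pi * I * ((h + I * w) / k))) =
      -2 * (Real.sqrt 2 : ℂ) * I * w ^ (-(1 / 2) : ℂ) * (omega h k ^ 2 / omega (2 * h) k) *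
          exp (Real.pi * I * h' / (8 * k) + 2 * Real.pi * k * r ^ 2 / w) *
          uFun (I * r / w) ((h' + I / w) / k / 2)
        - 2 * (Real.sqrt 2 : ℂ) * w ^ (1 / 2 : ℂ) * (omega h k ^ 2 / omega (2 * h) k) * (1 / k) *
          ∑ ν ∈ Finset.range k, exp (2 * Real.pi * I * h' / k * (-(ν : ℂ) ^ 2 + (ν : ℂ) / 2)) *
            (mordellI 1 k ν r w + mordellI (-1) k ν r w) := by
  have hkp := hk.pos
  have hw0 : w ≠ 0 := ne_zero_of_re_pos hw
  have hz := im_pos_of_re_pos hkp hw h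
  set z₁ : ℂ := (h' + I / w) / k with hz₁
  have hz1 : 0 < z₁.im := im_inv_pos_of_re_pos hkp hw h'
  have hz2 : 0 < (z₁ / 2).im := by
    rw [show z₁ / 2 = z₁ / ((2 : ℝ) : ℂ) by norm_num, div_ofReal_im]
    positivity
  -- the series over the poles
  have hres : 1 / k * ∑' n : ℤ, ∑' j : ℤ, resTerm k w h' r n j =
      I / w * exp (2 * Real.pi * k * r ^ 2 / w) * exp (-(Real.pi * r / w)) *
        ∑' m : {m : ℤ // Odd m}, uTerm (I * r / w) (z₁ / 2) m := by
    obtain ⟨κ, hκ⟩ := hk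
    have hbij : Function.Bijective fun n : ℤ => (⟨2 * n + k, by
        rw [hκ]; exact ⟨n + κ, by push_cast; ring⟩⟩ : {m : ℤ // Odd m}) := by
      refine ⟨fun a b hab => ?_, ?_⟩
      · simpa using hab
      · rintro ⟨m, c, hc⟩
        refine ⟨c - κ, Subtype.ext ?_⟩
        simp only [hκ, hc]
        push_cast
        ring
    rw [← tsum_mul_left, tsum_congr (tsum_resTerm_of_odd ⟨κ, hκ⟩ hw hh' hr), tsum_mul_left,
      ← (Equiv.ofBijective _ hbij).tsum_eq]
    rfl
  have hmain := tsum_oTerm_eq hkp hw hh (poleT_ne_zero_of_odd hk hr) (poleT_ne_freq_of_odd hk hr)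
  rw [sum_saddleTerm_of_odd hk hw hh' r, hres] at hmain
  have hq : (2 * Real.pi * I * ((h + I * w) / k) : ℂ) = 2 * Real.pi * I / k * (h + I * w) := by
    ring
  -- the theta series cancels the eta quotient at the transformed point
  have hp : exp (Real.pi * I * h' / k - Real.pi / (k * w)) = exp (2 * Real.pi * I * (z₁ / 2)) := by
    rw [hz₁]
    congr 1
    linear_combination (-(Real.pi / (k * w))) * I_sq
  have hθ : exp (Real.pi * I * h' / (8 * k)) *
      (ModularForm.eta (z₁ / 2) / ModularForm.eta z₁ ^ 2) * (exp (-(Real.pi / (8 * k * w))) *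
        ∑' s : ℤ, exp (Real.pi * I * h' / k - Real.pi / (k * w)) ^ (2 * s ^ 2 + s)) = 1 := by
    have hlt := norm_exp_two_pi_mul_lt_one hz2
    have e1 : exp (2 * Real.pi * I * z₁) = exp (2 * Real.pi * I * (z₁ / 2)) ^ 2 := by
      rw [← exp_nat_mul]
      congr 1
      push_cast
      ring
    have e2 : exp (Real.pi * I * h' / (8 * k)) * exp (-(Real.pi / (8 * k * w))) *
        exp (Real.pi * I * (z₁ / 2) / 12) = exp (Real.pi * I * z₁ / 12) ^ 2 := by
      rw [← exp_nat_mul, ← exp_add, ← exp_add]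
      congr 1
      rw [hz₁]
      push_cast
      linear_combination (-(Real.pi / (8 * k * w))) * I_sq
    rw [hp, tsum_zpow_two_mul_sq_add (exp_ne_zero _) hlt, eta_eq_euler, eta_eq_euler z₁, e1]
    have h1 := euler_ne_zero hlt
    have h2 := euler_ne_zero (norm_sq_lt_one hlt)
    have h3 := exp_ne_zero (Real.pi * I * z₁ / 12)
    set E1 := exp (Real.pi * I * h' / (8 * k))
    set E2 := exp (-(Real.pi / (8 * k * w)))
    set E3 := exp (Real.pi * I * (z₁ / 2) / 12)
    set E4 := exp (Real.pi * I * z₁ / 12)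
    set p := exp (2 * Real.pi * I * (z₁ / 2))
    rw [show E1 * (E3 * euler p / (E4 * euler (p ^ 2)) ^ 2) * (E2 * (euler (p ^ 2) ^ 2 / euler p)) =
      E1 * E2 * E3 / E4 ^ 2 by field_simp, e2]
    field_simp
  have hs2 : (Real.sqrt 2 : ℂ) * (Real.sqrt 2 : ℂ) = 2 := by
    rw [← ofReal_mul, Real.mul_self_sqrt (by norm_num)]
    norm_num
  have hs : (Real.sqrt 2 : ℂ) ≠ 0 := by
    rw [ofReal_ne_zero]
    positivity
  have hu : exp (Real.pi * I * (I * r / w)) = exp (-(Real.pi * r / w)) := by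
    congr 1
    linear_combination (Real.pi * r / w) * I_sq
  have h4 : (4 : ℂ) / Real.sqrt 2 = 2 * Real.sqrt 2 := by
    rw [div_eq_iff hs]
    linear_combination (-2 : ℂ) * hs2
  rw [oFun_eq_eta hz, hq, hmain, eta_quotient_of_odd hkp hw hh hh', ← hz₁, uFun, hu,
    cpow_neg_half hw0, exp_add, show 2 * (z₁ / 2) = z₁ by ring]
  set Θ := exp (-(Real.pi / (8 * k * w))) *
        ∑' s : ℤ, exp (Real.pi * I * h' / k - Real.pi / (k * w)) ^ (2 * s ^ 2 + s)
  set U := ∑' m : {m : ℤ // Odd m}, uTerm (I * r / w) (z₁ / 2) m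
  set M := ∑ ν ∈ Finset.range k, exp (2 * Real.pi * I * h' / k * (-(ν : ℂ) ^ 2 + (ν : ℂ) / 2)) *
        (mordellI 1 k ν r w + mordellI (-1) k ν r w)
  set E1 := exp (Real.pi * I * h' / (8 * k))
  set R := ModularForm.eta (z₁ / 2) / ModularForm.eta z₁ ^ 2
  set Ω := omega h k ^ 2 / omega (2 * h) k
  set W := w ^ (1 / 2 : ℂ)
  set E5 := exp (2 * Real.pi * k * r ^ 2 / w)
  set E6 := exp (-(Real.pi * r / w))
  linear_combination (-(Ω * W * E1 * R * (1 / k * (M * Θ) + I / w * E5 * E6 * U))) * h4 -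
    (2 * Real.sqrt 2 * Ω * W / k * M) * hθ

/-- The transformation of `O` for `k` even and `r ≠ 0`: the residues give `O` at the transformed
point, the saddle lines the integrals `I⁺`. -/
theorem oFun_of_even (hk : Even k) (hkp : 0 < k) (hw : 0 < w.re) {h h' : ℤ}
    (hh : h * h' ≡ -1 [ZMOD (k : ℤ)]) {r : ℝ} (hr : |r| < 1 / (8 * k)) (hr0 : r ≠ 0) :
    oFun r (exp (2 * Real.pi * I * ((h + I * w) / k))) =
      -I * (omega h k ^ 2 / omega h (k / 2)) * w ^ (-(1 / 2) : ℂ) *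
          exp (2 * Real.pi * k * r ^ 2 / w) *
          (oFun (r / (I * w)) (exp (2 * Real.pi * I * ((h' + I / w) / k))) +
            2 * (1 - (Real.sign r : ℂ)))
        - 4 * omega h k ^ 2 * w ^ (1 / 2 : ℂ) / (k * omega h (k / 2)) *
          ∑ ν ∈ Finset.range k, (-1) ^ ν * exp (-(2 * Real.pi * I * h' * (ν : ℂ) ^ 2 / k)) *
            mordellJ k w ((ν : ℝ) / k + r) := by
  have hw0 : w ≠ 0 := ne_zero_of_re_pos hw
  have hz := im_pos_of_re_pos hkp hw h
  set z₁ : ℂ := (h' + I / w) / k with hz₁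
  have hz1 : 0 < z₁.im := im_inv_pos_of_re_pos hkp hw h'
  set q₁ : ℂ := exp (2 * Real.pi * I * z₁) with hq₁
  have hq0 : q₁ ≠ 0 := exp_ne_zero _
  have hq1 : ‖q₁‖ < 1 := norm_exp_two_pi_mul_lt_one hz1
  have hodd : Odd h' := by
    obtain ⟨c, hc⟩ := hh.symm.dvd
    obtain ⟨κ, hκ⟩ := hk
    rw [hκ] at hc
    by_contra hne
    obtain ⟨g, hg⟩ := Int.not_odd_iff_even.1 hne
    rw [hg] at hc
    have h2 : 2 * (h * g) + 1 = 2 * (κ * c) := by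
      push_cast at hc
      linarith
    omega
  have hs1 : Summable (oTerm (r / (I * w)) q₁) := summable_oTerm hq0 hq1
  have hs2 : Summable fun s : ℤ => (-1 : ℂ) ^ s * q₁ ^ (s ^ 2) := by
    refine (summable_zpow_sq_mul_zpow hq0 hq1 (neg_ne_zero.2 one_ne_zero)).congr fun s => ?_
    rw [mul_comm]
  have hres : 1 / k * ∑' n : ℤ, ∑' j : ℤ, resTerm k w h' r n j =
      I / w * exp (2 * Real.pi * k * r ^ 2 / w) * (∑' s : ℤ, oTerm (r / (I * w)) q₁ s +
        if r < 0 then ∑' s : ℤ, (-1 : ℂ) ^ s * q₁ ^ (s ^ 2) else 0) := by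
    obtain ⟨κ, hκ⟩ := hk
    have e := (Equiv.subLeft (-κ : ℤ)).tsum_eq fun n : ℤ => ∑' j : ℤ, resTerm k w h' r n j
    have e2 : ∀ s : ℤ, Equiv.subLeft (-κ : ℤ) s = -s - κ := fun s => by
      rw [Equiv.subLeft_apply]
      ring
    simp only [e2] at e
    rw [← e, ← tsum_mul_left,
      tsum_congr (tsum_resTerm_of_even ⟨κ, hκ⟩ hkp hw hodd hr hr0 hκ hq₁), tsum_mul_left]
    congr 1
    split_ifs with hneg
    · exact hs1.tsum_add hs2
    · simp only [add_zero]
  have hmain := tsum_oTerm_eq hkp hw hh (poleT_ne_zero_of_even hk hkp hr hr0)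
    (poleT_ne_freq_of_even hk hkp hr hr0)
  rw [sum_saddleTerm_of_even hk hkp hw hodd r hq₁, hres] at hmain
  have hq : (2 * Real.pi * I * ((h + I * w) / k) : ℂ) = 2 * Real.pi * I / k * (h + I * w) := by
    ring
  have hθ : ModularForm.eta (2 * z₁) / ModularForm.eta z₁ ^ 2 *
      ∑' s : ℤ, (-1 : ℂ) ^ s * q₁ ^ (s ^ 2) = 1 := by
    rw [eta_quotient_eq_euler, ← hq₁, tsum_neg_one_zpow_mul hq0 hq1]
    have h1 := euler_ne_zero hq1
    have h2 := euler_ne_zero (norm_sq_lt_one hq1)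
    field_simp
  have hsgn : 2 * (1 - (Real.sign r : ℂ)) = if r < 0 then 4 else 0 := by
    rcases lt_or_gt_of_ne hr0 with hneg | hpos
    · rw [if_pos hneg, Real.sign_of_neg hneg]
      norm_num
    · rw [if_neg (not_lt.2 hpos.le), Real.sign_of_pos hpos]
      norm_num
  rw [oFun_eq_eta hz, hq, hmain, eta_quotient_of_even hkp hk hw hh, ← hz₁, hsgn, oFun_eq_eta hz1,
    ← hq₁, cpow_neg_half hw0]
  set M := ∑ ν ∈ Finset.range k, (-1) ^ ν * exp (-(2 * Real.pi * I * h' * (ν : ℂ) ^ 2 / k)) *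
            mordellJ k w ((ν : ℝ) / k + r)
  set W := w ^ (1 / 2 : ℂ)
  set E5 := exp (2 * Real.pi * k * r ^ 2 / w)
  split_ifs
  · linear_combination (-(4 * (omega h k ^ 2 / omega h (k / 2)) * W *
      (1 / k * M + I / w * E5))) * hθ
  · linear_combination (-(4 * (omega h k ^ 2 / omega h (k / 2)) * W * (1 / k * M))) * hθ

end

/-! ### Existence and symmetry of the Mordell integrals -/

lemma tendsto_truncatedIntegral {f : ℝ → ℂ} (hf : Integrable f) :
    Tendsto (truncatedIntegral f) (𝓝[>] (0 : ℝ)) (𝓝 (∫ x : ℝ, f x)) := by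
  have hS : ∀ ε : ℝ, MeasurableSet {x : ℝ | ε < |x|} := fun ε =>
    measurableSet_lt measurable_const measurable_id.abs
  have h : ∀ ε, truncatedIntegral f ε = ∫ x, {x : ℝ | ε < |x|}.indicator f x := fun ε =>
    (integral_indicator (hS ε)).symm
  simp only [funext h]
  refine tendsto_integral_filter_of_dominated_convergence (fun x => ‖f x‖)
    (Eventually.of_forall fun ε => hf.aestronglyMeasurable.indicator (hS ε))
    (Eventually.of_forall fun ε => Eventually.of_forall fun x => norm_indicator_le_norm_self f x)
    hf.norm ?_
  have h0 : ∀ᵐ x : ℝ, x ≠ 0 := by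
    simp [ae_iff, measure_singleton]
  filter_upwards [h0] with x hx
  refine tendsto_const_nhds.congr' ?_
  filter_upwards [nhdsWithin_le_nhds (gt_mem_nhds (abs_pos.2 hx))] with ε hε
  exact (Set.indicator_of_mem (s := {x : ℝ | ε < |x|}) hε f).symm

section

variable {k : ℕ} {w : ℂ}

/-- The integrand of `mordellJ`. -/
noncomputable def mordellFun (k : ℕ) (w : ℂ) (c x : ℝ) : ℂ :=
  exp (-(2 * Real.pi * w * x ^ 2 / k)) / mordellDen k w c x

lemma mordellFun_decay (hk : 0 < k) (hw : 0 < w.re) (c : ℝ) :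
    ∃ C R : ℝ, ∀ x : ℝ, R ≤ |x| → ‖mordellFun k w c x‖ ≤ C * (1 + x ^ 2)⁻¹ := by
  obtain ⟨C, R, h⟩ := stripDecay_mordell hk hw c 0 0 0
  refine ⟨C, R, fun x hx => ?_⟩
  have := h x (by simp) (by simp) (by simpa using hx)
  simpa [gaussChar, mordellFun] using this

lemma mordellDen_ofReal_ne_zero (hk : 0 < k) (hw : 0 < w.re) {c x : ℝ}
    (h : x ≠ 0 ∨ ∀ n, poleHeight k c n ≠ 0) : mordellDen k w c x ≠ 0 := by
  intro h0
  obtain ⟨n, hn⟩ := (mordellDen_eq_zero_iff hk hw c x).1 h0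
  have h1 : poleHeight k c n = 0 := by
    have := congrArg Complex.im hn
    rw [poleHeight_im, ofReal_im, eq_comm, mul_eq_zero] at this
    exact this.resolve_right (re_inv_pos hw).ne'
  rcases h with h | h
  · rw [h1] at hn
    simp only [ofReal_zero, mul_zero, zero_div, ofReal_eq_zero] at hn
    exact h hn
  · exact h n h1

lemma continuousOn_mordellFun (hk : 0 < k) (hw : 0 < w.re) {c : ℝ} {S : Set ℝ}
    (h : ∀ x ∈ S, x ≠ 0 ∨ ∀ n, poleHeight k c n ≠ 0) : ContinuousOn (mordellFun k w c) S := by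
  refine ContinuousOn.div (Continuous.continuousOn (by fun_prop))
    ((differentiable_mordellDen k w c).continuous.comp continuous_ofReal).continuousOn
    fun x hx => mordellDen_ofReal_ne_zero hk hw (h x hx)

lemma integrable_mordellFun (hk : 0 < k) (hw : 0 < w.re) {c : ℝ}
    (hc : ∀ n, poleHeight k c n ≠ 0) : Integrable (mordellFun k w c) := by
  obtain ⟨C, R, h⟩ := mordellFun_decay hk hw c
  exact integrableOn_univ.1 (integrableOn_of_decay isClosed_univ
    (continuousOn_mordellFun hk hw fun x _ => Or.inr hc) h)

lemma integrableOn_mordellFun (hk : 0 < k) (hw : 0 < w.re) (c : ℝ) {ε : ℝ} (hε : 0 < ε) :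
    IntegrableOn (mordellFun k w c) {x | ε < |x|} := by
  obtain ⟨C, R, h⟩ := mordellFun_decay hk hw c
  have hcl : IsClosed {x : ℝ | ε ≤ |x|} := isClosed_le continuous_const continuous_abs
  exact (integrableOn_of_decay hcl (continuousOn_mordellFun hk hw fun x hx =>
    Or.inl (abs_pos.1 (hε.trans_le hx))) h).mono_set
      fun x (hx : ε < |x|) => (hx.le : ε ≤ |x|)

/-- The partial fraction identity `1/(1 + u) + 1/(1 + u⁻¹) = 1`. -/
lemma mordellFun_add_neg (hk : 0 < k) (hw : 0 < w.re) {c x : ℝ}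
    (h : x ≠ 0 ∨ ∀ n, poleHeight k c n ≠ 0) :
    mordellFun k w c x + mordellFun k w (-c) (-x) = exp (-(2 * Real.pi * w * x ^ 2 / k)) := by
  have h0 := mordellDen_ofReal_ne_zero hk hw h
  have e : mordellDen k w (-c : ℝ) ((-x : ℝ) : ℂ) =
      1 + (exp (2 * Real.pi * I * c - 2 * Real.pi * w * x / k))⁻¹ := by
    rw [mordellDen, ← exp_neg]
    congr 2
    push_cast
    ring
  rw [mordellFun, mordellFun, e]
  rw [mordellDen] at h0 ⊢
  set u := exp (2 * Real.pi * I * c - 2 * Real.pi * w * x / k) with hu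
  have hu0 : u ≠ 0 := exp_ne_zero _
  have h1 : 1 + u⁻¹ ≠ 0 := by
    intro h2
    apply h0
    field_simp at h2
    linear_combination h2
  have h2 : 1 / (1 + u) + 1 / (1 + u⁻¹) = 1 := by
    rw [div_add_div _ _ h0 h1, div_eq_one_iff_eq (mul_ne_zero h0 h1)]
    field_simp
    ring
  rw [ofReal_neg, neg_sq]
  linear_combination (exp (-(2 * Real.pi * w * x ^ 2 / k))) * h2

lemma poleHeight_neg (k : ℕ) (c : ℝ) (n : ℤ) :
    poleHeight k (-c) n = -poleHeight k c (-1 - n) := by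
  rw [poleHeight, poleHeight]
  push_cast
  ring

lemma mordellJ_add_neg (hk : 0 < k) (hw : 0 < w.re) {c : ℝ} (hc : ∀ n, poleHeight k c n ≠ 0) :
    mordellJ k w c + mordellJ k w (-c) = ∫ x : ℝ, exp (-(2 * Real.pi * w * x ^ 2 / k)) := by
  have hc' : ∀ n, poleHeight k (-c) n ≠ 0 := fun n => by
    rw [poleHeight_neg, neg_ne_zero]
    exact hc _
  have h1 : mordellJ k w (-c) = ∫ x : ℝ, mordellFun k w (-c) (-x) :=
    (integral_neg_eq_self (mordellFun k w (-c)) volume).symm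
  have h2 : mordellJ k w c = ∫ x : ℝ, mordellFun k w c x := rfl
  rw [h1, h2, ← integral_add (integrable_mordellFun hk hw hc)
    (integrable_mordellFun hk hw hc').comp_neg]
  exact integral_congr_ae (Eventually.of_forall fun x => mordellFun_add_neg hk hw (Or.inr hc))

/-- If `2 c` is an integer then the principal value exists and is half a Gaussian integral, even if
the integrand has a pole at `0`. -/
lemma tendsto_truncatedIntegral_mordellFun (hk : 0 < k) (hw : 0 < w.re) {c : ℝ} {n : ℤ}
    (hc : c = -c + n) : Tendsto (truncatedIntegral (mordellFun k w c)) (𝓝[>] (0 : ℝ))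
      (𝓝 ((∫ x : ℝ, exp (-(2 * Real.pi * w * x ^ 2 / k))) / 2)) := by
  have hG : Integrable fun x : ℝ => exp (-(2 * Real.pi * w * x ^ 2 / k)) := by
    have hb : 0 < ((2 * Real.pi / k : ℝ) * w : ℂ).re := by
      rw [re_ofReal_mul]
      have := Real.pi_pos
      positivity
    refine (integrable_cexp_neg_mul_sq hb).congr (Eventually.of_forall fun x => ?_)
    simp only
    congr 1
    push_cast
    ring
  refine ((tendsto_truncatedIntegral hG).div_const 2).congr' ?_
  filter_upwards [self_mem_nhdsWithin] with ε hε
  have hε : 0 < ε := hε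
  have hS : MeasurableSet {x : ℝ | ε < |x|} := measurableSet_lt measurable_const measurable_id.abs
  have hper : mordellFun k w (-c) = mordellFun k w c := by
    funext x
    rw [mordellFun, mordellFun]
    conv_rhs => rw [hc, mordellDen_add_int]
  have h1 : ∫ x in {x : ℝ | ε < |x|}, mordellFun k w (-c) (-x) =
      ∫ x in {x : ℝ | ε < |x|}, mordellFun k w c x := by
    rw [← integral_indicator hS, ← integral_indicator hS, ← hper,
      ← integral_neg_eq_self ({x : ℝ | ε < |x|}.indicator (mordellFun k w (-c)))]
    congr 1
    funext x
    simp [Set.indicator]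
  have hi1 := integrableOn_mordellFun hk hw c hε
  have hi2 : IntegrableOn (fun x => mordellFun k w (-c) (-x)) {x : ℝ | ε < |x|} := by
    rw [hper, ← integrable_indicator_iff hS]
    refine ((integrable_indicator_iff hS).2 hi1).comp_neg.congr (Eventually.of_forall fun x => ?_)
    simp [Set.indicator]
  have h2 : truncatedIntegral (fun x : ℝ => exp (-(2 * Real.pi * w * x ^ 2 / k))) ε =
      truncatedIntegral (mordellFun k w c) ε + truncatedIntegral (mordellFun k w c) ε := by
    conv_rhs => rw [truncatedIntegral]
    nth_rewrite 2 [← h1]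
    rw [truncatedIntegral, ← integral_add hi1 hi2]
    refine setIntegral_congr_fun hS fun x hx => ?_
    exact (mordellFun_add_neg hk hw (Or.inl (abs_pos.1 (hε.trans hx)))).symm
  rw [h2]
  ring

lemma mordellIntegrand_eq_mordellFun_of_even (hk : Even k) (ν : ℤ) (r : ℝ) (w : ℂ) :
    mordellIntegrand 1 k ν r w = mordellFun k w ((ν : ℝ) / k + r) :=
  funext fun x => mordellIntegrand_eq_of_even hk ν r w x

lemma mordellI_eq_of_tendsto (hk : Even k) {ν : ℤ} {r : ℝ} {w l : ℂ}
    (h : Tendsto (truncatedIntegral (mordellFun k w ((ν : ℝ) / k + r))) (𝓝[>] (0 : ℝ)) (𝓝 l)) :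
    mordellI 1 k ν r w = l := by
  rw [mordellI, if_neg (Nat.not_odd_iff_even.2 hk), mordellIntegrand_eq_mordellFun_of_even hk]
  exact h.limUnder_eq

lemma mordellI_eq_of_even (hk : Even k) (hkp : 0 < k) (hw : 0 < w.re) {ν : ℤ} {r : ℝ}
    (hc : ∀ n, poleHeight k ((ν : ℝ) / k + r) n ≠ 0) :
    mordellI 1 k ν r w = mordellJ k w ((ν : ℝ) / k + r) :=
  mordellI_eq_of_tendsto hk (tendsto_truncatedIntegral (integrable_mordellFun hkp hw hc))

lemma eq_neg_add_of_poleHeight_eq_zero (hk : 0 < k) {c : ℝ} {n : ℤ} (h : poleHeight k c n = 0) :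
    c = -c + ((-1 - 2 * n : ℤ) : ℝ) := by
  have hk' : (k : ℝ) ≠ 0 := by exact_mod_cast hk.ne'
  have := (mul_eq_zero.1 h).resolve_left hk'
  push_cast
  linarith

lemma mordellI_zero_add_neg (hk : Even k) (hkp : 0 < k) (hw : 0 < w.re) (ν : ℤ) :
    mordellI 1 k ν 0 w + mordellI 1 k (-ν) 0 w =
      ∫ x : ℝ, exp (-(2 * Real.pi * w * x ^ 2 / k)) := by
  have e : ((-ν : ℤ) : ℝ) / k + 0 = -((ν : ℝ) / k + 0) := by
    push_cast
    ring
  by_cases hc : ∀ n, poleHeight k ((ν : ℝ) / k + 0) n ≠ 0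
  · have hc' : ∀ n, poleHeight k (((-ν : ℤ) : ℝ) / k + 0) n ≠ 0 := fun n => by
      rw [e, poleHeight_neg, neg_ne_zero]
      exact hc _
    rw [mordellI_eq_of_even hk hkp hw hc, mordellI_eq_of_even hk hkp hw hc', e,
      mordellJ_add_neg hkp hw hc]
  · push Not at hc
    obtain ⟨n, hn⟩ := hc
    have h1 := eq_neg_add_of_poleHeight_eq_zero hkp hn
    have h2 : ((-ν : ℤ) : ℝ) / k + 0 = -(((-ν : ℤ) : ℝ) / k + 0) + ((1 + 2 * n : ℤ) : ℝ) := by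
      rw [e]
      push_cast at h1 ⊢
      linarith
    rw [mordellI_eq_of_tendsto hk (tendsto_truncatedIntegral_mordellFun hkp hw h1),
      mordellI_eq_of_tendsto hk (tendsto_truncatedIntegral_mordellFun hkp hw h2), add_halves]

lemma tendsto_mordellI (hk : Even k) (hkp : 0 < k) (hw : 0 < w.re) (ν : ℤ) (r : ℝ) :
    Tendsto (truncatedIntegral (mordellIntegrand 1 k ν r w)) (𝓝[>] (0 : ℝ))
      (𝓝 (mordellI 1 k ν r w)) := by
  rw [mordellIntegrand_eq_mordellFun_of_even hk]
  by_cases hc : ∀ n, poleHeight k ((ν : ℝ) / k + r) n ≠ 0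
  · rw [mordellI_eq_of_even hk hkp hw hc]
    exact tendsto_truncatedIntegral (integrable_mordellFun hkp hw hc)
  · push Not at hc
    obtain ⟨n, hn⟩ := hc
    have h1 := tendsto_truncatedIntegral_mordellFun hkp hw
      (eq_neg_add_of_poleHeight_eq_zero hkp hn)
    rwa [mordellI_eq_of_tendsto hk h1]

/-! ### Symmetry under `r ↦ -r` -/

lemma sum_range_mul_add_sum_range_mul {a F F' : ℤ → ℂ} {g : ℂ} (ha : ∀ n, a (k + n) = a n)
    (ha' : ∀ n, a (-n) = a n) (hF' : ∀ n, F' (k + n) = F' n) (hg : ∀ n, F n + F' (-n) = g) :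
    ∑ n ∈ Finset.range k, a n * F n + ∑ n ∈ Finset.range k, a n * F' n =
      g * ∑ n ∈ Finset.range k, a n := by
  rw [← sum_range_neg_int (k := k) (g := fun n => a n * F' n) (fun n => by rw [ha, hF']),
    ← Finset.sum_add_distrib, Finset.mul_sum]
  refine Finset.sum_congr rfl fun n _ => ?_
  rw [ha', ← hg n]
  ring

/-- The functions `O_r` and `O_{-r}` have a constant sum, by `1/(1 + u) + 1/(1 + u⁻¹) = 1`. -/
lemma oFun_add_oFun_neg {q r : ℂ} (hq0 : q ≠ 0) (hq : ‖q‖ < 1)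
    (h : ∀ n : ℤ, 1 + exp (2 * Real.pi * I * r) * q ^ n ≠ 0) :
    oFun r q + oFun (-r) q = -4 := by
  have hterm : ∀ n : ℤ, oTerm r q n + oTerm (-r) q (-n) = -((-1) ^ n * q ^ (n ^ 2)) := by
    intro n
    have hn := h n
    have hneg : (-1 : ℂ) ^ (-n) = (-1) ^ n := by rw [zpow_neg, ← inv_zpow, inv_neg, inv_one]
    have e : exp (2 * Real.pi * I * -r) = (exp (2 * Real.pi * I * r))⁻¹ := by
      rw [← exp_neg]
      congr 1
      ring
    rw [oTerm, oTerm, zpow_add₀ (neg_ne_zero.2 one_ne_zero), zpow_add₀ (neg_ne_zero.2 one_ne_zero),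
      zpow_one, hneg, neg_sq, e, zpow_neg, ← mul_inv]
    set u := exp (2 * Real.pi * I * r) * q ^ n with hu
    have hu0 : u ≠ 0 := mul_ne_zero (exp_ne_zero _) (zpow_ne_zero _ hq0)
    have h1 : 1 + u⁻¹ ≠ 0 := by
      intro h2
      apply hn
      field_simp at h2
      linear_combination h2
    have h2 : 1 / (1 + u) + 1 / (1 + u⁻¹) = 1 := by
      rw [div_add_div _ _ hn h1, div_eq_one_iff_eq (mul_ne_zero hn h1)]
      field_simp
      ring
    linear_combination (-((-1) ^ n * q ^ (n ^ 2))) * h2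
  have h1 : ∑' n : ℤ, oTerm r q n + ∑' n : ℤ, oTerm (-r) q n = -(euler q ^ 2 / euler (q ^ 2)) := by
    have hs : Summable fun n : ℤ => oTerm (-r) q (-n) :=
      (Equiv.neg ℤ).summable_iff.2 (summable_oTerm hq0 hq)
    rw [← (Equiv.neg ℤ).tsum_eq (oTerm (-r) q), ← tsum_neg_one_zpow_mul hq0 hq, ← tsum_neg,
      ← tsum_congr hterm]
    exact ((summable_oTerm hq0 hq).tsum_add hs).symm
  have h2 := euler_ne_zero hq
  have h3 := euler_ne_zero (norm_sq_lt_one hq)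
  rw [oFun, oFun, ← mul_add, h1, qPochInf_div hq]
  field_simp

/-! ### Nonvanishing of the denominators and integrability -/

lemma oTerm_den_ne_zero (hk : 0 < k) (hw : 0 < w.re) (h : ℤ) {r : ℝ} (hr : |r| < 1 / 2) (n : ℤ) :
    1 + exp (2 * Real.pi * I * r) * exp (2 * Real.pi * I * ((h + I * w) / k)) ^ n ≠ 0 := by
  intro h0
  have hq := norm_exp_two_pi_mul_lt_one (im_pos_of_re_pos hk hw h)
  set q := exp (2 * Real.pi * I * ((h + I * w) / k)) with hqdef
  have hq0 : 0 < ‖q‖ := norm_pos_iff.2 (exp_ne_zero _)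
  have h1 : exp (2 * Real.pi * I * r) * q ^ n = -1 := by linear_combination h0
  have h2 := congrArg norm h1
  rw [norm_mul, show (2 * Real.pi * I * r : ℂ) = ((2 * Real.pi * r : ℝ) : ℂ) * I by push_cast; ring,
    norm_exp_ofReal_mul_I, one_mul, norm_zpow, norm_neg, norm_one,
    zpow_eq_one_iff_right₀ hq0.le hq.ne] at h2
  rw [h2, zpow_zero, mul_one, ← exp_pi_mul_I, exp_eq_exp_iff_exists_int] at h1
  obtain ⟨m, hm⟩ := h1
  have hpi : (Real.pi : ℂ) * I ≠ 0 := mul_ne_zero (by exact_mod_cast Real.pi_ne_zero) I_ne_zero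
  have h3 : (2 * r : ℂ) = 1 + 2 * m := by
    apply mul_left_cancel₀ hpi
    linear_combination hm
  have h4 : 2 * r = 1 + 2 * m := by exact_mod_cast h3
  rw [abs_lt] at hr
  have h5 : (m : ℝ) < 0 := by linarith
  have h6 : (-1 : ℝ) < m := by linarith
  have h7 : m < 0 := by exact_mod_cast h5
  have h8 : -1 < m := by exact_mod_cast h6
  omega

/-- Comparing moduli, a zero forces `k r = n`, hence `n = 0` and `r = 0`, where the value is `2`. -/
lemma oTerm_den_ne_zero' (hk : 0 < k) (hw : 0 < w.re) (h' : ℤ) {r : ℝ} (hr : |r| < 1 / (8 * k))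
    (n : ℤ) : 1 + exp (2 * Real.pi * I * (r / (I * w))) *
      exp (2 * Real.pi * I * ((h' + I / w) / k)) ^ n ≠ 0 := by
  intro h0
  have hw0 : w ≠ 0 := ne_zero_of_re_pos hw
  have hk0 : (k : ℂ) ≠ 0 := by exact_mod_cast hk.ne'
  have e : (2 * Real.pi * I * (r / (I * w)) + n * (2 * Real.pi * I * ((h' + I / w) / k)) : ℂ) =
      ((2 * Real.pi * h' * n / k : ℝ) : ℂ) * I + ((2 * Real.pi / k * (k * r - n) : ℝ) : ℂ) *
        (1 / w) := by
    push_cast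
    field_simp
    linear_combination (n : ℂ) * I_sq
  rw [← exp_int_mul, ← exp_add, e] at h0
  have h1 := congrArg norm (eq_neg_of_add_eq_zero_right h0)
  rw [norm_exp, norm_neg, norm_one, Real.exp_eq_one_iff, add_re, re_ofReal_mul, re_ofReal_mul,
    I_re, mul_zero, zero_add] at h1
  have h2 : (k : ℝ) * r - n = 0 := by
    have h3 := (mul_eq_zero.1 h1).resolve_right (re_inv_pos hw).ne'
    refine (mul_eq_zero.1 h3).resolve_left ?_
    have := Real.pi_pos
    positivity
  have hkr := abs_lt.1 (abs_mul_lt_of_abs_lt hk hr)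
  have hn : n = 0 := by
    have h5 : (n : ℝ) < 1 := by linarith
    have h6 : (-1 : ℝ) < n := by linarith
    have h7 : n < 1 := by exact_mod_cast h5
    have h8 : -1 < n := by exact_mod_cast h6
    omega
  rw [h2, hn] at h0
  norm_num at h0

lemma uTerm_den_ne_zero (hk : 0 < k) (hw : 0 < w.re) (h' : ℤ) {r : ℝ} (hr : |r| < 1 / (8 * k))
    {m : ℤ} (hm : m ≠ 0) : 1 - exp (2 * Real.pi * I * (I * r / w)) *
      exp (2 * Real.pi * I * ((h' + I / w) / k / 2)) ^ m ≠ 0 := by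
  intro h0
  have hw0 : w ≠ 0 := ne_zero_of_re_pos hw
  have hk0 : (k : ℂ) ≠ 0 := by exact_mod_cast hk.ne'
  have e : (2 * Real.pi * I * (I * r / w) + m * (2 * Real.pi * I * ((h' + I / w) / k / 2)) : ℂ) =
      ((Real.pi * h' * m / k : ℝ) : ℂ) * I + ((-(Real.pi / k * (2 * (k * r) + m)) : ℝ) : ℂ) *
        (1 / w) := by
    push_cast
    field_simp
    linear_combination (2 * k * r + m : ℂ) * I_sq
  rw [← exp_int_mul, ← exp_add, e] at h0
  have h1 := congrArg norm (sub_eq_zero.1 h0)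
  rw [norm_exp, norm_one, eq_comm, Real.exp_eq_one_iff, add_re, re_ofReal_mul, re_ofReal_mul,
    I_re, mul_zero, zero_add] at h1
  have h2 : 2 * ((k : ℝ) * r) + m = 0 := by
    have h3 := neg_eq_zero.1 ((mul_eq_zero.1 h1).resolve_right (re_inv_pos hw).ne')
    refine (mul_eq_zero.1 h3).resolve_left ?_
    have := Real.pi_pos
    positivity
  have hkr := abs_lt.1 (abs_mul_lt_of_abs_lt hk hr)
  apply hm
  have h5 : (m : ℝ) < 1 := by linarith
  have h6 : (-1 : ℝ) < m := by linarith
  have h7 : m < 1 := by exact_mod_cast h5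
  have h8 : -1 < m := by exact_mod_cast h6
  omega

end

section

variable {k : ℕ} {w : ℂ}

lemma poleHeight_ne_zero_of_even (hk : Even k) (hkp : 0 < k) {r : ℝ} (hr : |r| < 1 / (8 * k))
    (hr0 : r ≠ 0) (ν n : ℤ) : poleHeight k ((ν : ℝ) / k + r) n ≠ 0 := by
  rw [poleHeight_eq_poleT hkp]
  exact poleT_ne_zero_of_even hk hkp hr hr0 _

lemma integrable_mordellIntegrand_of_even (hk : Even k) (hkp : 0 < k) (hw : 0 < w.re) {r : ℝ}
    (hr : |r| < 1 / (8 * k)) (hr0 : r ≠ 0) (ν : ℤ) : Integrable (mordellIntegrand 1 k ν r w) := by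
  rw [mordellIntegrand_eq_mordellFun_of_even hk]
  exact integrable_mordellFun hkp hw (poleHeight_ne_zero_of_even hk hkp hr hr0 ν)

lemma integrable_mordellIntegrand_of_odd (hk : Odd k) (hw : 0 < w.re) {r : ℝ}
    (hr : |r| < 1 / (8 * k)) {σ : ℤ} (hσ : σ = 1 ∨ σ = -1) (ν : ℤ) :
    Integrable (mordellIntegrand σ k ν r w) := by
  have hk' : (0 : ℝ) < k := by exact_mod_cast hk.pos
  have e : mordellIntegrand σ k ν r w =
      mordellFun k w (σ * ((ν : ℝ) / k - 1 / (4 * k)) + r) :=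
    funext fun x => mordellIntegrand_eq_of_odd hk σ ν r w x
  rw [e]
  refine integrable_mordellFun hk.pos hw fun n hn => ?_
  have hkr := abs_lt.1 (abs_mul_lt_of_abs_lt hk.pos hr)
  -- four times the height is an odd integer up to `4 k r`, which is less than `1 / 2`
  have h4 : ((4 * σ * ν - σ + 2 * k + 4 * k * n : ℤ) : ℝ) + 4 * (k * r) = 0 := by
    have : 4 * poleHeight k (σ * ((ν : ℝ) / k - 1 / (4 * k)) + r) n = 0 := by rw [hn, mul_zero]
    rw [← this, poleHeight]
    push_cast
    field_simp
    ring
  have h5 : ((4 * σ * ν - σ + 2 * k + 4 * k * n : ℤ) : ℝ) < 1 := by linarith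
  have h6 : (-1 : ℝ) < ((4 * σ * ν - σ + 2 * k + 4 * k * n : ℤ) : ℝ) := by linarith
  have h7 : 4 * σ * ν - σ + 2 * k + 4 * k * n < 1 := by exact_mod_cast h5
  have h8 : -1 < 4 * σ * ν - σ + 2 * k + 4 * k * n := by exact_mod_cast h6
  have h9 : 2 * (2 * (σ * ν) + k + 2 * (k * n)) = σ := by linarith
  rcases hσ with rfl | rfl <;> omega

/-! ### The case of even `k` and `r = 0` -/

/-- For `k` even and `r = 0` everything is explicit: `O_0 = -2`, and the integrals `I_ν` and
`I_{-ν}` add up to a Gaussian integral. The value of their weighted sum is found by adding the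
transformations for `r` and `-r`. -/
theorem oFun_zero_of_even (hk : Even k) (hkp : 0 < k) (hw : 0 < w.re) {h h' : ℤ}
    (hh : h * h' ≡ -1 [ZMOD (k : ℤ)]) :
    oFun 0 (exp (2 * Real.pi * I * ((h + I * w) / k))) =
      -(4 * omega h k ^ 2 * w ^ (1 / 2 : ℂ) / (k * omega h (k / 2)) *
          ∑ ν ∈ Finset.range k, (-1) ^ ν * exp (-(2 * Real.pi * I * h' * (ν : ℂ) ^ 2 / k)) *
            mordellI 1 k ν 0 w) ∧
    oFun 0 (exp (2 * Real.pi * I * ((h' + I / w) / k))) = -2 := by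
  have hk' : (0 : ℝ) < k := by exact_mod_cast hkp
  have hk0 : (k : ℂ) ≠ 0 := by exact_mod_cast hkp.ne'
  set q := exp (2 * Real.pi * I * ((h + I * w) / k)) with hq
  set q₁ := exp (2 * Real.pi * I * ((h' + I / w) / k)) with hq₁
  have hq1 : ‖q‖ < 1 := norm_exp_two_pi_mul_lt_one (im_pos_of_re_pos hkp hw h)
  have hq11 : ‖q₁‖ < 1 := norm_exp_two_pi_mul_lt_one (im_inv_pos_of_re_pos hkp hw h')
  set r : ℝ := 1 / (16 * k) with hr
  have hrpos : 0 < r := by positivity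
  have hrlt : |r| < 1 / (8 * k) := by
    rw [abs_of_pos hrpos, hr]
    exact one_div_lt_one_div_of_lt (by positivity) (by linarith)
  have hrlt' : |-r| < 1 / (8 * k) := by rwa [abs_neg]
  have hr2 : |r| < 1 / 2 := hrlt.trans_le (by
    have : (1 : ℝ) ≤ k := by exact_mod_cast hkp
    exact one_div_le_one_div_of_le (by norm_num) (by linarith))
  have f1 := oFun_of_even hk hkp hw hh hrlt hrpos.ne'
  have f2 := oFun_of_even hk hkp hw hh hrlt' (neg_ne_zero.2 hrpos.ne')
  have g1 : oFun r q + oFun (-r) q = -4 :=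
    oFun_add_oFun_neg (exp_ne_zero _) hq1 (oTerm_den_ne_zero hkp hw h hr2)
  have g2 : oFun (r / (I * w)) q₁ + oFun (-(r / (I * w))) q₁ = -4 :=
    oFun_add_oFun_neg (exp_ne_zero _) hq11 (oTerm_den_ne_zero' hkp hw h' hrlt)
  have g3 : oFun 0 q + oFun (-0) q = -4 := oFun_add_oFun_neg (exp_ne_zero _) hq1 fun n => by
    simpa using oTerm_den_ne_zero hkp hw h (r := 0) (by norm_num) n
  have g4 : oFun 0 q₁ + oFun (-0) q₁ = -4 := oFun_add_oFun_neg (exp_ne_zero _) hq11 fun n => by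
    simpa using oTerm_den_ne_zero' hkp hw h' (r := 0) (by rw [abs_zero]; positivity) n
  rw [neg_zero] at g3 g4
  -- the weights of the integrals
  set a : ℤ → ℂ := fun ν => (-1) ^ ν * exp (-(2 * Real.pi * I * h' * (ν : ℂ) ^ 2 / k)) with ha
  have ha1 : ∀ n, a (k + n) = a n := fun n => by
    simp only [ha]
    rw [zpow_add₀ (neg_ne_zero.2 one_ne_zero), zpow_natCast, hk.neg_one_pow, one_mul]
    congr 1
    rw [exp_eq_exp_iff_exists_int]
    refine ⟨-(h' * (k + 2 * n)), ?_⟩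
    push_cast
    field_simp
    ring
  have ha2 : ∀ n, a (-n) = a n := fun n => by
    simp only [ha]
    rw [zpow_neg, ← inv_zpow, inv_neg, inv_one, Int.cast_neg, neg_sq]
  set g := ∫ x : ℝ, exp (-(2 * Real.pi * w * x ^ 2 / k)) with hg
  have s1 := sum_range_mul_add_sum_range_mul (k := k) (a := a)
    (F := fun n : ℤ => mordellJ k w ((n : ℝ) / k + r))
    (F' := fun n : ℤ => mordellJ k w ((n : ℝ) / k + -r)) (g := g) ha1 ha2
    (fun n => by
      rw [show ((k + n : ℤ) : ℝ) / k + -r = (n : ℝ) / k + -r + (1 : ℤ) by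
        push_cast
        field_simp
        ring, mordellJ_add_int])
    (fun n => by
      rw [hg, ← mordellJ_add_neg hkp hw (poleHeight_ne_zero_of_even hk hkp hrlt hrpos.ne' n)]
      congr 2
      push_cast
      ring)
  have s2 := sum_range_mul_add_sum_range_mul (k := k) (a := a)
    (F := fun n : ℤ => mordellI 1 k n 0 w) (F' := fun n : ℤ => mordellI 1 k n 0 w) (g := g) ha1 ha2
    (fun n => by
      have e : mordellIntegrand 1 k (k + n) 0 w = mordellIntegrand 1 k n 0 w := by
        rw [mordellIntegrand_eq_mordellFun_of_even hk, mordellIntegrand_eq_mordellFun_of_even hk]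
        funext x
        rw [mordellFun, mordellFun, show ((k + n : ℤ) : ℝ) / k + 0 = (n : ℝ) / k + 0 + (1 : ℤ) by
          push_cast
          field_simp
          ring, mordellDen_add_int]
      rw [mordellI, mordellI, e])
    (fun n => mordellI_zero_add_neg hk hkp hw n)
  have hcast : ∀ n : ℕ, a n = (-1) ^ n * exp (-(2 * Real.pi * I * h' * (n : ℂ) ^ 2 / k)) :=
    fun n => by
      simp only [ha]
      rw [zpow_natCast, Int.cast_natCast]
  simp only [hcast, Int.cast_natCast] at s1 s2
  rw [← hq, ← hq₁, Real.sign_of_pos hrpos] at f1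
  rw [← hq, ← hq₁, Real.sign_of_neg (neg_neg_of_pos hrpos), ofReal_neg, neg_div, neg_sq] at f2
  refine ⟨?_, by linear_combination (1 / 2 : ℂ) * g4⟩
  set M1 := ∑ ν ∈ Finset.range k, (-1 : ℂ) ^ ν * exp (-(2 * Real.pi * I * h' * (ν : ℂ) ^ 2 / k)) *
    mordellJ k w ((ν : ℝ) / k + r)
  set M2 := ∑ ν ∈ Finset.range k, (-1 : ℂ) ^ ν * exp (-(2 * Real.pi * I * h' * (ν : ℂ) ^ 2 / k)) *
    mordellJ k w ((ν : ℝ) / k + -r)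
  set M0 := ∑ ν ∈ Finset.range k, (-1 : ℂ) ^ ν * exp (-(2 * Real.pi * I * h' * (ν : ℂ) ^ 2 / k)) *
    mordellI 1 k ν 0 w
  have hM : 2 * M0 = M1 + M2 := by linear_combination s2 - s1
  push_cast at f1 f2
  set c := -I * (omega h k ^ 2 / omega h (k / 2)) * w ^ (-(1 / 2) : ℂ) *
          exp (2 * Real.pi * k * r ^ 2 / w)
  set d := 4 * omega h k ^ 2 * w ^ (1 / 2 : ℂ) / (k * omega h (k / 2))
  linear_combination (1 / 2 : ℂ) * g3 - (1 / 2 : ℂ) * g1 + (1 / 2 : ℂ) * f1 + (1 / 2 : ℂ) * f2 +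
    (1 / 2 : ℂ) * c * g2 + (d / 2) * hM

end

end OverpartitionRank

theorem theorem4p1 (k : ℕ) (hk : 0 < k) :
    ∃ δ : ℝ, 0 < δ ∧ ∀ (h h' : ℤ), h * h' ≡ -1 [ZMOD (k : ℤ)] →
      ∀ (w : ℂ), 0 < w.re → ∀ (r : ℝ), |r| < δ →
      ∀ (q q₁ z₁ : ℂ), q = exp (2 * Real.pi * I / k * (h + I * w)) →
        z₁ = (h' + I / w) / k → q₁ = exp (2 * Real.pi * I * z₁) →
      -- the series defining `O_r(q)` has no vanishing denominator and converges
      ((∀ n : ℤ, 1 + exp (2 * Real.pi * I * r) * q ^ n ≠ 0) ∧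
        Summable (OverpartitionRank.oTerm r q)) ∧
      -- `k` odd, where `h'` is chosen even and `q₁^{1/2} = e^{2πi(z₁/2)}`
      (Odd k → Even h' →
        (∀ m : ℤ, Odd m → 1 - exp (2 * Real.pi * I * (I * r / w)) *
          exp (2 * Real.pi * I * (z₁ / 2)) ^ m ≠ 0) ∧
        Summable (fun m : {m : ℤ // Odd m} =>
          OverpartitionRank.uTerm (I * r / w) (z₁ / 2) m) ∧
        (∀ ν : ℤ, Integrable (OverpartitionRank.mordellIntegrand 1 k ν r w) ∧
          Integrable (OverpartitionRank.mordellIntegrand (-1) k ν r w)) ∧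
        OverpartitionRank.oFun r q =
          -2 * (Real.sqrt 2 : ℂ) * I * w ^ (-(1 / 2) : ℂ) *
              (OverpartitionRank.omega h k ^ 2 / OverpartitionRank.omega (2 * h) k) *
              exp (Real.pi * I * h' / (8 * k) + 2 * Real.pi * k * r ^ 2 / w) *
              OverpartitionRank.uFun (I * r / w) (z₁ / 2)
          - 2 * (Real.sqrt 2 : ℂ) * w ^ (1 / 2 : ℂ) *
              (OverpartitionRank.omega h k ^ 2 / OverpartitionRank.omega (2 * h) k) * (1 / k) *
              ∑ ν ∈ Finset.range k,
                exp (2 * Real.pi * I * h' / k * (-(ν : ℂ) ^ 2 + (ν : ℂ) / 2)) *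
                  (OverpartitionRank.mordellI 1 k ν r w +
                    OverpartitionRank.mordellI (-1) k ν r w)) ∧
      -- `k` even
      (Even k →
        (∀ n : ℤ, 1 + exp (2 * Real.pi * I * (r / (I * w))) * q₁ ^ n ≠ 0) ∧
        Summable (OverpartitionRank.oTerm (r / (I * w)) q₁) ∧
        (r ≠ 0 → ∀ ν : ℤ, Integrable (OverpartitionRank.mordellIntegrand 1 k ν r w)) ∧
        (∀ ν : ℤ, Tendsto (OverpartitionRank.truncatedIntegral
            (OverpartitionRank.mordellIntegrand 1 k ν r w)) (𝓝[>] (0 : ℝ))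
          (𝓝 (OverpartitionRank.mordellI 1 k ν r w))) ∧
        OverpartitionRank.oFun r q =
          -I * (OverpartitionRank.omega h k ^ 2 / OverpartitionRank.omega h (k / 2)) *
              w ^ (-(1 / 2) : ℂ) * exp (2 * Real.pi * k * r ^ 2 / w) *
              (OverpartitionRank.oFun (r / (I * w)) q₁ + 2 * (1 - (Real.sign r : ℂ)))
          - 4 * OverpartitionRank.omega h k ^ 2 * w ^ (1 / 2 : ℂ) /
              (k * OverpartitionRank.omega h (k / 2)) *
              ∑ ν ∈ Finset.range k, (-1) ^ ν *
                exp (-(2 * Real.pi * I * h' * (ν : ℂ) ^ 2 / k)) *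
                  OverpartitionRank.mordellI 1 k ν r w) := by
  refine ⟨1 / (8 * k), by positivity, ?_⟩
  rintro h h' hh w hw r hr q q₁ z₁ rfl rfl rfl
  have hq : (2 * Real.pi * I / k * (h + I * w) : ℂ) = 2 * Real.pi * I * ((h + I * w) / k) := by
    ring
  have hz1 := OverpartitionRank.im_inv_pos_of_re_pos hk hw h'
  have hr2 : |r| < 1 / 2 := hr.trans_le (by
    have : (1 : ℝ) ≤ k := by exact_mod_cast hk
    exact one_div_le_one_div_of_le (by norm_num) (by linarith))
  rw [hq]
  refine ⟨⟨OverpartitionRank.oTerm_den_ne_zero hk hw h hr2,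
    OverpartitionRank.summable_oTerm (exp_ne_zero _)
      (OverpartitionRank.norm_exp_two_pi_mul_lt_one (OverpartitionRank.im_pos_of_re_pos hk hw h))⟩,
    fun hodd hh' => ?_, fun heven => ?_⟩
  · have hz2 : 0 < ((h' + I / w) / k / 2 : ℂ).im := by
      rw [show ((h' + I / w) / k / 2 : ℂ) = (h' + I / w) / k / ((2 : ℝ) : ℂ) by norm_num,
        div_ofReal_im]
      positivity
    refine ⟨fun m hm => OverpartitionRank.uTerm_den_ne_zero hk hw h' hr fun h0 => ?_,
      (OverpartitionRank.summable_uTerm hz2).comp_injective Subtype.val_injective,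
      fun ν => ⟨OverpartitionRank.integrable_mordellIntegrand_of_odd hodd hw hr (Or.inl rfl) ν,
        OverpartitionRank.integrable_mordellIntegrand_of_odd hodd hw hr (Or.inr rfl) ν⟩,
      OverpartitionRank.oFun_of_odd hodd hw hh hh' hr⟩
    rw [h0] at hm
    exact absurd hm (by decide)
  · refine ⟨OverpartitionRank.oTerm_den_ne_zero' hk hw h' hr,
      OverpartitionRank.summable_oTerm (exp_ne_zero _)
      (OverpartitionRank.norm_exp_two_pi_mul_lt_one hz1),
      fun hr0 => OverpartitionRank.integrable_mordellIntegrand_of_even heven hk hw hr hr0,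
      fun ν => OverpartitionRank.tendsto_mordellI heven hk hw ν r, ?_⟩
    by_cases hr0 : r = 0
    · obtain ⟨h1, h2⟩ := OverpartitionRank.oFun_zero_of_even heven hk hw hh
      rw [hr0, ofReal_zero, zero_div, Real.sign_zero, h1, h2]
      push_cast
      ring
    · rw [OverpartitionRank.oFun_of_even heven hk hw hh hr hr0]
      congr 2
      refine Finset.sum_congr rfl fun ν _ => ?_
      have hI := OverpartitionRank.mordellI_eq_of_even heven hk hw (ν := (ν : ℤ))
        (OverpartitionRank.poleHeight_ne_zero_of_even heven hk hr hr0 ν)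
      rw [Int.cast_natCast] at hI
      rw [hI]
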